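/- Let $\Bbbk$ be an algebraically closed field of characteristic $0$ and let $H$ be a finite-dimensional cocommutative Hopf algebra over $\Bbbk$, with antipode $S$ and counit $\varepsilon$, regarded as quasi-triangular with $\mathcal R=1\otimes1$. Let $\mathcal C=H\text{-mod}$ be the category of finite-dimensional left $H$-modules, which is then symmetric monoidal with the flip $c$ as braiding. **The elliptic Drinfeld center.** A half-braiding on $X\in\mathcal C$ is a natural isomorphism $\lambda_A:A\otimes X\to X\otimes A$ with $\lambda_{A\otimes B}=(\lambda_A\otimes\mathrm{id}_B)(\mathrm{id}_A\otimes\lambda_B)$. Objects of $\mathcal Z^{el}(\mathcal C)$ are triples $(X,\lambda^1,\lambda^2)$ of an object and two half-braidings on it such that, for all $A,B\in\mathcal C$, as maps $A\otimes B\otimes X\to X\otimes B\otimes A$, $$(\mathrm{id}_X\otimes c_{A,B})(\lambda^1_A\otimes\mathrm{id}_B)(\mathrm{id}_A\otimes\lambda^2_B)=(\lambda^2_B\otimes\mathrm{id}_A)(\mathrm{id}_B\otimes\lambda^1_A)(c_{B,A}^{-1}\otimes\mathrm{id}_X);$$ morphisms are the morphisms of $\mathcal C$ that intertwine both half-braidings.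 Its naive tensor product is $(X,\lambda^1,\lambda^2)\otimes(Y,\mu^1,\mu^2)=(X\otimes Y,\lambda^1\otimes\mu^1,\lambda^2\otimes\mu^2)$ with $(\lambda\otimes\mu)_A=(\mathrm{id}_X\otimes\mu_A)(\lambda_A\otimes\mathrm{id}_Y)$, and with the associativity and unit constraints of $\mathcal C$. **The elliptic Drinfeld double.** Let $H_1^*,H_2^*$ be two copies of the dual $H^*$ with the convolution product. $\mathcal D^{el}(H)$ is the algebra generated by $H$, $H_1^*$ and $H_2^*$ (each included by an algebra map, $\iota_i$ denoting the inclusion of $H_i^*$), subject to $$f\,h=\sum h_2\; f\big(h_3\,(\cdot)\,S^{-1}(h_1)\big)\quad(h\in H,\ f\in H_i^{*},\ i=1,2),\qquad f^2f^1=f^1f^2\quad(f^1\in H_1^{*},\ f^2\in H_2^{*}),$$ the second relation being the case $\mathcal R=1\otimes 1$ of the relation between $H_1^*$ and $H_2^*$ for a general R-matrix. Let $H^{*,\mathrm{cop}}$ be the coalgebra $H^*$ with counit $f\mapsto f(1)$ and coproduct $f\mapsto\sum g_i\otimes h_i$ where $f(ba)=\sum g_i(a)h_i(b)$. **Theorem.**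 1. The map $H\otimes H_1^{*,\mathrm{cop}}\otimes H_2^{*,\mathrm{cop}}\to\mathcal D^{el}(H)$, $h\otimes f^1\otimes f^2\mapsto h\,f^1f^2$, is bijective, and $\mathcal D^{el}(H)$ is a Hopf algebra whose coalgebra structure is componentwise, i.e. for which this map is an isomorphism of coalgebras. Its antipode is $S(h\,f^1f^2)=(f^2\circ S^{-1})(f^1\circ S^{-1})\,S(h)$. If $v\in H$ is a pivotal element of $H$ (group-like with $S^2(x)=vxv^{-1}$), then $v$ is a pivotal element of $\mathcal D^{el}(H)$; if $v$ is spherical (pivotal, and $\operatorname{tr}_V(v\theta)=\operatorname{tr}_V(v^{-1}\theta)$ for all endomorphisms $\theta$ of finite-dimensional modules $V$), then $v$ is spherical for $\mathcal D^{el}(H)$. In particular $\mathcal D^{el}(H)$ is a spherical Hopf algebra (take $v=1$). 2. With respect to the naive tensor product on $\mathcal Z^{el}(\mathcal C)$ and the tensor product on $\mathcal D^{el}(H)\text{-mod}$ (finite-dimensional modules) given by this Hopf structure, the equivalence $\mathcal Z^{el}(\mathcal C)\simeq\mathcal D^{el}(H)\text{-mod}$ is a tensor equivalence. Here $(X,\lambda^1,\lambda^2)$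 corresponds to the vector space $X$ on which $H$ acts as given and $$\iota_i(f)\cdot x=(\mathrm{id}_X\otimes f)\big(\lambda^i_H(1\otimes x)\big)\qquad(f\in H^*,\ i=1,2),$$ and its tensor structure is the identity on underlying vector spaces (so the equivalence is compatible, as a tensor functor, with the forgetful functors to vector spaces). -/

import Mathlib

open CategoryTheory MonoidalCategory
open scoped TensorProduct

universe u

noncomputable section

namespace Elliptic

/-! ## The elliptic Drinfeld center -/

section EllipticCenter

universe v₁ u₁

variable {C : Type u₁} [Category.{v₁} C] [MonoidalCategory C]

/-- A half-braiding `λ_A : A ⊗ X ≅ X ⊗ A` on `X`, in the convention in which the tested object `A`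
starts on the left.  Mathlib's `HalfBraiding X` consists of isomorphisms `β_A : X ⊗ A ≅ A ⊗ X`,
natural in `A` and with `β_{A ⊗ B} = (A ◁ β_B) ∘ (β_A ▷ B)`; the two notions correspond by
`λ_A = (β_A)⁻¹`, which is natural in `A` with `λ_{A ⊗ B} = (λ_A ▷ B) ∘ (A ◁ λ_B)`. -/
def lam {X : C} (b : HalfBraiding X) (A : C) : A ⊗ X ≅ X ⊗ A := (b.β A).symm

variable [BraidedCategory C]

/-- The compatibility condition COMM between two half-braidings on `X`: for all `A`, `B`, the
composites `A ⊗ B ⊗ X ⟶ X ⊗ B ⊗ A` given by `(X ◁ c_{A,B}) ∘ (λ¹_A ▷ B) ∘ (A ◁ λ²_B)` and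
`(λ²_B ▷ A) ∘ (B ◁ λ¹_A) ∘ (c_{B,A}⁻¹ ▷ X)` agree. -/
def Comm {X : C} (b₁ b₂ : HalfBraiding X) : Prop :=
  ∀ A B : C,
    A ◁ (lam b₂ B).hom ≫ (α_ A X B).inv ≫ (lam b₁ A).hom ▷ B ≫ (α_ X A B).hom ≫
        X ◁ (β_ A B).hom =
      (α_ A B X).inv ≫ (β_ B A).inv ▷ X ≫ (α_ B A X).hom ≫ B ◁ (lam b₁ A).hom ≫
        (α_ B X A).inv ≫ (lam b₂ B).hom ▷ A ≫ (α_ X B A).hom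

end EllipticCenter

/-- The elliptic Drinfeld center of a braided monoidal category: objects `(X, λ¹, λ²)` with two
half-braidings that satisfy COMM. -/
structure EllipticCenter (C : Type*) [Category* C] [MonoidalCategory C] [BraidedCategory C] where
  X : C
  b₁ : HalfBraiding X
  b₂ : HalfBraiding X
  comm : Comm b₁ b₂

namespace EllipticCenter

universe v₁ u₁

variable {C : Type u₁} [Category.{v₁} C] [MonoidalCategory C]

/-- Intertwining `λ` is the same as intertwining `λ⁻¹`. -/
theorem comm_iff {X Y : C} (b : HalfBraiding X) (b' : HalfBraiding Y) (f : X ⟶ Y) (A : C) :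
    (lam b A).hom ≫ f ▷ A = A ◁ f ≫ (lam b' A).hom ↔
      f ▷ A ≫ (b'.β A).hom = (b.β A).hom ≫ A ◁ f := by
  simp only [lam, Iso.symm_hom]
  rw [Iso.inv_comp_eq, ← Category.assoc, Iso.eq_comp_inv]

section Category

variable [BraidedCategory C]

/-- The first half-braiding of an object. -/
abbrev lam₁ (Z : EllipticCenter C) (A : C) : A ⊗ Z.X ≅ Z.X ⊗ A := lam Z.b₁ A

/-- The second half-braiding of an object. -/
abbrev lam₂ (Z : EllipticCenter C) (A : C) : A ⊗ Z.X ≅ Z.X ⊗ A := lam Z.b₂ A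

/-- The object `(X, λ¹)` of the Drinfeld center. -/
def fst (Z : EllipticCenter C) : Center C := ⟨Z.X, Z.b₁⟩

/-- The object `(X, λ²)` of the Drinfeld center. -/
def snd (Z : EllipticCenter C) : Center C := ⟨Z.X, Z.b₂⟩

/-- Morphisms are the morphisms of `C` that intertwine both half-braidings. -/
@[ext]
structure Hom (Z W : EllipticCenter C) where
  f : Z.X ⟶ W.X
  comm₁ : ∀ A : C, (Z.lam₁ A).hom ≫ f ▷ A = A ◁ f ≫ (W.lam₁ A).hom
  comm₂ : ∀ A : C, (Z.lam₂ A).hom ≫ f ▷ A = A ◁ f ≫ (W.lam₂ A).hom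

instance : Category (EllipticCenter C) where
  Hom := Hom
  id Z := ⟨𝟙 Z.X, by simp, by simp⟩
  comp f g := ⟨f.f ≫ g.f,
    fun A => by
      rw [comp_whiskerRight, ← Category.assoc, f.comm₁, Category.assoc, g.comm₁,
        MonoidalCategory.whiskerLeft_comp, Category.assoc],
    fun A => by
      rw [comp_whiskerRight, ← Category.assoc, f.comm₂, Category.assoc, g.comm₂,
        MonoidalCategory.whiskerLeft_comp, Category.assoc]⟩

@[ext]
theorem hom_ext {Z W : EllipticCenter C} (f g : Z ⟶ W) (h : f.f = g.f) : f = g := Hom.ext h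

@[simp] theorem id_f (Z : EllipticCenter C) : Hom.f (𝟙 Z) = 𝟙 Z.X := rfl

@[simp] theorem comp_f {Z W U : EllipticCenter C} (f : Z ⟶ W) (g : W ⟶ U) :
    (f ≫ g).f = f.f ≫ g.f := rfl

variable (C) in
/-- The forgetful functor `(X, λ¹, λ²) ↦ X`. -/
@[simps]
def forget : EllipticCenter C ⥤ C where
  obj Z := Z.X
  map f := f.f

instance : (forget C).Faithful where
  map_injective h := hom_ext _ _ h

theorem Hom.comm₁' {Z W : EllipticCenter C} (f : Z ⟶ W) (A : C) :
    f.f ▷ A ≫ (W.b₁.β A).hom = (Z.b₁.β A).hom ≫ A ◁ f.f :=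
  (comm_iff _ _ _ _).1 (f.comm₁ A)

theorem Hom.comm₂' {Z W : EllipticCenter C} (f : Z ⟶ W) (A : C) :
    f.f ▷ A ≫ (W.b₂.β A).hom = (Z.b₂.β A).hom ≫ A ◁ f.f :=
  (comm_iff _ _ _ _).1 (f.comm₂ A)

/-- The morphism of the Drinfeld center given by intertwining the first half-braidings. -/
def homFst {Z W : EllipticCenter C} (f : Z ⟶ W) : Z.fst ⟶ W.fst := ⟨f.f, Hom.comm₁' f⟩

/-- The morphism of the Drinfeld center given by intertwining the second half-braidings. -/
def homSnd {Z W : EllipticCenter C} (f : Z ⟶ W) : Z.snd ⟶ W.snd := ⟨f.f, Hom.comm₂' f⟩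

/-- A morphism of `C` that underlies morphisms `(X, λ¹) ⟶ (Y, μ¹)` and `(X, λ²) ⟶ (Y, μ²)` of the
Drinfeld center. -/
def mkHom {Z W : EllipticCenter C} (f : Z.X ⟶ W.X) (g₁ : Z.fst ⟶ W.fst) (g₂ : Z.snd ⟶ W.snd)
    (h₁ : g₁.f = f) (h₂ : g₂.f = f) : Z ⟶ W :=
  ⟨f, fun A => (comm_iff _ _ _ _).2 (by subst h₁; exact g₁.comm A),
    fun A => (comm_iff _ _ _ _).2 (by subst h₂; exact g₂.comm A)⟩

end Category

/-! ### The naive tensor product over a symmetric monoidal category -/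

/-- The tensor product of half-braidings,
`(λ ⊗ μ)_A = (X ◁ μ_A) ∘ (λ_A ▷ Y)`; this is Mathlib's tensor product of half-braidings. -/
def tensorHB {X Y : C} (b : HalfBraiding X) (b' : HalfBraiding Y) : HalfBraiding (X ⊗ Y) :=
  (Center.tensorObj ⟨X, b⟩ ⟨Y, b'⟩).2

theorem lam_tensorHB {X Y : C} (b : HalfBraiding X) (b' : HalfBraiding Y) (A : C) :
    (lam (tensorHB b b') A).hom =
      (α_ A X Y).inv ≫ (lam b A).hom ▷ Y ≫ (α_ X A Y).hom ≫ X ◁ (lam b' A).hom ≫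
        (α_ X Y A).inv := by
  simp [lam, tensorHB, Center.tensorObj]

variable [SymmetricCategory C]

theorem comm_tensorHB {X Y : C} {b₁ b₂ : HalfBraiding X} {c₁ c₂ : HalfBraiding Y}
    (hb : Comm b₁ b₂) (hc : Comm c₁ c₂) : Comm (tensorHB b₁ c₁) (tensorHB b₂ c₂) := by
  intro A B
  have hb := hb A B
  have hc := hc A B
  simp only [lam_tensorHB]
  have hsym : (β_ A B).hom = (β_ B A).inv := by
    rw [← cancel_mono (β_ B A).hom]; simp
  rw [hsym] at hb hc ⊢
  calc
    _ = 𝟙 _ ⊗≫ A ◁ (lam b₂ B).hom ▷ Y ⊗≫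
          ((A ⊗ X) ◁ (lam c₂ B).hom ≫ (lam b₁ A).hom ▷ (Y ⊗ B)) ⊗≫
          X ◁ (lam c₁ A).hom ▷ B ⊗≫ (X ⊗ Y) ◁ (β_ B A).inv := by monoidal
    _ = 𝟙 _ ⊗≫ (A ◁ (lam b₂ B).hom ≫ (α_ A X B).inv ≫ (lam b₁ A).hom ▷ B) ▷ Y ⊗≫
          X ◁ (A ◁ (lam c₂ B).hom ≫ (α_ A Y B).inv ≫ (lam c₁ A).hom ▷ B ≫ (α_ Y A B).hom ≫
            Y ◁ (β_ B A).inv) ⊗≫ 𝟙 _ := by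
      rw [whisker_exchange]; monoidal
    _ = 𝟙 _ ⊗≫ (A ◁ (lam b₂ B).hom ≫ (α_ A X B).inv ≫ (lam b₁ A).hom ▷ B ≫ (α_ X A B).hom ≫
            X ◁ (β_ B A).inv) ▷ Y ⊗≫
          X ◁ B ◁ (lam c₁ A).hom ⊗≫ X ◁ (lam c₂ B).hom ▷ A ⊗≫ 𝟙 _ := by
      rw [hc]; monoidal
    _ = 𝟙 _ ⊗≫ (β_ B A).inv ▷ X ▷ Y ⊗≫ B ◁ (lam b₁ A).hom ▷ Y ⊗≫
          ((lam b₂ B).hom ▷ (A ⊗ Y) ≫ (X ⊗ B) ◁ (lam c₁ A).hom) ⊗≫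
          X ◁ (lam c₂ B).hom ▷ A ⊗≫ 𝟙 _ := by
      rw [hb]; monoidal
    _ = _ := by
      rw [← whisker_exchange]; monoidal

variable (C) in
/-- The trivial half-braiding on the unit object. -/
def unitHB : HalfBraiding (𝟙_ C) := (Center.tensorUnit (C := C)).2

theorem comm_unitHB : Comm (unitHB C) (unitHB C) := by
  intro A B
  have hsym : (β_ A B).hom = (β_ B A).inv := by
    rw [← cancel_mono (β_ B A).hom]; simp
  have h : ∀ A : C, (lam (unitHB C) A).hom = (ρ_ A).hom ≫ (λ_ A).inv := by
    intro A; simp [lam, unitHB, Center.tensorUnit]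
  simp only [h, hsym]
  calc
    _ = 𝟙 _ ⊗≫ (β_ B A).inv ⊗≫ 𝟙 _ := by monoidal
    _ = _ := by monoidal

/-- The naive tensor product `(X ⊗ Y, λ¹ ⊗ μ¹, λ² ⊗ μ²)`. -/
def tensorObj (Z W : EllipticCenter C) : EllipticCenter C where
  X := Z.X ⊗ W.X
  b₁ := tensorHB Z.b₁ W.b₁
  b₂ := tensorHB Z.b₂ W.b₂
  comm := comm_tensorHB Z.comm W.comm

/-- The unit object. -/
def tensorUnit : EllipticCenter C where
  X := 𝟙_ C
  b₁ := unitHB C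
  b₂ := unitHB C
  comm := comm_unitHB

/-- On morphisms the tensor product, and the associativity and unit constraints, are those
of `C`. -/
instance : MonoidalCategoryStruct (EllipticCenter C) where
  tensorObj := tensorObj
  tensorUnit := tensorUnit
  whiskerLeft Z _ _ f := mkHom (Z.X ◁ f.f) (Z.fst ◁ homFst f) (Z.snd ◁ homSnd f) rfl rfl
  whiskerRight f W := mkHom (f.f ▷ W.X) (homFst f ▷ W.fst) (homSnd f ▷ W.snd) rfl rfl
  tensorHom f g := mkHom (f.f ⊗ₘ g.f) (homFst f ⊗ₘ homFst g) (homSnd f ⊗ₘ homSnd g) rfl rfl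
  associator Z W U :=
    { hom := mkHom (α_ Z.X W.X U.X).hom (α_ Z.fst W.fst U.fst).hom
        (α_ Z.snd W.snd U.snd).hom rfl rfl
      inv := mkHom (α_ Z.X W.X U.X).inv (α_ Z.fst W.fst U.fst).inv
        (α_ Z.snd W.snd U.snd).inv (Center.associator_inv_f _ _ _) (Center.associator_inv_f _ _ _)
      hom_inv_id := hom_ext _ _ (α_ Z.X W.X U.X).hom_inv_id
      inv_hom_id := hom_ext _ _ (α_ Z.X W.X U.X).inv_hom_id }
  leftUnitor Z :=
    { hom := mkHom (λ_ Z.X).hom (λ_ Z.fst).hom (λ_ Z.snd).hom rfl rfl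
      inv := mkHom (λ_ Z.X).inv (λ_ Z.fst).inv (λ_ Z.snd).inv
        (Center.leftUnitor_inv_f _) (Center.leftUnitor_inv_f _)
      hom_inv_id := hom_ext _ _ (λ_ Z.X).hom_inv_id
      inv_hom_id := hom_ext _ _ (λ_ Z.X).inv_hom_id }
  rightUnitor Z :=
    { hom := mkHom (ρ_ Z.X).hom (ρ_ Z.fst).hom (ρ_ Z.snd).hom rfl rfl
      inv := mkHom (ρ_ Z.X).inv (ρ_ Z.fst).inv (ρ_ Z.snd).inv
        (Center.rightUnitor_inv_f _) (Center.rightUnitor_inv_f _)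
      hom_inv_id := hom_ext _ _ (ρ_ Z.X).hom_inv_id
      inv_hom_id := hom_ext _ _ (ρ_ Z.X).inv_hom_id }

/-- The comparison data of the forgetful functor to `C` are identities. -/
def inducingData : Monoidal.InducingFunctorData (forget C) :=
    { μIso := fun _ _ => Iso.refl _
      whiskerLeft_eq := fun Z _ _ f =>
        show Z.X ◁ f.f = 𝟙 _ ≫ (Z.X ◁ f.f) ≫ 𝟙 _ by rw [Category.id_comp, Category.comp_id]
      whiskerRight_eq := fun f W =>
        show f.f ▷ W.X = 𝟙 _ ≫ (f.f ▷ W.X) ≫ 𝟙 _ by rw [Category.id_comp, Category.comp_id]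
      tensorHom_eq := fun f g =>
        show f.f ⊗ₘ g.f = 𝟙 _ ≫ (f.f ⊗ₘ g.f) ≫ 𝟙 _ by rw [Category.id_comp, Category.comp_id]
      εIso := Iso.refl _
      associator_eq := fun Z W U =>
        show (α_ Z.X W.X U.X).hom = (𝟙 _ ≫ (𝟙 _ ⊗ₘ 𝟙 _)) ≫ (α_ Z.X W.X U.X).hom ≫
          ((𝟙 _ ⊗ₘ 𝟙 _) ≫ 𝟙 _) by simp only [id_tensorHom_id, Category.id_comp, Category.comp_id]
      leftUnitor_eq := fun Z =>
        show (λ_ Z.X).hom = (𝟙 _ ≫ (𝟙 _ ⊗ₘ 𝟙 _)) ≫ (λ_ Z.X).hom by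
          simp only [id_tensorHom_id, Category.id_comp]
      rightUnitor_eq := fun Z =>
        show (ρ_ Z.X).hom = (𝟙 _ ≫ (𝟙 _ ⊗ₘ 𝟙 _)) ≫ (ρ_ Z.X).hom by
          simp only [id_tensorHom_id, Category.id_comp] }

instance : MonoidalCategory (EllipticCenter C) := Monoidal.induced (forget C) inducingData

instance : (forget C).Monoidal := Monoidal.fromInducedMonoidal (forget C) inducingData

end EllipticCenter

/-! ## Finite-dimensional modules over an algebra, Hopf structures -/

/-- A finite-dimensional left module over a `k`-algebra `A`: a finite-dimensional vector space
with an algebra homomorphism from `A` to its endomorphisms. -/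
structure FDMod (k A : Type u) [Field k] [Ring A] [Algebra k A] where
  V : ModuleCat.{u} k
  finite : FiniteDimensional k V
  ρ : A →ₐ[k] Module.End k V

namespace FDMod

section Category

variable {k A : Type u} [Field k] [Ring A] [Algebra k A]

/-- `A`-linear maps. -/
@[ext]
structure Hom (X Y : FDMod k A) where
  hom : X.V ⟶ Y.V
  equivariant : ∀ (a : A) (x : X.V), hom (X.ρ a x) = Y.ρ a (hom x)

instance : Category (FDMod k A) where
  Hom := Hom
  id X := ⟨𝟙 X.V, fun _ _ => rfl⟩
  comp f g := ⟨f.hom ≫ g.hom, fun a x => by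
    simp only [ModuleCat.hom_comp, LinearMap.comp_apply, f.equivariant, g.equivariant]⟩

@[ext]
theorem hom_ext {X Y : FDMod k A} (f g : X ⟶ Y) (h : f.hom = g.hom) : f = g := Hom.ext h

variable (k A) in
/-- The forgetful functor to vector spaces. -/
@[simps]
def forget : FDMod k A ⥤ ModuleCat.{u} k where
  obj X := X.V
  map f := f.hom

instance : (forget k A).Faithful where
  map_injective h := hom_ext _ _ h

/-- A linear isomorphism that is `A`-linear is an isomorphism of modules. -/
def isoMk {X Y : FDMod k A} (e : X.V ≅ Y.V)
    (h : ∀ (a : A) (x : X.V), e.hom (X.ρ a x) = Y.ρ a (e.hom x)) : X ≅ Y where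
  hom := ⟨e.hom, h⟩
  inv := ⟨e.inv, fun a y => by
    have := h a (e.inv y)
    apply_fun e.inv at this
    simpa using this.symm⟩
  hom_inv_id := hom_ext _ _ e.hom_inv_id
  inv_hom_id := hom_ext _ _ e.inv_hom_id

variable (k A) in
/-- The regular module of a finite-dimensional algebra. -/
def regular [FiniteDimensional k A] : FDMod k A where
  V := ModuleCat.of k A
  finite := inferInstanceAs (FiniteDimensional k A)
  ρ := Algebra.lmul k A

end Category

/-! ### The monoidal category of modules over a bialgebra -/

section Monoidal

variable {k A : Type u} [Field k] [Ring A] [Bialgebra k A]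

/-- The tensor product of modules over a bialgebra: `a (x ⊗ y) = ∑ a₁ x ⊗ a₂ y`. -/
def tensorObj (X Y : FDMod k A) : FDMod k A where
  V := ModuleCat.of k (X.V ⊗[k] Y.V)
  finite := by
    have := X.finite
    have := Y.finite
    exact inferInstanceAs (FiniteDimensional k (X.V ⊗[k] Y.V))
  ρ := (Module.endTensorEndAlgHom (R := k) (S := k) (A := k)).comp
    ((Algebra.TensorProduct.map X.ρ Y.ρ).comp (Bialgebra.comulAlgHom k A))

/-- The trivial module `k`, on which the algebra acts by the counit. -/
def tensorUnit : FDMod k A where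
  V := ModuleCat.of k k
  finite := inferInstanceAs (FiniteDimensional k k)
  ρ := (Algebra.lmul k k).comp (Bialgebra.counitAlgHom k A)

theorem tensor_ρ (X Y : FDMod k A) {ι : Type*} {a : A} (r : Coalgebra.Repr k a ι)
    (x : X.V) (y : Y.V) :
    (tensorObj X Y).ρ a (x ⊗ₜ[k] y) =
      ∑ i ∈ r.index, X.ρ (r.left i) x ⊗ₜ[k] Y.ρ (r.right i) y := by
  change (Module.endTensorEndAlgHom (R := k) (S := k) (A := k)
    (Algebra.TensorProduct.map X.ρ Y.ρ (Coalgebra.comul a))) (x ⊗ₜ[k] y) = _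
  rw [← r.eq, map_sum, map_sum, LinearMap.sum_apply]
  rfl

theorem assoc_equivariant (X Y Z : FDMod k A) (a : A)
    (t : (tensorObj (tensorObj X Y) Z).V) :
    (α_ X.V Y.V Z.V).hom ((tensorObj (tensorObj X Y) Z).ρ a t) =
      (tensorObj X (tensorObj Y Z)).ρ a ((α_ X.V Y.V Z.V).hom t) := by
  let L : (X.V ⊗[k] Y.V) ⊗[k] Z.V →ₗ[k] X.V ⊗[k] (Y.V ⊗[k] Z.V) :=
    (TensorProduct.assoc k X.V Y.V Z.V).toLinearMap ∘ₗ (tensorObj (tensorObj X Y) Z).ρ a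
  let R : (X.V ⊗[k] Y.V) ⊗[k] Z.V →ₗ[k] X.V ⊗[k] (Y.V ⊗[k] Z.V) :=
    ((tensorObj X (tensorObj Y Z)).ρ a) ∘ₗ (TensorProduct.assoc k X.V Y.V Z.V).toLinearMap
  suffices h : L = R from congrArg (fun f => f t) h
  apply TensorProduct.ext_threefold
  intro x y z
  let r := Coalgebra.Repr.arbitrary k a
  let r₁ := fun i => Coalgebra.Repr.arbitrary k (r.left i)
  let r₂ := fun i => Coalgebra.Repr.arbitrary k (r.right i)
  have h := Coalgebra.sum_tmul_tmul_eq r r₁ r₂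
  let E : A ⊗[k] (A ⊗[k] A) →ₗ[k] X.V ⊗[k] (Y.V ⊗[k] Z.V) :=
    TensorProduct.map (LinearMap.applyₗ x ∘ₗ X.ρ.toLinearMap)
      (TensorProduct.map (LinearMap.applyₗ y ∘ₗ Y.ρ.toLinearMap)
        (LinearMap.applyₗ z ∘ₗ Z.ρ.toLinearMap))
  have h := congrArg E h
  simp only [map_sum] at h
  have hL : L ((x ⊗ₜ[k] y) ⊗ₜ[k] z) = ∑ i ∈ r.index, ∑ j ∈ (r₁ i).index,
      X.ρ ((r₁ i).left j) x ⊗ₜ[k] (Y.ρ ((r₁ i).right j) y ⊗ₜ[k] Z.ρ (r.right i) z) := by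
    change (TensorProduct.assoc k X.V Y.V Z.V)
      ((tensorObj (tensorObj X Y) Z).ρ a ((x ⊗ₜ[k] y) ⊗ₜ[k] z)) = _
    refine (congrArg _ (tensor_ρ (tensorObj X Y) Z r (x ⊗ₜ[k] y) z)).trans ?_
    refine (map_sum (TensorProduct.assoc k X.V Y.V Z.V) _ _).trans ?_
    refine Finset.sum_congr rfl fun i _ => ?_
    refine (congrArg (fun w => TensorProduct.assoc k X.V Y.V Z.V (w ⊗ₜ[k] Z.ρ (r.right i) z))
      (tensor_ρ X Y (r₁ i) x y)).trans ?_
    refine (congrArg _ (TensorProduct.sum_tmul _ _ _)).trans ?_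
    exact map_sum (TensorProduct.assoc k X.V Y.V Z.V) _ _
  have hR : R ((x ⊗ₜ[k] y) ⊗ₜ[k] z) = ∑ i ∈ r.index, ∑ j ∈ (r₂ i).index,
      X.ρ (r.left i) x ⊗ₜ[k] (Y.ρ ((r₂ i).left j) y ⊗ₜ[k] Z.ρ ((r₂ i).right j) z) := by
    change ((tensorObj X (tensorObj Y Z)).ρ a (x ⊗ₜ[k] (y ⊗ₜ[k] z))) = _
    refine (tensor_ρ X (tensorObj Y Z) r x (y ⊗ₜ[k] z)).trans ?_
    refine Finset.sum_congr rfl fun i _ => ?_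
    refine (congrArg (fun w => X.ρ (r.left i) x ⊗ₜ[k] w) (tensor_ρ Y Z (r₂ i) y z)).trans ?_
    exact TensorProduct.tmul_sum _ _ _
  rw [hL, hR]
  exact h

theorem leftUnitor_equivariant (X : FDMod k A) (a : A) (t : (tensorObj tensorUnit X).V) :
    (λ_ X.V).hom ((tensorObj tensorUnit X).ρ a t) = X.ρ a ((λ_ X.V).hom t) := by
  let L : k ⊗[k] X.V →ₗ[k] X.V :=
    (TensorProduct.lid k X.V).toLinearMap ∘ₗ (tensorObj tensorUnit X).ρ a
  let R : k ⊗[k] X.V →ₗ[k] X.V := X.ρ a ∘ₗ (TensorProduct.lid k X.V).toLinearMap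
  suffices h : L = R from congrArg (fun f => f t) h
  apply TensorProduct.ext'
  intro c x
  let r := Coalgebra.Repr.arbitrary k a
  change (TensorProduct.lid k X.V) ((tensorObj tensorUnit X).ρ a (c ⊗ₜ[k] x)) =
    X.ρ a (c • x)
  refine (congrArg _ (tensor_ρ tensorUnit X r c x)).trans ?_
  refine (map_sum (TensorProduct.lid k X.V) _ _).trans ?_
  conv_rhs => rw [← Coalgebra.sum_counit_smul r, map_sum, LinearMap.sum_apply]
  refine Finset.sum_congr rfl fun i _ => ?_
  refine (TensorProduct.lid_tmul _ _).trans ?_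
  change (Coalgebra.counit (R := k) (r.left i) * c) • X.ρ (r.right i) x =
    X.ρ (Coalgebra.counit (R := k) (r.left i) • r.right i) (c • x)
  simp only [map_smul, LinearMap.smul_apply, smul_smul, mul_comm]

theorem rightUnitor_equivariant (X : FDMod k A) (a : A) (t : (tensorObj X tensorUnit).V) :
    (ρ_ X.V).hom ((tensorObj X tensorUnit).ρ a t) = X.ρ a ((ρ_ X.V).hom t) := by
  let L : X.V ⊗[k] k →ₗ[k] X.V :=
    (TensorProduct.rid k X.V).toLinearMap ∘ₗ (tensorObj X tensorUnit).ρ a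
  let R : X.V ⊗[k] k →ₗ[k] X.V := X.ρ a ∘ₗ (TensorProduct.rid k X.V).toLinearMap
  suffices h : L = R from congrArg (fun f => f t) h
  apply TensorProduct.ext'
  intro x c
  let r := Coalgebra.Repr.arbitrary k a
  have hr : ∑ i ∈ r.index, Coalgebra.counit (R := k) (r.right i) • r.left i = a := by
    have := congrArg (TensorProduct.rid k A) (Coalgebra.sum_tmul_counit_eq r)
    simpa only [map_sum, TensorProduct.rid_tmul, one_smul] using this
  change (TensorProduct.rid k X.V) ((tensorObj X tensorUnit).ρ a (x ⊗ₜ[k] c)) =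
    X.ρ a (c • x)
  refine (congrArg _ (tensor_ρ X tensorUnit r x c)).trans ?_
  refine (map_sum (TensorProduct.rid k X.V) _ _).trans ?_
  conv_rhs => rw [← hr, map_sum, LinearMap.sum_apply]
  refine Finset.sum_congr rfl fun i _ => ?_
  refine (TensorProduct.rid_tmul _ _).trans ?_
  change (Coalgebra.counit (R := k) (r.right i) * c) • X.ρ (r.left i) x =
    X.ρ (Coalgebra.counit (R := k) (r.right i) • r.left i) (c • x)
  simp only [map_smul, LinearMap.smul_apply, smul_smul, mul_comm]

theorem map_equivariant {X X' Y Y' : FDMod k A} (f : X ⟶ X') (g : Y ⟶ Y') (a : A)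
    (t : (tensorObj X Y).V) :
    (f.hom ⊗ₘ g.hom) ((tensorObj X Y).ρ a t) =
      (tensorObj X' Y').ρ a ((f.hom ⊗ₘ g.hom) t) := by
  let L : X.V ⊗[k] Y.V →ₗ[k] X'.V ⊗[k] Y'.V :=
    TensorProduct.map f.hom.hom g.hom.hom ∘ₗ (tensorObj X Y).ρ a
  let R : X.V ⊗[k] Y.V →ₗ[k] X'.V ⊗[k] Y'.V :=
    (tensorObj X' Y').ρ a ∘ₗ TensorProduct.map f.hom.hom g.hom.hom
  suffices h : L = R from congrArg (fun f => f t) h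
  apply TensorProduct.ext'
  intro x y
  let r := Coalgebra.Repr.arbitrary k a
  change TensorProduct.map f.hom.hom g.hom.hom ((tensorObj X Y).ρ a (x ⊗ₜ[k] y)) =
    (tensorObj X' Y').ρ a (f.hom x ⊗ₜ[k] g.hom y)
  refine (congrArg _ (tensor_ρ X Y r x y)).trans ?_
  refine Eq.trans ?_ (tensor_ρ X' Y' r _ _).symm
  rw [map_sum]
  refine Finset.sum_congr rfl fun i _ => ?_
  rw [← f.equivariant, ← g.equivariant]
  rfl

/-- The tensor product of morphisms and the associativity and unit constraints are those of vector
spaces. -/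
instance : MonoidalCategoryStruct (FDMod k A) where
  tensorObj := tensorObj
  tensorUnit := tensorUnit
  whiskerLeft X _ _ f := ⟨X.V ◁ f.hom, fun a t => map_equivariant (𝟙 X) f a t⟩
  whiskerRight f Y := ⟨f.hom ▷ Y.V, fun a t => map_equivariant f (𝟙 Y) a t⟩
  tensorHom f g := ⟨f.hom ⊗ₘ g.hom, map_equivariant f g⟩
  associator X Y Z := isoMk (α_ X.V Y.V Z.V) (assoc_equivariant X Y Z)
  leftUnitor X := isoMk (λ_ X.V) (leftUnitor_equivariant X)
  rightUnitor X := isoMk (ρ_ X.V) (rightUnitor_equivariant X)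

/-- The comparison data of the forgetful functor to vector spaces are identities. -/
def inducingData : Monoidal.InducingFunctorData (forget k A) where
  μIso _ _ := Iso.refl _
  whiskerLeft_eq X _ _ f :=
    show X.V ◁ f.hom = 𝟙 _ ≫ (X.V ◁ f.hom) ≫ 𝟙 _ by rw [Category.id_comp, Category.comp_id]
  whiskerRight_eq f Y :=
    show f.hom ▷ Y.V = 𝟙 _ ≫ (f.hom ▷ Y.V) ≫ 𝟙 _ by rw [Category.id_comp, Category.comp_id]
  tensorHom_eq f g :=
    show f.hom ⊗ₘ g.hom = 𝟙 _ ≫ (f.hom ⊗ₘ g.hom) ≫ 𝟙 _ by rw [Category.id_comp, Category.comp_id]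
  εIso := Iso.refl _
  associator_eq X Y Z :=
    show (α_ X.V Y.V Z.V).hom = (𝟙 _ ≫ (𝟙 _ ⊗ₘ 𝟙 _)) ≫ (α_ X.V Y.V Z.V).hom ≫
      ((𝟙 _ ⊗ₘ 𝟙 _) ≫ 𝟙 _) by simp only [id_tensorHom_id, Category.id_comp, Category.comp_id]
  leftUnitor_eq X :=
    show (λ_ X.V).hom = (𝟙 _ ≫ (𝟙 _ ⊗ₘ 𝟙 _)) ≫ (λ_ X.V).hom by
      simp only [id_tensorHom_id, Category.id_comp]
  rightUnitor_eq X :=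
    show (ρ_ X.V).hom = (𝟙 _ ≫ (𝟙 _ ⊗ₘ 𝟙 _)) ≫ (ρ_ X.V).hom by
      simp only [id_tensorHom_id, Category.id_comp]

instance : MonoidalCategory (FDMod k A) := Monoidal.induced (forget k A) inducingData

instance : (forget k A).Monoidal := Monoidal.fromInducedMonoidal (forget k A) inducingData

/-! ### The symmetric braiding over a cocommutative bialgebra -/

variable [Coalgebra.IsCocomm k A]

theorem braiding_equivariant (X Y : FDMod k A) (a : A) (t : (tensorObj X Y).V) :
    (β_ X.V Y.V).hom ((tensorObj X Y).ρ a t) = (tensorObj Y X).ρ a ((β_ X.V Y.V).hom t) := by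
  let L : X.V ⊗[k] Y.V →ₗ[k] Y.V ⊗[k] X.V :=
    (TensorProduct.comm k X.V Y.V).toLinearMap ∘ₗ (tensorObj X Y).ρ a
  let R : X.V ⊗[k] Y.V →ₗ[k] Y.V ⊗[k] X.V :=
    (tensorObj Y X).ρ a ∘ₗ (TensorProduct.comm k X.V Y.V).toLinearMap
  suffices h : L = R from congrArg (fun f => f t) h
  apply TensorProduct.ext'
  intro x y
  let r := Coalgebra.Repr.arbitrary k a
  let r' : Coalgebra.Repr k a (A × A) :=
    { index := r.index, left := r.right, right := r.left
      eq := by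
        rw [← Coalgebra.comm_comul k a, ← r.eq, map_sum]
        rfl }
  change (TensorProduct.comm k X.V Y.V) ((tensorObj X Y).ρ a (x ⊗ₜ[k] y)) =
    (tensorObj Y X).ρ a (y ⊗ₜ[k] x)
  refine (congrArg _ (tensor_ρ X Y r x y)).trans ?_
  refine Eq.trans ?_ (tensor_ρ Y X r' y x).symm
  rw [map_sum]
  rfl

/-- The braiding is the flip of the two factors. -/
instance : BraidedCategory (FDMod k A) :=
  BraidedCategory.ofFaithful (forget k A)
    (fun X Y => isoMk (β_ X.V Y.V) (braiding_equivariant X Y))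
    (fun X Y => show 𝟙 _ ≫ (β_ X.V Y.V).hom = (β_ X.V Y.V).hom ≫ 𝟙 _ by
      rw [Category.id_comp, Category.comp_id])

instance : SymmetricCategory (FDMod k A) where
  symmetry X Y := hom_ext _ _ (SymmetricCategory.symmetry X.V Y.V)

end Monoidal
end FDMod
/-! ## The coalgebra `H^{*,cop}` -/

section DualCop

set_option linter.unusedSectionVars false

variable (k H : Type u) [Field k] [Ring H] [Algebra k H]

/-- The dual vector space of `H`, as the underlying space of the coalgebra `H^{*,cop}`. -/
def DualCop : Type u := Module.Dual k H

instance : AddCommGroup (DualCop k H) := inferInstanceAs (AddCommGroup (Module.Dual k H))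

instance : Module k (DualCop k H) := inferInstanceAs (Module k (Module.Dual k H))

instance : FunLike (DualCop k H) H k := inferInstanceAs (FunLike (Module.Dual k H) H k)

variable {k H} in
@[simp] theorem DualCop.zero_apply (a : H) : (0 : DualCop k H) a = 0 := rfl

variable {k H} in
theorem DualCop.add_apply (f g : DualCop k H) (a : H) : (f + g) a = f a + g a := rfl

variable [FiniteDimensional k H]

/-- The coproduct of `H^{*,cop}`: if `Δ f = ∑ g_i ⊗ h_i`, then `f (b * a) = ∑ g_i a * h_i b`,
i.e. it is the opposite of the dual of the multiplication of `H`. -/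
def dualCopComul : DualCop k H →ₗ[k] DualCop k H ⊗[k] DualCop k H :=
  (TensorProduct.comm k (Module.Dual k H) (Module.Dual k H)).toLinearMap ∘ₗ
    (TensorProduct.dualDistribEquiv k H H).symm.toLinearMap ∘ₗ
      (LinearMap.mul' k H).dualMap

/-- The counit `f ↦ f 1` of `H^{*,cop}`. -/
def dualCopCounit : DualCop k H →ₗ[k] k := LinearMap.applyₗ (R := k) (M := H) (M₂ := k) 1

variable {k H}

/-- Evaluation of an element of `H^* ⊗ H^*` on a pair of elements. -/
def eval₂ (a b : H) : DualCop k H ⊗[k] DualCop k H →ₗ[k] k :=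
  LinearMap.applyₗ (a ⊗ₜ[k] b) ∘ₗ TensorProduct.dualDistrib k H H

theorem eval₂_tmul (a b : H) (f g : DualCop k H) :
    eval₂ a b (f ⊗ₜ[k] g) = f a * g b := rfl

theorem eval₂_comul (a b : H) (f : DualCop k H) :
    eval₂ a b (dualCopComul k H f) = f (b * a) := by
  have hswap : ∀ t : Module.Dual k H ⊗[k] Module.Dual k H,
      TensorProduct.dualDistrib k H H (TensorProduct.comm k _ _ t) (a ⊗ₜ[k] b) =
        TensorProduct.dualDistrib k H H t (b ⊗ₜ[k] a) := by
    intro t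
    induction t with
    | zero => simp
    | tmul f g => simp [mul_comm]
    | add x y hx hy => simp only [map_add, LinearMap.add_apply, hx, hy]
  refine (hswap _).trans ?_
  have h := (TensorProduct.dualDistribEquiv k H H).apply_symm_apply
    ((LinearMap.mul' k H).dualMap (f : Module.Dual k H))
  exact congrArg (fun w : Module.Dual k (H ⊗[k] H) => w (b ⊗ₜ[k] a)) h

/-- The identification of `H^* ⊗ (H^* ⊗ H^*)` with the dual of `H ⊗ (H ⊗ H)`. -/
def dual₃ : DualCop k H ⊗[k] (DualCop k H ⊗[k] DualCop k H) ≃ₗ[k]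
    Module.Dual k (H ⊗[k] (H ⊗[k] H)) :=
  (TensorProduct.congr (LinearEquiv.refl k (Module.Dual k H))
    (TensorProduct.dualDistribEquiv k H H)) ≪≫ₗ TensorProduct.dualDistribEquiv k H (H ⊗[k] H)

theorem dual₃_tmul (a b c : H) (f : DualCop k H) (t : DualCop k H ⊗[k] DualCop k H) :
    dual₃ (f ⊗ₜ[k] t) (a ⊗ₜ[k] (b ⊗ₜ[k] c)) = f a * eval₂ b c t := rfl

theorem dual₃_assoc (a b c : H) (h : DualCop k H) (t : DualCop k H ⊗[k] DualCop k H) :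
    dual₃ (TensorProduct.assoc k _ _ _ (t ⊗ₜ[k] h)) (a ⊗ₜ[k] (b ⊗ₜ[k] c)) =
      eval₂ a b t * h c := by
  induction t with
  | zero => simp
  | tmul f g =>
    rw [TensorProduct.assoc_tmul, dual₃_tmul]
    simp only [eval₂_tmul, mul_assoc]
  | add x y hx hy =>
    simp only [TensorProduct.add_tmul, map_add, LinearMap.add_apply, hx, hy, add_mul]

theorem coassoc_left (a b c : H) (t : DualCop k H ⊗[k] DualCop k H) :
    dual₃ (TensorProduct.assoc k _ _ _ ((dualCopComul k H).rTensor _ t))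
      (a ⊗ₜ[k] (b ⊗ₜ[k] c)) = eval₂ (b * a) c t := by
  induction t with
  | zero => simp
  | tmul f g => rw [LinearMap.rTensor_tmul, dual₃_assoc, eval₂_comul, eval₂_tmul]
  | add x y hx hy => simp only [map_add, LinearMap.add_apply, hx, hy]

theorem coassoc_right (a b c : H) (t : DualCop k H ⊗[k] DualCop k H) :
    dual₃ ((dualCopComul k H).lTensor _ t) (a ⊗ₜ[k] (b ⊗ₜ[k] c)) = eval₂ a (c * b) t := by
  induction t with
  | zero => simp
  | tmul f g => rw [LinearMap.lTensor_tmul, dual₃_tmul, eval₂_comul, eval₂_tmul]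
  | add x y hx hy => simp only [map_add, LinearMap.add_apply, hx, hy]

theorem lid_counit (a : H) (t : DualCop k H ⊗[k] DualCop k H) :
    TensorProduct.lid k (DualCop k H) ((dualCopCounit k H).rTensor _ t) a = eval₂ 1 a t := by
  induction t with
  | zero => simp
  | tmul f g => rfl
  | add x y hx hy => simp only [map_add, DualCop.add_apply, hx, hy]

theorem rid_counit (a : H) (t : DualCop k H ⊗[k] DualCop k H) :
    TensorProduct.rid k (DualCop k H) ((dualCopCounit k H).lTensor _ t) a = eval₂ a 1 t := by
  induction t with
  | zero => simp
  | tmul f g => exact mul_comm _ _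
  | add x y hx hy => simp only [map_add, DualCop.add_apply, hx, hy]

instance : Coalgebra k (DualCop k H) where
  comul := dualCopComul k H
  counit := dualCopCounit k H
  coassoc := by
    refine LinearMap.ext fun f => dual₃.injective ?_
    refine TensorProduct.ext (LinearMap.ext fun a => TensorProduct.ext' fun b c => ?_)
    refine (coassoc_left a b c _).trans (Eq.trans ?_ (coassoc_right a b c _).symm)
    rw [eval₂_comul, eval₂_comul, mul_assoc]
  rTensor_counit_comp_comul := by
    refine LinearMap.ext fun f => (TensorProduct.lid k (DualCop k H)).injective ?_
    refine DFunLike.ext _ _ fun a => (lid_counit a _).trans ?_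
    rw [eval₂_comul, mul_one, TensorProduct.mk_apply, TensorProduct.lid_tmul, one_smul]
  lTensor_counit_comp_comul := by
    refine LinearMap.ext fun f => (TensorProduct.rid k (DualCop k H)).injective ?_
    refine DFunLike.ext _ _ fun a => (rid_counit a _).trans ?_
    rw [eval₂_comul, one_mul, LinearMap.flip_apply, TensorProduct.mk_apply,
      TensorProduct.rid_tmul, one_smul]

end DualCop

/-! ## Hopf algebra structures on a given algebra -/

/-- A Hopf algebra structure on an algebra. -/
structure HopfStructure (k A : Type u) [Field k] [Ring A] [Algebra k A] where
  comul : A →ₐ[k] A ⊗[k] A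
  counit : A →ₐ[k] k
  coassoc : (Algebra.TensorProduct.assoc k k k A A A).toAlgHom.comp
    ((Algebra.TensorProduct.map comul (.id k A)).comp comul) =
      (Algebra.TensorProduct.map (.id k A) comul).comp comul
  counit_left : (Algebra.TensorProduct.map counit (.id k A)).comp comul =
    (Algebra.TensorProduct.lid k A).symm
  counit_right : (Algebra.TensorProduct.map (.id k A) counit).comp comul =
    (Algebra.TensorProduct.rid k k A).symm
  antipode : A →ₗ[k] A
  antipode_left : LinearMap.mul' k A ∘ₗ antipode.rTensor A ∘ₗ comul.toLinearMap =
    Algebra.linearMap k A ∘ₗ counit.toLinearMap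
  antipode_right : LinearMap.mul' k A ∘ₗ antipode.lTensor A ∘ₗ comul.toLinearMap =
    Algebra.linearMap k A ∘ₗ counit.toLinearMap

/-- The Hopf algebra given by a Hopf algebra structure. -/
@[reducible]
def HopfStructure.toHopfAlgebra {k A : Type u} [Field k] [Ring A] [Algebra k A]
    (s : HopfStructure k A) : HopfAlgebra k A :=
  { Bialgebra.ofAlgHom s.comul s.counit s.coassoc s.counit_left s.counit_right with
    antipode := s.antipode
    mul_antipode_rTensor_comul := s.antipode_left
    mul_antipode_lTensor_comul := s.antipode_right }

/-- A pivotal element of a Hopf algebra: a group-like element `v` with `S²(x) = v x v⁻¹`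
(group-like elements are invertible). -/
structure IsPivotal (k : Type u) {A : Type u} [Field k] [Ring A] [HopfAlgebra k A] (v : A) :
    Prop where
  groupLike : IsGroupLikeElem k v
  antipode_sq : ∀ x : A, HopfAlgebra.antipode k (HopfAlgebra.antipode k x) * v = v * x

/-- A spherical element of a Hopf algebra: a pivotal element `v` such that for each endomorphism
`θ` of a finite-dimensional module, the traces of `v θ` and `v⁻¹ θ` agree (here `v⁻¹ = S v`). -/
structure IsSpherical (k : Type u) {A : Type u} [Field k] [Ring A] [HopfAlgebra k A] (v : A) :
    Prop extends IsPivotal k v where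
  trace_eq : ∀ (X : FDMod k A) (θ : X ⟶ X),
    LinearMap.trace k X.V (X.ρ v ∘ₗ θ.hom.hom) =
      LinearMap.trace k X.V (X.ρ (HopfAlgebra.antipode k v) ∘ₗ θ.hom.hom)

/-! ## The elliptic Drinfeld double -/

section EllipticDouble

variable (k H : Type u) [Field k] [Ring H] [HopfAlgebra k H]

/-- The inverse `S⁻¹` of the antipode (the antipode is bijective if `H` is finite-dimensional). -/
def antipodeInv : Module.End k H := Ring.inverse (HopfAlgebra.antipode k (A := H))

namespace EllipticDouble

/-- The space of generators `H ⊕ H₁^* ⊕ H₂^*`. -/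
abbrev Gen : Type u := H × Module.Dual k H × Module.Dual k H

variable {k H}

/-- The generator given by an element of `H`. -/
def genH (h : H) : TensorAlgebra k (Gen k H) := TensorAlgebra.ι k (h, 0, 0)

/-- The generator given by an element of `H_i^*`; here `i = 0` stands for the first copy `H₁^*`
and `i = 1` for the second copy `H₂^*`. -/
def genD (i : Fin 2) (f : Module.Dual k H) : TensorAlgebra k (Gen k H) :=
  TensorAlgebra.ι k (0, if i = 0 then (f, 0) else (0, f))

/-- The functional `x ↦ f (a * x * b)`, i.e. `⟨f₁, a⟩ ⟨f₃, b⟩ f₂` for the iterated coproduct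
`f₁ ⊗ f₂ ⊗ f₃` of `f` dual to the multiplication of `H`. -/
def translate (f : Module.Dual k H) (a b : H) : Module.Dual k H :=
  f ∘ₗ LinearMap.mulLeft k a ∘ₗ LinearMap.mulRight k b

/-- The defining relations of the elliptic Drinfeld double of `H` with respect to `R ∈ H ⊗ H`. -/
inductive Rel (R : H ⊗[k] H) : TensorAlgebra k (Gen k H) → TensorAlgebra k (Gen k H) → Prop
  /-- The inclusion of `H` is an algebra map. -/
  | one_H : Rel R (genH 1) 1
  | mul_H (a b : H) : Rel R (genH (a * b)) (genH a * genH b)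
  /-- The inclusions of the two copies of `H^*`, with the convolution product
  `(f g)(x) = ∑ f(x₁) g(x₂)` and the unit `ε`, are algebra maps. -/
  | one_D (i : Fin 2) : Rel R (genD i (Coalgebra.counit (R := k) (A := H))) 1
  | mul_D (i : Fin 2) (f g : Module.Dual k H) :
      Rel R (genD i (WithConv.toConv f * WithConv.toConv g).ofConv) (genD i f * genD i g)
  /-- `f h = ∑ ⟨f₃, S⁻¹(h₁)⟩ ⟨f₁, h₃⟩ h₂ f₂` for `h ∈ H` and `f ∈ H_i^*`. -/
  | cross (i : Fin 2) (f : Module.Dual k H) (h : H) (n : ℕ) (h₁ h₂ h₃ : Fin n → H)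
      (hh : (Coalgebra.comul (R := k)).lTensor H (Coalgebra.comul (R := k) h) =
        ∑ j, h₁ j ⊗ₜ[k] (h₂ j ⊗ₜ[k] h₃ j)) :
      Rel R (genD i f * genH h)
        (∑ j, genH (h₂ j) * genD i (translate f (h₃ j) (antipodeInv k H (h₁ j))))
  /-- `f² f¹ = ∑ ⟨f¹₁, t_a⟩ ⟨f¹₃, s_{a'}⟩ ⟨f²₁, s_a⟩ ⟨f²₃, t_{a'}⟩ f¹₂ f²₂` for `f¹ ∈ H₁^*`,
  `f² ∈ H₂^*`, where `R = ∑ s_a ⊗ t_a`. -/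
  | comm (f₁ f₂ : Module.Dual k H) (n : ℕ) (s t : Fin n → H) (hR : R = ∑ a, s a ⊗ₜ[k] t a) :
      Rel R (genD 1 f₂ * genD 0 f₁)
        (∑ a, ∑ a', genD 0 (translate f₁ (t a) (s a')) * genD 1 (translate f₂ (s a) (t a')))

end EllipticDouble

variable {k H}

/-- The elliptic Drinfeld double of `H` with respect to `R ∈ H ⊗ H`, as an algebra: it is generated
by `H` and two copies of the convolution algebra `H^*`, subject to the straightening relations
`EllipticDouble.Rel`. -/
def EllipticDouble (R : H ⊗[k] H) : Type u := RingQuot (EllipticDouble.Rel R)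

namespace EllipticDouble

variable (R : H ⊗[k] H)

instance : Ring (EllipticDouble R) := inferInstanceAs (Ring (RingQuot (Rel R)))

instance : Algebra k (EllipticDouble R) := inferInstanceAs (Algebra k (RingQuot (Rel R)))

/-- The map `H → D^el(H)`. -/
def ι (h : H) : EllipticDouble R := RingQuot.mkAlgHom k (Rel R) (genH h)

/-- The map `ι_i : H_i^* → D^el(H)`; `i = 0` is the first copy and `i = 1` the second. -/
def ιD (i : Fin 2) (f : Module.Dual k H) : EllipticDouble R :=
  RingQuot.mkAlgHom k (Rel R) (genD i f)

end EllipticDouble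

variable (k H) in
/-- The elliptic Drinfeld double `D^el(H)` of a cocommutative Hopf algebra `H`, which is
quasi-triangular with `R = 1 ⊗ 1`. -/
abbrev Del : Type u := EllipticDouble ((1 : H) ⊗ₜ[k] (1 : H))

end EllipticDouble

/-- For an `H`-module `X` and a map `l : H ⊗ X ⟶ X ⊗ H`, the operator
`f ↦ (x ↦ (id_X ⊗ f) (l (1 ⊗ x)))` on `X`. -/
def dualAction {k H : Type u} [Field k] [Ring H] [HopfAlgebra k H] [FiniteDimensional k H]
    {X : FDMod k H} (l : FDMod.regular k H ⊗ X ⟶ X ⊗ FDMod.regular k H) (f : Module.Dual k H)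
    (x : X.V) : X.V :=
  TensorProduct.rid k X.V (f.lTensor X.V (l.hom ((1 : H) ⊗ₜ[k] x : H ⊗[k] X.V)))

end Elliptic

end

open Elliptic

open CategoryTheory MonoidalCategory
open scoped TensorProduct

noncomputable section

namespace Elliptic

/-! ### Cartier's theorem: the group-like elements span `H`. -/

section Cartier

open WithConv

set_option linter.unusedSectionVars false

/-! The theorem reduces to group algebras. By Cartier's theorem (`span_groupLike`) a
finite-dimensional cocommutative Hopf algebra over an algebraically closed field of characteristic
zero has its group-like elements as a basis, so `H = k[G]` for a finite group `G`. Its proof works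
in the commutative algebra `A = H^*`: the points of `A` are the group-likes, a tangent vector at `g`
is an `x` with `Δ x = g ⊗ x + x ⊗ g`, and `g⁻¹ x` is then primitive, hence zero
(`eq_zero_of_primitive`). So `A` is unramified over `k`, hence reduced, and a functional that
vanishes at every group-like is zero.

For `H = k[G]` the algebra `H^*` consists of the functions on `G` with pointwise product, `S² = 1`,
and the straightening relation says `f g = g f(g · g⁻¹)`. Thus the double is the crossed product of
the functions on `G × G` with `G` acting by simultaneous conjugation. An explicit representation on
functions on `G³` shows that the multiplication map is injective (`lift_mulMap`). The coproduct
sends `f` to the function `(a, b) ↦ f(ba)`; pulling back functions along `(a, b) ↦ ba` is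
multiplicative and commutes with conjugation, so the relations are respected. All Hopf axioms are
then checked on generators. A pivotal element is a central group-like of `H`, and stays central in
the double.

A half-braiding is determined by the vectors `λ_H(1 ⊗ x) = ∑ p_g x ⊗ g`, since naturality gives
`λ_A(a ⊗ x) = ∑ p_g x ⊗ g a` (`lamLin_tmul`). The tensor axiom makes `f ↦ ∑ f(g) p_g`
multiplicative, `H`-linearity gives the crossing relation and COMM makes the two actions commute.
Conversely such projections define a half-braiding by the same formula. So an object of the center
is an `H`-module with two commuting `G`-gradings whose degrees are conjugated by the action of `G`,
which is exactly a module over the double. In the naive tensor product `A` passes `X` and then `Y`,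
so degrees `g` and `h` combine to `h g` (`coact_tensorHB`). This is the coproduct of `H^{*,cop}`,
and therefore the identity map is a tensor structure. -/

/-- In finite dimension every functional on `M ⊗ N` is a sum of products of functionals on the
factors. -/
theorem tensor_ext_dual {k M N : Type*} [Field k] [AddCommGroup M] [AddCommGroup N] [Module k M]
    [Module k N] [FiniteDimensional k M] [FiniteDimensional k N] {t t' : M ⊗[k] N}
    (h : ∀ (f : Module.Dual k M) (g : Module.Dual k N),
      TensorProduct.dualDistrib k M N (f ⊗ₜ g) t = TensorProduct.dualDistrib k M N (f ⊗ₜ g) t') :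
    t = t' := by
  rw [← sub_eq_zero, ← Module.forall_dual_apply_eq_zero_iff k]
  intro φ
  obtain ⟨s, rfl⟩ := (TensorProduct.dualDistribEquiv k M N).surjective φ
  change TensorProduct.dualDistrib k M N s (t - t') = 0
  induction s with
  | zero => simp
  | tmul f g => rw [map_sub, h, sub_self]
  | add x y hx hy => rw [map_add, LinearMap.add_apply, hx, hy, add_zero]

/-- A finite-dimensional bialgebra in characteristic zero has no nonzero primitive elements. -/
theorem eq_zero_of_primitive {k H : Type*} [Field k] [CharZero k] [Ring H] [Bialgebra k H]
    [FiniteDimensional k H] {y : H}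
    (hy : Coalgebra.comul (R := k) y = y ⊗ₜ[k] 1 + 1 ⊗ₜ[k] y) : y = 0 := by
  have hc : Coalgebra.counit (R := k) y • (1 : H) = 0 := by
    have h := congrArg (TensorProduct.lid k H) (Coalgebra.rTensor_counit_comul (R := k) y)
    rw [hy] at h
    simpa using h
  by_cases hmem : y ∈ Submodule.span k {(1 : H)}
  · obtain ⟨c, rfl⟩ := Submodule.mem_span_singleton.1 hmem
    simpa using hc
  exfalso
  obtain ⟨f, hfy, hf⟩ := Submodule.exists_le_ker_of_notMem hmem
  have hf1 : f 1 = 0 := hf (Submodule.mem_span_singleton_self 1)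
  -- `T = (id ⊗ f) Δ` behaves like a derivative on powers of `y`: since `f 1 = 0`, the top term of
  -- the binomial expansion disappears.
  let T : H →ₗ[k] H := (TensorProduct.rid k H).toLinearMap ∘ₗ f.lTensor H ∘ₗ Coalgebra.comul
  have hT : ∀ j, T (y ^ j) = ∑ i ∈ Finset.range j, ((j.choose i : k) * f (y ^ (j - i))) • y ^ i := by
    intro j
    have hcomm : Commute (y ⊗ₜ[k] (1 : H)) ((1 : H) ⊗ₜ[k] y) := by
      simp [Commute, SemiconjBy]
    have h : Coalgebra.comul (R := k) (y ^ j) =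
        ∑ i ∈ Finset.range (j + 1), (j.choose i : k) • ((y ^ i) ⊗ₜ[k] (y ^ (j - i))) := by
      rw [Bialgebra.comul_pow, hy, hcomm.add_pow]
      refine Finset.sum_congr rfl fun i _ => ?_
      simp [Algebra.TensorProduct.tmul_pow, ← nsmul_eq_mul', Nat.cast_smul_eq_nsmul]
    simp [T, h, Finset.sum_range_succ, hf1, mul_smul]
  let p := minpoly k y
  have hint : IsIntegral k y := Algebra.IsIntegral.isIntegral y
  -- `q` is the formal image under `T` of the minimal polynomial `p`, so `q(y) = T(p(y)) = 0`. Its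
  -- degree is smaller than that of `p`, and it is nonzero because its coefficient one below the
  -- degree `n` of `p` is `n f(y)`, where characteristic zero enters.
  let q : Polynomial k := ∑ j ∈ Finset.range (p.natDegree + 1), ∑ i ∈ Finset.range j,
    Polynomial.monomial i (p.coeff j * ((j.choose i : k) * f (y ^ (j - i))))
  have hq : Polynomial.aeval y q = 0 := by
    have h0 : T (Polynomial.aeval y p) = 0 := by rw [minpoly.aeval, map_zero]
    rw [Polynomial.aeval_eq_sum_range, map_sum] at h0
    rw [← h0, map_sum]
    refine Finset.sum_congr rfl fun j _ => ?_
    rw [map_smul, hT, map_sum, Finset.smul_sum]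
    refine Finset.sum_congr rfl fun i _ => ?_
    rw [Polynomial.aeval_monomial, ← Algebra.smul_def, mul_smul]
  have hpos : 0 < p.natDegree := by
    have : Nontrivial H := ⟨y, 0, fun h => hfy (by rw [h, map_zero])⟩
    exact minpoly.natDegree_pos hint
  have hcoeff : q.coeff (p.natDegree - 1) = p.natDegree * f y := by
    simp only [q, Polynomial.finsetSum_coeff, Polynomial.coeff_monomial]
    rw [Finset.sum_eq_single_of_mem p.natDegree (by simp)]
    · rw [Finset.sum_eq_single_of_mem (p.natDegree - 1) (by simp [hpos])]
      · obtain ⟨n, hn⟩ : ∃ n, p.natDegree = n + 1 := ⟨p.natDegree - 1, by omega⟩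
        have hlead : p.coeff p.natDegree = 1 := minpoly.monic hint
        rw [hlead, hn]
        simp
      · intro b _ hb
        rw [if_neg hb]
    · intro b hb hb'
      refine Finset.sum_eq_zero fun i hi => if_neg ?_
      simp only [Finset.mem_range] at hb hi
      omega
  have hq0 : q ≠ 0 := by
    intro h
    rw [h, Polynomial.coeff_zero, eq_comm, mul_eq_zero, Nat.cast_eq_zero] at hcoeff
    exact hcoeff.elim hpos.ne' hfy
  have hlt : q.degree < p.degree := by
    rw [Polynomial.degree_eq_natDegree (minpoly.ne_zero hint)]
    refine (Polynomial.degree_sum_le _ _).trans_lt ?_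
    rw [Finset.sup_lt_iff (WithBot.bot_lt_coe _)]
    intro j hj
    refine (Polynomial.degree_sum_le _ _).trans_lt ?_
    rw [Finset.sup_lt_iff (WithBot.bot_lt_coe _)]
    intro i hi
    refine (Polynomial.degree_monomial_le _ _).trans_lt ?_
    simp only [Finset.mem_range] at hi hj
    exact_mod_cast (show i < p.natDegree by omega)
  exact absurd (minpoly.degree_le_of_ne_zero k y hq0 hq) (not_le.2 hlt)

variable {k H : Type u} [Field k] [Ring H] [HopfAlgebra k H] [FiniteDimensional k H]

instance : FiniteDimensional k (WithConv (H →ₗ[k] k)) :=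
  Module.Finite.equiv (WithConv.linearEquiv k (H →ₗ[k] k)).symm

theorem exists_eval_eq (L : WithConv (H →ₗ[k] k) →ₗ[k] k) :
    ∃ x : H, ∀ f, L f = f.ofConv x := by
  obtain ⟨x, hx⟩ := (Module.evalEquiv k H).surjective
    (L ∘ₗ (WithConv.linearEquiv k (H →ₗ[k] k)).symm.toLinearMap)
  refine ⟨x, fun f => ?_⟩
  have := LinearMap.congr_fun hx f.ofConv
  simpa using this.symm

theorem conv_apply (f g : WithConv (H →ₗ[k] k)) (x : H) :
    (f * g).ofConv x =
      TensorProduct.dualDistrib k H H (f.ofConv ⊗ₜ g.ofConv) (Coalgebra.comul x) := by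
  rw [LinearMap.convMul_apply]
  generalize (Coalgebra.comul (R := k) x : H ⊗[k] H) = t
  induction t with
  | zero => simp
  | tmul a b => simp
  | add x y hx hy => simp only [map_add, hx, hy]

/-- By biduality `φ` is evaluation at some `x`. Preservation of the unit gives `ε(x) = 1`, and
multiplicativity for convolution gives `Δ x = x ⊗ x`. -/
theorem exists_groupLike_eq (φ : WithConv (H →ₗ[k] k) →ₐ[k] k) :
    ∃ g : GroupLike k H, ∀ f, φ f = f.ofConv g := by
  obtain ⟨x, hx⟩ := exists_eval_eq φ.toLinearMap
  simp only [AlgHom.toLinearMap_apply] at hx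
  refine ⟨⟨x, ?_, ?_⟩, hx⟩
  · have := hx 1
    rw [map_one] at this
    simpa using this.symm
  · refine tensor_ext_dual fun f g => ?_
    rw [← conv_apply (toConv f) (toConv g), ← hx, map_mul, hx, hx]
    rfl

variable [Coalgebra.IsCocomm k H] [CharZero k]

/-- The Leibniz rule at `g` says that the representing vector `x` satisfies `Δ x = g ⊗ x + x ⊗ g`.
Left multiplication by `g⁻¹` moves it to the identity, where it is primitive and hence zero. -/
theorem eq_zero_of_pointDerivation (g : GroupLike k H) (δ : WithConv (H →ₗ[k] k) →ₗ[k] k)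
    (h : ∀ a b, δ (a * b) = a.ofConv g * δ b + b.ofConv g * δ a) : δ = 0 := by
  obtain ⟨x, hx⟩ := exists_eval_eq δ
  have hΔ : Coalgebra.comul (R := k) x = (g : H) ⊗ₜ[k] x + x ⊗ₜ[k] (g : H) := by
    refine tensor_ext_dual fun f f' => ?_
    rw [← conv_apply (toConv f) (toConv f'), ← hx, h, hx, hx]
    simp [mul_comm]
  have hy : ((g⁻¹ : GroupLike k H) : H) * x = 0 := by
    apply eq_zero_of_primitive (k := k)
    have hg : ((g⁻¹ : GroupLike k H) : H) * g = 1 := by rw [← GroupLike.val_mul]; simp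
    rw [Bialgebra.comul_mul, hΔ, (g⁻¹).2.comul_eq_tmul_self, mul_add,
      Algebra.TensorProduct.tmul_mul_tmul, Algebra.TensorProduct.tmul_mul_tmul, hg, add_comm]
  have hx0 : x = 0 := by
    have hg : (g : H) * ((g⁻¹ : GroupLike k H) : H) = 1 := by rw [← GroupLike.val_mul]; simp
    rw [← one_mul x, ← hg, mul_assoc, hy, mul_zero]
  ext f
  simp [hx, hx0]

variable [IsAlgClosed k]

theorem exists_algEquiv_quotient {A : Type*} [CommRing A] [Algebra k A] [FiniteDimensional k A]
    (m : Ideal A) [m.IsMaximal] : Nonempty ((A ⧸ m) ≃ₐ[k] k) := by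
  let := Ideal.Quotient.field m
  exact ⟨(AlgEquiv.ofBijective (Algebra.ofId k (A ⧸ m))
    IsAlgClosed.algebraMap_bijective_of_isIntegral).symm⟩

/-- If the module of differentials were nonzero, a simple quotient of it would be a residue field,
which is `k`. Composing with the universal derivation would give a derivation at a group-like; this
vanishes, although the differentials `D a` generate the module. -/
theorem formallyUnramified_dual : Algebra.FormallyUnramified k (WithConv (H →ₗ[k] k)) := by
  let A := WithConv (H →ₗ[k] k)
  constructor
  by_contra hΩ
  rw [not_subsingleton_iff_nontrivial] at hΩ
  obtain ⟨W, hW, -⟩ := (eq_top_or_exists_le_coatom (⊥ : Submodule A (Ω[A⁄k]))).resolve_left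
    bot_ne_top
  have hs : IsSimpleModule A (Ω[A⁄k] ⧸ W) := isSimpleModule_iff_isCoatom.2 hW
  obtain ⟨m, hm, ⟨e⟩⟩ := isSimpleModule_iff_quot_maximal.1 hs
  obtain ⟨e'⟩ := exists_algEquiv_quotient (k := k) m
  let φ : A →ₐ[k] k := e'.toAlgHom.comp (Ideal.Quotient.mkₐ k m)
  obtain ⟨g, hg⟩ := exists_groupLike_eq φ
  let r : Ω[A⁄k] →ₗ[A] A ⧸ m := e.toLinearMap ∘ₗ W.mkQ
  let δ : A →ₗ[k] k := e'.toLinearMap ∘ₗ (r.restrictScalars k) ∘ₗ (KaehlerDifferential.D k A)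
  have hr : ∀ (a : A) (w : Ω[A⁄k]), e' (r (a • w)) = a.ofConv g * e' (r w) := by
    intro a w
    rw [← hg, map_smul]
    exact (congrArg e' (Algebra.smul_def a (r w))).trans (map_mul e' _ _)
  have hδ : δ = 0 := by
    refine eq_zero_of_pointDerivation g δ fun a b => ?_
    change e' (r (KaehlerDifferential.D k A (a * b))) = _
    rw [Derivation.leibniz, map_add, map_add, hr, hr]
    rfl
  have hr0 : LinearMap.ker r = ⊤ := by
    rw [eq_top_iff, ← KaehlerDifferential.span_range_derivation, Submodule.span_le]
    rintro _ ⟨a, rfl⟩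
    exact e'.injective ((LinearMap.congr_fun hδ a).trans (map_zero e').symm)
  have hrs : Function.Surjective r := e.surjective.comp W.mkQ_surjective
  obtain ⟨w, hw⟩ := hrs 1
  have : (1 : A ⧸ m) = 0 := by
    rw [← hw]
    exact LinearMap.mem_ker.1 (hr0 ▸ Submodule.mem_top)
  exact (Ideal.ne_top_iff_one m).1 hm.ne_top (Ideal.Quotient.eq_zero_iff_mem.1 this)

/-- Cartier's theorem for finite-dimensional cocommutative Hopf algebras over an algebraically
closed field of characteristic zero. -/
theorem span_groupLike : Submodule.span k (Set.range (GroupLike.val (R := k) (A := H))) = ⊤ := by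
  let A := WithConv (H →ₗ[k] k)
  have hU : Algebra.FormallyUnramified k A := formallyUnramified_dual
  have hred : IsReduced A := Algebra.FormallyUnramified.isReduced_of_field k A
  have hart : IsArtinianRing A := isArtinian_of_tower k inferInstance
  by_contra hne
  obtain ⟨x, hx⟩ : ∃ x, x ∉ Submodule.span k (Set.range (GroupLike.val (R := k) (A := H))) := by
    by_contra! h
    exact hne (eq_top_iff.2 fun x _ => h x)
  obtain ⟨f, hfx, hf⟩ := Submodule.exists_le_ker_of_notMem hx
  -- Every prime of the Artinian ring `A` is maximal with residue field `k`, so it is the kernel of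
  -- evaluation at a group-like, and `f` lies in all of them.
  have hnil : IsNilpotent (toConv f : A) := by
    rw [nilpotent_iff_mem_prime]
    intro m hm
    have := IsArtinianRing.isMaximal_of_isPrime m
    obtain ⟨e'⟩ := exists_algEquiv_quotient (k := k) m
    obtain ⟨g, hg⟩ := exists_groupLike_eq (e'.toAlgHom.comp (Ideal.Quotient.mkₐ k m))
    have h0 : e' (Ideal.Quotient.mk m (toConv f)) = 0 :=
      (hg (toConv f)).trans (hf (Submodule.subset_span ⟨g, rfl⟩))
    exact Ideal.Quotient.eq_zero_iff_mem.1 (e'.injective (h0.trans (map_zero e').symm))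
  have h0 : f = 0 := congrArg ofConv hnil.eq_zero
  exact hfx (by rw [h0]; rfl)

end Cartier

end Elliptic

namespace Elliptic

/-! ### Consequences of `H = k[G]`: coordinates, delta functions, involutive antipode. -/

section GroupLikeBasis

set_option linter.unusedSectionVars false

open WithConv

variable {k H : Type u} [Field k] [Ring H] [HopfAlgebra k H] [FiniteDimensional k H]

theorem comul_groupLike (g : GroupLike k H) :
    Coalgebra.comul (R := k) (g : H) = (g : H) ⊗ₜ[k] (g : H) := g.2.comul_eq_tmul_self

theorem counit_groupLike (g : GroupLike k H) : Coalgebra.counit (R := k) (g : H) = 1 :=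
  g.2.counit_eq_one

theorem antipode_groupLike (g : GroupLike k H) :
    HopfAlgebra.antipode k (g : H) = ((g⁻¹ : GroupLike k H) : H) := rfl

theorem groupLike_mul_inv (g : GroupLike k H) : (g : H) * ((g⁻¹ : GroupLike k H) : H) = 1 := by
  rw [← GroupLike.val_mul, mul_inv_cancel, GroupLike.val_one]

theorem groupLike_inv_mul (g : GroupLike k H) : ((g⁻¹ : GroupLike k H) : H) * (g : H) = 1 := by
  rw [← GroupLike.val_mul, inv_mul_cancel, GroupLike.val_one]

theorem conv_groupLike (f f' : Module.Dual k H) (g : GroupLike k H) :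
    (toConv f * toConv f').ofConv (g : H) = f g * f' g := by
  rw [conv_apply, comul_groupLike]
  rfl

instance : Finite (GroupLike k H) :=
  (linearIndep_groupLikeVal (R := k) (A := H)).finite

instance : Fintype (GroupLike k H) := Fintype.ofFinite _

variable [IsAlgClosed k] [CharZero k] [Coalgebra.IsCocomm k H]

variable (k H) in
/-- The basis of group-like elements. -/
def groupLikeBasis : Module.Basis (GroupLike k H) k H :=
  Module.Basis.mk linearIndep_groupLikeVal span_groupLike.ge

@[simp] theorem groupLikeBasis_apply (g : GroupLike k H) : groupLikeBasis k H g = g :=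
  Module.Basis.mk_apply _ _ g

/-- This is the form in which Cartier's theorem is used below: any identity linear in an element of
`H` needs checking only on group-likes. -/
theorem linearMap_ext_groupLike {M : Type*} [AddCommGroup M] [Module k M] {φ ψ : H →ₗ[k] M}
    (h : ∀ g : GroupLike k H, φ g = ψ g) : φ = ψ :=
  (groupLikeBasis k H).ext fun g => by simpa using h g

/-- The functional dual to a group-like element with respect to the basis of group-like
elements. -/
def delta (g : GroupLike k H) : Module.Dual k H := (groupLikeBasis k H).coord g

open Classical in
theorem delta_apply (g h : GroupLike k H) : delta g (h : H) = if g = h then 1 else 0 := by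
  rw [delta, Module.Basis.coord_apply, ← groupLikeBasis_apply h, Module.Basis.repr_self,
    Finsupp.single_apply]
  simp [eq_comm]

theorem sum_delta_smul (h : H) : ∑ g : GroupLike k H, delta g h • (g : H) = h := by
  conv_rhs => rw [← (groupLikeBasis k H).sum_repr h]
  simp [delta]

theorem dual_eq_sum_delta (f : Module.Dual k H) : ∑ g : GroupLike k H, f g • delta g = f := by
  classical
  refine linearMap_ext_groupLike fun h => ?_
  simp [delta_apply]

theorem tensor_eq_sum_left {N : Type*} [AddCommGroup N] [Module k N] (t : H ⊗[k] N) :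
    ∑ g : GroupLike k H, (g : H) ⊗ₜ[k] TensorProduct.lid k N ((delta g).rTensor N t) = t := by
  induction t with
  | zero => simp
  | tmul h n =>
    conv_rhs => rw [← sum_delta_smul (k := k) h]
    simp only [LinearMap.rTensor_tmul, TensorProduct.lid_tmul, TensorProduct.tmul_smul,
      TensorProduct.sum_tmul, TensorProduct.smul_tmul']
  | add x y hx hy =>
    simp only [map_add, TensorProduct.tmul_add, Finset.sum_add_distrib, hx, hy]

theorem tensor_eq_sum_right {N : Type*} [AddCommGroup N] [Module k N] (t : N ⊗[k] H) :
    ∑ g : GroupLike k H, TensorProduct.rid k N ((delta g).lTensor N t) ⊗ₜ[k] (g : H) = t := by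
  induction t with
  | zero => simp
  | tmul n h =>
    conv_rhs => rw [← sum_delta_smul (k := k) h]
    simp only [LinearMap.lTensor_tmul, TensorProduct.rid_tmul, TensorProduct.tmul_smul,
      TensorProduct.tmul_sum, TensorProduct.smul_tmul']
  | add x y hx hy =>
    simp only [map_add, TensorProduct.add_tmul, Finset.sum_add_distrib, hx, hy]

/-- Elements of `H^* ⊗ H^*` are functions on `G × G`, so equality is pointwise. -/
theorem eval₂_ext {t t' : DualCop k H ⊗[k] DualCop k H}
    (h : ∀ a b : GroupLike k H, eval₂ (a : H) (b : H) t = eval₂ (a : H) (b : H) t') : t = t' := by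
  refine (TensorProduct.dualDistribEquiv k H H).injective ?_
  refine TensorProduct.ext (linearMap_ext_groupLike fun a => linearMap_ext_groupLike fun b => ?_)
  exact h a b

/-- An algebra homomorphism on `H` is given by a homomorphism on the group of group-like
elements. -/
def liftGroupLike {B : Type*} [Ring B] [Algebra k B] (m : GroupLike k H →* B) : H →ₐ[k] B :=
  AlgHom.ofLinearMap ((groupLikeBasis k H).constr k m)
    (by
      have h := (groupLikeBasis k H).constr_basis k m 1
      rwa [groupLikeBasis_apply, GroupLike.val_one, MonoidHom.map_one] at h)
    (by
      have hm : ∀ g : GroupLike k H, (groupLikeBasis k H).constr k m (g : H) = m g := by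
        intro g
        rw [← groupLikeBasis_apply, Module.Basis.constr_basis]
      intro x y
      refine LinearMap.congr_fun (f := (groupLikeBasis k H).constr k m ∘ₗ LinearMap.mulRight k y)
        (g := LinearMap.mulRight k _ ∘ₗ (groupLikeBasis k H).constr k m)
        (linearMap_ext_groupLike fun a => ?_) x
      refine LinearMap.congr_fun
        (f := (groupLikeBasis k H).constr k m ∘ₗ LinearMap.mulLeft k (a : H))
        (g := LinearMap.mulLeft k _ ∘ₗ (groupLikeBasis k H).constr k m)
        (linearMap_ext_groupLike fun b => ?_) y
      simp only [LinearMap.comp_apply, LinearMap.mulLeft_apply]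
      rw [← GroupLike.val_mul, hm, hm, hm, map_mul])

@[simp] theorem liftGroupLike_apply {B : Type*} [Ring B] [Algebra k B] (m : GroupLike k H →* B)
    (g : GroupLike k H) : liftGroupLike m (g : H) = m g := by
  change (groupLikeBasis k H).constr k m (g : H) = m g
  rw [← groupLikeBasis_apply, Module.Basis.constr_basis]

/-- On group-likes the antipode is inversion. As a consequence `S⁻¹ = S`, which removes the inverse
antipode from all relations. -/
theorem antipode_comp_antipode :
    HopfAlgebra.antipode k (A := H) ∘ₗ HopfAlgebra.antipode k = LinearMap.id :=
  linearMap_ext_groupLike fun g => g.2.antipode_antipode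

theorem antipode_antipode (h : H) :
    HopfAlgebra.antipode k (HopfAlgebra.antipode k h) = h :=
  LinearMap.congr_fun antipode_comp_antipode h

theorem antipodeInv_eq : antipodeInv k H = HopfAlgebra.antipode k := by
  let U : (Module.End k H)ˣ := ⟨HopfAlgebra.antipode k, HopfAlgebra.antipode k,
    antipode_comp_antipode, antipode_comp_antipode⟩
  exact Ring.inverse_unit U

end GroupLikeBasis

namespace EllipticDouble

/-! ### Generators of the double, its relations on group-likes, and its universal property. -/

section Basic

set_option linter.unusedSectionVars false

open WithConv

variable {k H : Type u} [Field k] [Ring H] [HopfAlgebra k H]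

theorem translate_apply (f : Module.Dual k H) (a b x : H) : translate f a b x = f (a * (x * b)) :=
  rfl

/-- The inclusion of `H` as a linear map on generators. -/
def genHLin : H →ₗ[k] TensorAlgebra k (Gen k H) := TensorAlgebra.ι k ∘ₗ LinearMap.inl k _ _

/-- The inclusion of the copies of `H^*` as linear maps on generators. -/
def genDLin (i : Fin 2) : Module.Dual k H →ₗ[k] TensorAlgebra k (Gen k H) :=
  TensorAlgebra.ι k ∘ₗ LinearMap.inr k _ _ ∘ₗ
    (if i = 0 then LinearMap.inl k _ _ else LinearMap.inr k _ _)

theorem genDLin_apply (i : Fin 2) (f : Module.Dual k H) : genDLin i f = genD i f := by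
  fin_cases i <;> rfl

variable (k H) in
/-- The quotient map from the tensor algebra. -/
def quotHom : TensorAlgebra k (Gen k H) →ₐ[k] Del k H :=
  RingQuot.mkAlgHom k (Rel ((1 : H) ⊗ₜ[k] (1 : H)))

theorem quotHom_rel {x y : TensorAlgebra k (Gen k H)} (h : Rel ((1 : H) ⊗ₜ[k] (1 : H)) x y) :
    quotHom k H x = quotHom k H y := RingQuot.mkAlgHom_rel k h

/-- The inclusion of `H` as an algebra homomorphism. -/
def ιHom : H →ₐ[k] Del k H :=
  AlgHom.ofLinearMap ((quotHom k H).toLinearMap ∘ₗ genHLin)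
    ((quotHom_rel Rel.one_H).trans (map_one _))
    (fun a b => (quotHom_rel (Rel.mul_H a b)).trans (map_mul _ _ _))

theorem ιHom_apply (h : H) : ιHom h = ι ((1 : H) ⊗ₜ[k] (1 : H)) h := rfl

/-- The inclusions of the two copies of `H^*` as linear maps. -/
def ιDLin (i : Fin 2) : Module.Dual k H →ₗ[k] Del k H := (quotHom k H).toLinearMap ∘ₗ genDLin i

theorem ιDLin_apply (i : Fin 2) (f : Module.Dual k H) :
    ιDLin i f = ιD ((1 : H) ⊗ₜ[k] (1 : H)) i f := by
  change quotHom k H (genDLin i f) = _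
  rw [genDLin_apply]
  rfl

theorem ιDLin_counit (i : Fin 2) : ιDLin i (Coalgebra.counit (R := k) (A := H)) = 1 := by
  rw [ιDLin_apply]
  exact (quotHom_rel (Rel.one_D i)).trans (map_one _)

theorem ιDLin_mul (i : Fin 2) (f g : Module.Dual k H) :
    ιDLin i (toConv f * toConv g).ofConv = ιDLin i f * ιDLin i g := by
  simp only [ιDLin_apply]
  exact (quotHom_rel (Rel.mul_D i f g)).trans (map_mul _ _ _)

/-- The general relation is applied to the one-term expression `1 ⊗ 1` of the R-matrix, for which
all translations are trivial. -/
theorem ιDLin_comm (f₁ f₂ : Module.Dual k H) :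
    ιDLin 1 f₂ * ιDLin 0 f₁ = ιDLin 0 f₁ * ιDLin 1 f₂ := by
  have h := quotHom_rel (Rel.comm f₁ f₂ 1
    (fun _ => 1) (fun _ => 1) (by simp))
  have ht : ∀ f : Module.Dual k H, translate f 1 1 = f := fun f => by
    ext x
    simp [translate_apply]
  simp only [Finset.univ_unique, Finset.sum_singleton, ht, map_mul] at h
  simp only [ιDLin_apply]
  exact h

/-- A subalgebra that contains the generators is everything. -/
theorem subalgebra_eq_top {P : Subalgebra k (Del k H)} (hι : ∀ h : H, ιHom h ∈ P)
    (hD : ∀ i (f : Module.Dual k H), ιDLin i f ∈ P) : P = ⊤ := by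
  have h : P.comap (quotHom k H) = ⊤ := by
    rw [eq_top_iff, ← TensorAlgebra.adjoin_range_ι, Algebra.adjoin_le_iff]
    rintro _ ⟨⟨h, f₁, f₂⟩, rfl⟩
    have hs : ((h, f₁, f₂) : Gen k H) = (h, 0, 0) + ((0, f₁, 0) + (0, 0, f₂)) := by simp
    rw [hs]
    simp only [map_add, SetLike.mem_coe]
    have h₀ := hD 0 f₁
    have h₁ := hD 1 f₂
    rw [ιDLin_apply] at h₀ h₁
    exact add_mem (hι h) (add_mem h₀ h₁)
  rw [eq_top_iff]
  intro x _
  obtain ⟨y, rfl⟩ := RingQuot.mkAlgHom_surjective k (Rel ((1 : H) ⊗ₜ[k] (1 : H))) x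
  have : y ∈ P.comap (quotHom k H) := h ▸ Algebra.mem_top
  exact this

theorem induction_generators {p : Del k H → Prop} (hι : ∀ h : H, p (ιHom h))
    (hD : ∀ i (f : Module.Dual k H), p (ιDLin i f))
    (hadd : ∀ x y, p x → p y → p (x + y)) (hmul : ∀ x y, p x → p y → p (x * y))
    (x : Del k H) : p x := by
  let P : Subalgebra k (Del k H) :=
    { carrier := {x | p x}
      mul_mem' := hmul _ _
      add_mem' := hadd _ _
      algebraMap_mem' := fun c => by
        have := hι (algebraMap k H c)
        rwa [AlgHom.commutes] at this }
  have hP : P = ⊤ := subalgebra_eq_top hι hD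
  exact (hP ▸ Algebra.mem_top : x ∈ P)

theorem algHom_ext {B : Type*} [Semiring B] [Algebra k B] {φ ψ : Del k H →ₐ[k] B}
    (hι : ∀ h : H, φ (ιHom h) = ψ (ιHom h))
    (hD : ∀ i (f : Module.Dual k H), φ (ιDLin i f) = ψ (ιDLin i f)) : φ = ψ :=
  AlgHom.ext fun x => induction_generators (p := fun x => φ x = ψ x) hι hD
    (fun x y hx hy => by rw [map_add, map_add, hx, hy])
    (fun x y hx hy => by rw [map_mul, map_mul, hx, hy]) x

/-- The functional `x ↦ f (g x g⁻¹)`. -/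
def conj (g : GroupLike k H) (f : Module.Dual k H) : Module.Dual k H :=
  translate f (g : H) ((g⁻¹ : GroupLike k H) : H)

theorem conj_apply (g x : GroupLike k H) (f : Module.Dual k H) :
    conj g f (x : H) = f ((g * x * g⁻¹ : GroupLike k H) : H) := by
  simp only [conj, translate_apply, GroupLike.val_mul, mul_assoc]

variable [FiniteDimensional k H] [IsAlgClosed k] [CharZero k] [Coalgebra.IsCocomm k H]

/-- The iterated coproduct of `g` is the single term `g ⊗ g ⊗ g`, so the sum in the defining
relation collapses to a conjugation. -/
theorem ιDLin_mul_ιHom (i : Fin 2) (f : Module.Dual k H) (g : GroupLike k H) :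
    ιDLin i f * ιHom (g : H) = ιHom (g : H) * ιDLin i (conj g f) := by
  have h := quotHom_rel (Rel.cross i f (g : H) 1
    (fun _ => g) (fun _ => g) (fun _ => g) (by simp))
  simp only [Finset.univ_unique, Finset.sum_singleton, map_mul, antipodeInv_eq] at h
  simp only [ιDLin_apply]
  exact h

variable (k H) in
/-- The data of an algebra homomorphism on `D^el(H)`. -/
structure LiftData (B : Type*) [Ring B] [Algebra k B] where
  φ : H →ₐ[k] B
  ψ : Fin 2 → Module.Dual k H →ₗ[k] B
  one : ∀ i, ψ i (Coalgebra.counit (R := k) (A := H)) = 1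
  mul : ∀ i (f f' : Module.Dual k H), ψ i (toConv f * toConv f').ofConv = ψ i f * ψ i f'
  cross : ∀ i (f : Module.Dual k H) (g : GroupLike k H),
    ψ i f * φ (g : H) = φ (g : H) * ψ i (conj g f)
  comm : ∀ f₁ f₂ : Module.Dual k H, ψ 1 f₂ * ψ 0 f₁ = ψ 0 f₁ * ψ 1 f₂

namespace LiftData

variable {B : Type*} [Ring B] [Algebra k B] (d : LiftData k H B)

/-- The homomorphism on the tensor algebra. -/
def tensorHom : TensorAlgebra k (Gen k H) →ₐ[k] B :=
  TensorAlgebra.lift k (d.φ.toLinearMap.coprod ((d.ψ 0).coprod (d.ψ 1)))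

theorem tensorHom_genH (h : H) : d.tensorHom (genH h) = d.φ h := by
  simp [tensorHom, genH]

theorem tensorHom_genD (i : Fin 2) (f : Module.Dual k H) : d.tensorHom (genD i f) = d.ψ i f := by
  fin_cases i <;> simp [tensorHom, genD]

/-- `translate` as a linear map in all of its arguments. -/
def translateLin : Module.Dual k H →ₗ[k] H →ₗ[k] H →ₗ[k] Module.Dual k H :=
  LinearMap.mk₂ k (fun f a => LinearMap.mk
      ⟨fun b => translate f a b, fun b b' => by ext; simp [translate_apply, mul_add]⟩
      (fun c b => by ext; simp [translate_apply]))
    (fun f f' a => by ext; simp [translate_apply])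
    (fun c f a => by ext; simp [translate_apply])
    (fun f a a' => by ext; simp [translate_apply, add_mul])
    (fun c f a => by ext; simp [translate_apply])

/-- The crossing relation is only assumed on group-likes. This suffices because its right-hand side
is a linear function of the iterated coproduct of `h`: it does not depend on the chosen
decomposition, and it is linear in `h`. -/
theorem tensorHom_rel ⦃x y : TensorAlgebra k (Gen k H)⦄ (h : Rel ((1 : H) ⊗ₜ[k] (1 : H)) x y) :
    d.tensorHom x = d.tensorHom y := by
  induction h with
  | one_H => rw [tensorHom_genH, map_one, map_one]
  | mul_H a b => simp only [map_mul, tensorHom_genH]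
  | one_D i => rw [tensorHom_genD, d.one, map_one]
  | mul_D i f g => simp only [map_mul, tensorHom_genD, d.mul]
  | cross i f h n h₁ h₂ h₃ hh =>
    simp only [map_sum, map_mul, tensorHom_genD, tensorHom_genH]
    let L : H ⊗[k] (H ⊗[k] H) →ₗ[k] B :=
      LinearMap.mul' k B ∘ₗ TensorProduct.map d.φ.toLinearMap
        (d.ψ i ∘ₗ TensorProduct.lift (translateLin f)) ∘ₗ
        (TensorProduct.assoc k H H H).toLinearMap ∘ₗ (TensorProduct.comm k H (H ⊗[k] H)).toLinearMap
        ∘ₗ (antipodeInv k H).rTensor _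
    have hL : ∀ a b c : H, L (a ⊗ₜ (b ⊗ₜ c)) = d.φ b * d.ψ i (translate f c (antipodeInv k H a)) :=
      fun a b c => rfl
    simp only [← hL]
    rw [← map_sum, ← hh]
    let M : H →ₗ[k] B := L ∘ₗ (Coalgebra.comul (R := k)).lTensor H ∘ₗ Coalgebra.comul (R := k)
    refine LinearMap.congr_fun (f := LinearMap.mulLeft k (d.ψ i f) ∘ₗ d.φ.toLinearMap) (g := M)
      (linearMap_ext_groupLike fun g => ?_) h
    simp only [M, LinearMap.comp_apply, comul_groupLike, LinearMap.lTensor_tmul, hL,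
      antipodeInv_eq]
    exact d.cross i f g
  | comm f₁ f₂ n s t hR =>
    simp only [map_sum, map_mul, tensorHom_genD]
    let T₁ := TensorProduct.lift (translateLin f₁)
    let T₂ := TensorProduct.lift (translateLin f₂)
    let L : (H ⊗[k] H) ⊗[k] (H ⊗[k] H) →ₗ[k] B :=
      LinearMap.mul' k B ∘ₗ TensorProduct.map (d.ψ 0 ∘ₗ T₁) (d.ψ 1 ∘ₗ T₂) ∘ₗ
        (TensorProduct.tensorTensorTensorComm k H H H H).toLinearMap ∘ₗ
        (TensorProduct.comm k H H).toLinearMap.rTensor _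
    have hL : ∀ a b a' b' : H, L ((a ⊗ₜ b) ⊗ₜ (a' ⊗ₜ b')) =
        d.ψ 0 (translate f₁ b a') * d.ψ 1 (translate f₂ a b') := fun a b a' b' => rfl
    have ht : ∀ f : Module.Dual k H, translate f 1 1 = f := fun f => by
      ext x
      simp [translate_apply]
    have h := hL 1 1 1 1
    rw [ht, ht] at h
    rw [d.comm, ← h]
    simp only [← hL]
    -- The double sum is the value of `L` at the tensor square of the R-matrix, so both factors `1 ⊗
    -- 1` are replaced by the given decomposition.
    conv_lhs => rw [hR]
    simp only [TensorProduct.sum_tmul, TensorProduct.tmul_sum, map_sum]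
    rw [Finset.sum_comm]

/-- The induced homomorphism on `D^el(H)`. -/
def lift : Del k H →ₐ[k] B := RingQuot.liftAlgHom k ⟨d.tensorHom, d.tensorHom_rel⟩

@[simp] theorem lift_ιHom (h : H) : d.lift (ιHom h) = d.φ h :=
  (RingQuot.liftAlgHom_mkAlgHom_apply k _ _ _).trans (d.tensorHom_genH h)

@[simp] theorem lift_ιDLin (i : Fin 2) (f : Module.Dual k H) : d.lift (ιDLin i f) = d.ψ i f := by
  rw [ιDLin_apply]
  exact (RingQuot.liftAlgHom_mkAlgHom_apply k _ _ _).trans (d.tensorHom_genD i f)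

end LiftData

end Basic

end EllipticDouble

end Elliptic

namespace Elliptic
namespace EllipticDouble

/-! ### Bijectivity of the multiplication map. -/

section PBW

set_option linter.unusedSectionVars false

open WithConv

variable {k H : Type u} [Field k] [Ring H] [HopfAlgebra k H] [FiniteDimensional k H]
  [IsAlgClosed k] [CharZero k] [Coalgebra.IsCocomm k H]

variable (k H) in
/-- The identification of the dual of `H` with the underlying space of `H^{*,cop}`. -/
def cop : Module.Dual k H ≃ₗ[k] DualCop k H := LinearEquiv.refl k (Module.Dual k H)

@[simp] theorem cop_apply (f : Module.Dual k H) (x : H) : cop k H f x = f x := rfl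

variable (k H) in
/-- The inclusions of `H_i^*`, on the coalgebra `H^{*,cop}`. -/
def ιCop (i : Fin 2) : DualCop k H →ₗ[k] Del k H := ιDLin i ∘ₗ (cop k H).symm.toLinearMap

@[simp] theorem ιCop_cop (i : Fin 2) (f : Module.Dual k H) :
    ιCop k H i (cop k H f) = ιDLin i f := rfl

variable (k H) in
/-- The multiplication map `h ⊗ f¹ ⊗ f² ↦ h f¹ f²`. -/
def mulMap : H ⊗[k] (DualCop k H ⊗[k] DualCop k H) →ₗ[k] Del k H :=
  LinearMap.mul' k (Del k H) ∘ₗ TensorProduct.map ιHom.toLinearMap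
    (LinearMap.mul' k (Del k H) ∘ₗ TensorProduct.map (ιCop k H 0) (ιCop k H 1))

theorem mulMap_tmul (h : H) (f₁ f₂ : Module.Dual k H) :
    mulMap k H (h ⊗ₜ (cop k H f₁ ⊗ₜ cop k H f₂)) = ιHom h * (ιDLin 0 f₁ * ιDLin 1 f₂) := rfl

variable (k H) in
/-- The space of functions of three group-like elements. -/
abbrev Fun₃ : Type u := GroupLike k H × GroupLike k H × GroupLike k H → k

/-- The action of the group-like elements on functions of three group-like elements, by translation
of the first variable and conjugation of the other two. -/
def fun₃Action : GroupLike k H →* Module.End k (Fun₃ k H) where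
  toFun g := LinearMap.funLeft k k fun p => (g⁻¹ * p.1, g⁻¹ * p.2.1 * g, g⁻¹ * p.2.2 * g)
  map_one' := by ext F p; simp [LinearMap.funLeft_apply]
  map_mul' g g' := by ext F p; simp [LinearMap.funLeft_apply, mul_assoc]

theorem fun₃Action_apply (g : GroupLike k H) (F : Fun₃ k H)
    (p : GroupLike k H × GroupLike k H × GroupLike k H) :
    fun₃Action g F p = F (g⁻¹ * p.1, g⁻¹ * p.2.1 * g, g⁻¹ * p.2.2 * g) := rfl

/-- The multiplication of functions of three group-like elements by functionals in the second or
third variable. -/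
def fun₃Mul (i : Fin 2) : Module.Dual k H →ₗ[k] Module.End k (Fun₃ k H) :=
  (LinearMap.mul k (Fun₃ k H)) ∘ₗ LinearMap.pi fun p =>
    LinearMap.applyₗ ((if i = 0 then p.2.1 else p.2.2 : GroupLike k H) : H)

theorem fun₃Mul_apply (i : Fin 2) (f : Module.Dual k H) (F : Fun₃ k H)
    (p : GroupLike k H × GroupLike k H × GroupLike k H) :
    fun₃Mul i f F p = f ((if i = 0 then p.2.1 else p.2.2 : GroupLike k H) : H) * F p := rfl

variable (k H) in
/-- The action of `D^el(H)` on functions of three group-like elements. -/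
def fun₃Data : LiftData k H (Module.End k (Fun₃ k H)) where
  φ := liftGroupLike fun₃Action
  ψ := fun₃Mul
  one i := by ext F p; simp [fun₃Mul_apply]
  mul i f f' := by
    refine LinearMap.ext fun F => funext fun p => ?_
    simp only [fun₃Mul_apply, Module.End.mul_apply, conv_groupLike, mul_assoc]
  cross i f g := by
    refine LinearMap.ext fun F => funext fun p => ?_
    simp only [fun₃Mul_apply, Module.End.mul_apply, liftGroupLike_apply, fun₃Action_apply,
      conj_apply]
    split_ifs <;> simp [mul_assoc]
  comm f₁ f₂ := by
    refine LinearMap.ext fun F => funext fun p => ?_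
    simp only [fun₃Mul_apply, Module.End.mul_apply]
    ring

-- Applied to the indicator of `p.1 = 1`, the element `g f¹ f²` gives a function supported on `p.1 =
-- g`, whose value at `(g, g a g⁻¹, g b g⁻¹)` is `f¹(a) f²(b)`. Evaluating at first coordinate `c`
-- therefore reads off the coefficient of `c` in `t`, as a function on `G × G`.
open Classical in
theorem lift_mulMap (t : H ⊗[k] (DualCop k H ⊗[k] DualCop k H)) (c a b : GroupLike k H) :
    (fun₃Data k H).lift (mulMap k H t) (fun p => if p.1 = 1 then 1 else 0)
        (c, c * a * c⁻¹, c * b * c⁻¹) =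
      eval₂ (a : H) (b : H) (TensorProduct.lid k _ ((delta c).rTensor _ t)) := by
  let ev : Module.End k (Fun₃ k H) →ₗ[k] k :=
    LinearMap.proj (c, c * a * c⁻¹, c * b * c⁻¹) ∘ₗ
      LinearMap.applyₗ (fun p => if p.1 = 1 then 1 else 0)
  refine LinearMap.congr_fun (f := ev ∘ₗ (fun₃Data k H).lift.toLinearMap ∘ₗ mulMap k H)
    (g := eval₂ (a : H) (b : H) ∘ₗ (TensorProduct.lid k _).toLinearMap ∘ₗ (delta c).rTensor _)
    (TensorProduct.ext ?_) t
  refine linearMap_ext_groupLike fun g => TensorProduct.ext' fun f₁ f₂ => ?_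
  obtain ⟨f₁, rfl⟩ := (cop k H).surjective f₁
  obtain ⟨f₂, rfl⟩ := (cop k H).surjective f₂
  change ev ((fun₃Data k H).lift (mulMap k H ((g : H) ⊗ₜ (cop k H f₁ ⊗ₜ cop k H f₂)))) =
    eval₂ (a : H) (b : H) (delta c (g : H) • (cop k H f₁ ⊗ₜ cop k H f₂))
  have hm : (fun₃Data k H).lift (ιHom (g : H) * (ιDLin 0 f₁ * ιDLin 1 f₂)) =
      (fun₃Data k H).φ (g : H) * ((fun₃Data k H).ψ 0 f₁ * (fun₃Data k H).ψ 1 f₂) := by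
    rw [map_mul, map_mul, LiftData.lift_ιHom, LiftData.lift_ιDLin, LiftData.lift_ιDLin]
  rw [mulMap_tmul, hm, map_smul, eval₂_tmul, delta_apply]
  change (liftGroupLike fun₃Action (g : H) * (fun₃Mul 0 f₁ * fun₃Mul 1 f₂)) _ _ = _
  simp only [Module.End.mul_apply, liftGroupLike_apply, fun₃Action_apply, fun₃Mul_apply,
    inv_mul_eq_one]
  by_cases h : g = c
  · subst h
    simp [mul_assoc]
  · simp [h, Ne.symm h]

variable (k H) in
theorem mulMap_injective : Function.Injective (mulMap k H) := by
  classical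
  rw [injective_iff_map_eq_zero]
  intro t ht
  rw [← tensor_eq_sum_left t]
  refine Finset.sum_eq_zero fun c _ => ?_
  have : TensorProduct.lid k _ ((delta c).rTensor _ t) = 0 := by
    refine eval₂_ext fun a b => ?_
    rw [← lift_mulMap, ht, map_zero, map_zero]
    rfl
  rw [this, TensorProduct.tmul_zero]

theorem ιHom_mul_mem_range (h : H) {y : Del k H} (hy : y ∈ LinearMap.range (mulMap k H)) :
    ιHom h * y ∈ LinearMap.range (mulMap k H) := by
  obtain ⟨t, rfl⟩ := hy
  refine ⟨(LinearMap.mulLeft k h).rTensor _ t, ?_⟩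
  induction t with
  | zero => simp
  | tmul a s =>
    simp only [mulMap, LinearMap.comp_apply, LinearMap.rTensor_tmul, TensorProduct.map_tmul,
      LinearMap.mul'_apply, LinearMap.mulLeft_apply, AlgHom.toLinearMap_apply, map_mul, mul_assoc]
  | add x y hx hy => simp only [map_add, mul_add, hx, hy]

/-- A functional is moved to the right past a group-like by conjugating it, and is then absorbed
into the factor from the same copy of `H^*`; for the second copy it first commutes past the first.
-/
theorem ιDLin_mul_mem_range (i : Fin 2) (f : Module.Dual k H) {y : Del k H}
    (hy : y ∈ LinearMap.range (mulMap k H)) :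
    ιDLin i f * y ∈ LinearMap.range (mulMap k H) := by
  obtain ⟨t, rfl⟩ := hy
  -- Membership in the range is rephrased as vanishing of a linear map to the quotient, so that it
  -- can be tested on group-likes and pure tensors.
  let π := (LinearMap.range (mulMap k H)).mkQ
  suffices h : π ∘ₗ LinearMap.mulLeft k (ιDLin i f) ∘ₗ mulMap k H = 0 from
    (Submodule.Quotient.mk_eq_zero _).1 (LinearMap.congr_fun h t)
  refine TensorProduct.ext (linearMap_ext_groupLike fun g => TensorProduct.ext' fun f₁ f₂ => ?_)
  refine (Submodule.Quotient.mk_eq_zero _).2 ?_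
  obtain ⟨f₁, rfl⟩ := (cop k H).surjective f₁
  obtain ⟨f₂, rfl⟩ := (cop k H).surjective f₂
  change ιDLin i f * mulMap k H ((g : H) ⊗ₜ (cop k H f₁ ⊗ₜ cop k H f₂)) ∈ _
  rw [mulMap_tmul, ← mul_assoc, ιDLin_mul_ιHom, mul_assoc]
  refine ιHom_mul_mem_range _ ?_
  have h1 : ∀ f₁ f₂ : Module.Dual k H,
      ιDLin 0 f₁ * ιDLin 1 f₂ ∈ LinearMap.range (mulMap k H) := fun f₁ f₂ =>
    ⟨1 ⊗ₜ (cop k H f₁ ⊗ₜ cop k H f₂), by rw [mulMap_tmul, map_one, one_mul]⟩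
  fin_cases i
  · change ιDLin 0 _ * _ ∈ _
    rw [← mul_assoc, ← ιDLin_mul]
    exact h1 _ _
  · change ιDLin 1 _ * _ ∈ _
    rw [← mul_assoc, ιDLin_comm, mul_assoc, ← ιDLin_mul]
    exact h1 _ _

-- The range is stable under left multiplication by the generators, hence is a left ideal, and it
-- contains `1`.
variable (k H) in
theorem mulMap_surjective : Function.Surjective (mulMap k H) := by
  have h : ∀ x y : Del k H, y ∈ LinearMap.range (mulMap k H) →
      x * y ∈ LinearMap.range (mulMap k H) := by
    intro x
    refine induction_generators (p := fun x => ∀ y, y ∈ LinearMap.range (mulMap k H) →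
      x * y ∈ LinearMap.range (mulMap k H)) (fun h y => ιHom_mul_mem_range h)
      (fun i f y => ιDLin_mul_mem_range i f) ?_ ?_ x
    · intro x x' hx hx' y hy
      rw [add_mul]
      exact add_mem (hx y hy) (hx' y hy)
    · intro x x' hx hx' y hy
      rw [mul_assoc]
      exact hx _ (hx' y hy)
  intro x
  have h1 := h x 1 ⟨1 ⊗ₜ (cop k H (Coalgebra.counit (R := k) (A := H)) ⊗ₜ
    cop k H (Coalgebra.counit (R := k) (A := H))), by
      rw [mulMap_tmul, map_one, one_mul, ιDLin_counit, ιDLin_counit, one_mul]⟩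
  rwa [mul_one] at h1

end PBW

end EllipticDouble
end Elliptic

namespace Elliptic
namespace EllipticDouble

/-! ### The Hopf structure, the coalgebra isomorphism, and pivotal and spherical elements. -/

section Hopf

set_option linter.unusedSectionVars false

open WithConv

variable {k H : Type u} [Field k] [Ring H] [HopfAlgebra k H] [FiniteDimensional k H]
  [IsAlgClosed k] [CharZero k] [Coalgebra.IsCocomm k H]

theorem eval₂_comul_groupLike (a b : GroupLike k H) (f : Module.Dual k H) :
    eval₂ (a : H) (b : H) (Coalgebra.comul (R := k) (cop k H f)) =
      f ((b * a : GroupLike k H) : H) := eval₂_comul _ _ _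

variable (k H) in
/-- The tensor square of the inclusion of `H_i^{*,cop}`. -/
def ιSq (i : Fin 2) : DualCop k H ⊗[k] DualCop k H →ₗ[k] Del k H ⊗[k] Del k H :=
  TensorProduct.map (ιCop k H i) (ιCop k H i)

theorem ιSq_tmul (i : Fin 2) (f f' : Module.Dual k H) :
    ιSq k H i (cop k H f ⊗ₜ cop k H f') = ιDLin i f ⊗ₜ ιDLin i f' := rfl

/-- Induction on `H^{*,cop} ⊗ H^{*,cop}`. -/
theorem dualCop_tensor_induction {p : DualCop k H ⊗[k] DualCop k H → Prop} (h0 : p 0)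
    (htmul : ∀ f f' : Module.Dual k H, p (cop k H f ⊗ₜ cop k H f'))
    (hadd : ∀ s t, p s → p t → p (s + t)) (t : DualCop k H ⊗[k] DualCop k H) : p t :=
  TensorProduct.induction_on t h0 (fun f f' => htmul ((cop k H).symm f) ((cop k H).symm f')) hadd

/-- The map `ιSq` turns pointwise products of functions on `G × G` into products in the tensor
square of the double. Describing `u` by its values avoids putting an algebra structure on `H^{*,cop}
⊗ H^{*,cop}`. -/
theorem exists_ιSq_mul (i : Fin 2) (s t : DualCop k H ⊗[k] DualCop k H) :
    ∃ u, ιSq k H i s * ιSq k H i t = ιSq k H i u ∧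
      ∀ a b : GroupLike k H, eval₂ (a : H) (b : H) u =
        eval₂ (a : H) (b : H) s * eval₂ (a : H) (b : H) t := by
  induction s using dualCop_tensor_induction with
  | h0 => exact ⟨0, by simp, by simp⟩
  | hadd s s' hs hs' =>
    obtain ⟨u, hu, hu'⟩ := hs
    obtain ⟨w, hw, hw'⟩ := hs'
    exact ⟨u + w, by rw [map_add, add_mul, hu, hw, map_add],
      fun a b => by rw [map_add, map_add, hu', hw', add_mul]⟩
  | htmul f f' =>
    induction t using dualCop_tensor_induction with
    | h0 => exact ⟨0, by simp, by simp⟩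
    | hadd s s' hs hs' =>
      obtain ⟨u, hu, hu'⟩ := hs
      obtain ⟨w, hw, hw'⟩ := hs'
      exact ⟨u + w, by rw [map_add, mul_add, hu, hw, map_add],
        fun a b => by rw [map_add, map_add, hu', hw', mul_add]⟩
    | htmul e e' =>
      refine ⟨cop k H (toConv f * toConv e).ofConv ⊗ₜ cop k H (toConv f' * toConv e').ofConv,
        ?_, fun a b => ?_⟩
      · simp only [ιSq_tmul, Algebra.TensorProduct.tmul_mul_tmul, ιDLin_mul]
      · simp only [eval₂_tmul, cop_apply, conv_groupLike]
        ring

/-- Moving `g ⊗ g` to the left conjugates both variables at once, by the crossing relation in each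
tensor factor. -/
theorem exists_ιSq_mul_ιHom (i : Fin 2) (g : GroupLike k H) (s : DualCop k H ⊗[k] DualCop k H) :
    ∃ u, ιSq k H i s * (ιHom (g : H) ⊗ₜ ιHom (g : H)) =
        (ιHom (g : H) ⊗ₜ ιHom (g : H)) * ιSq k H i u ∧
      ∀ a b : GroupLike k H, eval₂ (a : H) (b : H) u =
        eval₂ ((g * a * g⁻¹ : GroupLike k H) : H) ((g * b * g⁻¹ : GroupLike k H) : H) s := by
  induction s using dualCop_tensor_induction with
  | h0 => exact ⟨0, by simp, by simp⟩
  | hadd s s' hs hs' =>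
    obtain ⟨u, hu, hu'⟩ := hs
    obtain ⟨w, hw, hw'⟩ := hs'
    exact ⟨u + w, by rw [map_add, add_mul, hu, hw, map_add, mul_add],
      fun a b => by rw [map_add, map_add, hu', hw']⟩
  | htmul f f' =>
    refine ⟨cop k H (conj g f) ⊗ₜ cop k H (conj g f'), ?_, fun a b => ?_⟩
    · simp only [ιSq_tmul, Algebra.TensorProduct.tmul_mul_tmul, ιDLin_mul_ιHom]
    · simp only [eval₂_tmul, cop_apply, conj_apply]

theorem ιSq_comm (s t : DualCop k H ⊗[k] DualCop k H) :
    ιSq k H 1 t * ιSq k H 0 s = ιSq k H 0 s * ιSq k H 1 t := by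
  induction s using dualCop_tensor_induction with
  | h0 => simp
  | hadd s s' hs hs' => rw [map_add, mul_add, add_mul, hs, hs']
  | htmul f f' =>
    induction t using dualCop_tensor_induction with
    | h0 => simp
    | hadd s s' hs hs' => rw [map_add, mul_add, add_mul, hs, hs']
    | htmul e e' => simp only [ιSq_tmul, Algebra.TensorProduct.tmul_mul_tmul, ιDLin_comm]

variable (k H) in
/-- The data of the coproduct. -/
def comulData : LiftData k H (Del k H ⊗[k] Del k H) where
  φ := (Algebra.TensorProduct.map ιHom ιHom).comp (Bialgebra.comulAlgHom k H)
  ψ i := ιSq k H i ∘ₗ Coalgebra.comul ∘ₗ (cop k H).toLinearMap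
  one i := by
    have h : Coalgebra.comul (R := k) (cop k H (Coalgebra.counit (R := k) (A := H))) =
        cop k H (Coalgebra.counit (R := k) (A := H)) ⊗ₜ
          cop k H (Coalgebra.counit (R := k) (A := H)) := by
      refine eval₂_ext fun a b => ?_
      rw [eval₂_comul_groupLike, eval₂_tmul, cop_apply, cop_apply]
      simp
    change ιSq k H i (Coalgebra.comul (R := k) (cop k H (Coalgebra.counit (R := k) (A := H)))) = 1
    rw [h, ιSq_tmul, ιDLin_counit, Algebra.TensorProduct.one_def]
  mul i f f' := by
    change ιSq k H i (Coalgebra.comul (R := k) (cop k H (toConv f * toConv f').ofConv)) =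
      ιSq k H i (Coalgebra.comul (R := k) (cop k H f)) *
        ιSq k H i (Coalgebra.comul (R := k) (cop k H f'))
    obtain ⟨u, hu, hu'⟩ := exists_ιSq_mul i (Coalgebra.comul (R := k) (cop k H f))
      (Coalgebra.comul (R := k) (cop k H f'))
    rw [hu]
    refine congrArg _ (eval₂_ext fun a b => ?_)
    rw [hu', eval₂_comul_groupLike, eval₂_comul_groupLike, eval₂_comul_groupLike]
    exact conv_groupLike f f' (b * a)
  cross i f g := by
    change ιSq k H i (Coalgebra.comul (R := k) (cop k H f)) *
        Algebra.TensorProduct.map ιHom ιHom (Coalgebra.comul (R := k) (g : H)) =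
      Algebra.TensorProduct.map ιHom ιHom (Coalgebra.comul (R := k) (g : H)) *
        ιSq k H i (Coalgebra.comul (R := k) (cop k H (conj g f)))
    rw [comul_groupLike, Algebra.TensorProduct.map_tmul]
    obtain ⟨u, hu, hu'⟩ := exists_ιSq_mul_ιHom i g (Coalgebra.comul (R := k) (cop k H f))
    rw [hu]
    refine congrArg (fun w => _ * ιSq k H i w) (eval₂_ext fun a b => ?_)
    rw [hu']
    -- What remains is that conjugation by `g` respects the product `b a`.
    simp only [eval₂_comul_groupLike, conj_apply]
    congr 2
    group
  comm f₁ f₂ := ιSq_comm _ _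

variable (k H) in
/-- The data of the counit. -/
def counitData : LiftData k H k where
  φ := Bialgebra.counitAlgHom k H
  ψ _ := LinearMap.applyₗ 1
  one _ := Bialgebra.counit_one
  mul _ f f' := conv_groupLike f f' 1
  cross i f g := by
    change f 1 * Coalgebra.counit (R := k) (g : H) =
      Coalgebra.counit (R := k) (g : H) * conj g f ((1 : GroupLike k H) : H)
    rw [conj_apply, counit_groupLike]
    simp
  comm f₁ f₂ := mul_comm _ _

/-- The functional `f ∘ S`. -/
def compAntipode (f : Module.Dual k H) : Module.Dual k H := f ∘ₗ HopfAlgebra.antipode k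

theorem compAntipode_apply (f : Module.Dual k H) (g : GroupLike k H) :
    compAntipode f (g : H) = f ((g⁻¹ : GroupLike k H) : H) := rfl

/-- The homomorphism `g ↦ g⁻¹` from group-like elements to the opposite of `D^el(H)`. -/
def opInv : GroupLike k H →* (Del k H)ᵐᵒᵖ where
  toFun g := .op (ιHom ((g⁻¹ : GroupLike k H) : H))
  map_one' := by simp
  map_mul' g g' := by
    rw [mul_inv_rev, GroupLike.val_mul, map_mul, MulOpposite.op_mul]

variable (k H) in
/-- The data of the antipode. -/
def antipodeData : LiftData k H (Del k H)ᵐᵒᵖ where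
  φ := liftGroupLike opInv
  ψ i := (MulOpposite.opLinearEquiv k).toLinearMap ∘ₗ ιDLin i ∘ₗ
    (HopfAlgebra.antipode k (A := H)).dualMap
  one i := by
    have h : compAntipode (Coalgebra.counit (R := k) (A := H)) = Coalgebra.counit :=
      linearMap_ext_groupLike fun g => by
        rw [compAntipode_apply, counit_groupLike, counit_groupLike]
    change MulOpposite.op (ιDLin i (compAntipode (Coalgebra.counit (R := k) (A := H)))) = 1
    rw [h, ιDLin_counit, MulOpposite.op_one]
  mul i f f' := by
    change MulOpposite.op (ιDLin i (compAntipode (toConv f * toConv f').ofConv)) =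
      MulOpposite.op (ιDLin i (compAntipode f)) * MulOpposite.op (ιDLin i (compAntipode f'))
    rw [← MulOpposite.op_mul, ← ιDLin_mul]
    refine congrArg (fun w => MulOpposite.op (ιDLin i w)) (linearMap_ext_groupLike fun g => ?_)
    rw [compAntipode_apply, conv_groupLike, conv_groupLike, compAntipode_apply, compAntipode_apply,
      mul_comm]
  cross i f g := by
    rw [liftGroupLike_apply]
    change MulOpposite.op (ιDLin i (compAntipode f)) * MulOpposite.op _ =
      MulOpposite.op _ * MulOpposite.op (ιDLin i (compAntipode (conj g f)))
    rw [← MulOpposite.op_mul, ← MulOpposite.op_mul, ιDLin_mul_ιHom]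
    refine congrArg (fun w => MulOpposite.op (_ * ιDLin i w)) (linearMap_ext_groupLike fun x => ?_)
    rw [conj_apply, compAntipode_apply, compAntipode_apply, conj_apply]
    congr 2
    group
  comm f₁ f₂ := by
    change MulOpposite.op _ * MulOpposite.op _ = MulOpposite.op _ * MulOpposite.op _
    rw [← MulOpposite.op_mul, ← MulOpposite.op_mul]
    exact congrArg _ (ιDLin_comm _ _).symm

variable (k H) in
/-- The antipode of `D^el(H)`. -/
def antipodeLin : Del k H →ₗ[k] Del k H :=
  (MulOpposite.opLinearEquiv k).symm.toLinearMap ∘ₗ (antipodeData k H).lift.toLinearMap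

theorem antipodeLin_apply (x : Del k H) :
    antipodeLin k H x = ((antipodeData k H).lift x).unop := rfl

theorem antipodeLin_mul (x y : Del k H) :
    antipodeLin k H (x * y) = antipodeLin k H y * antipodeLin k H x := by
  rw [antipodeLin_apply, map_mul, MulOpposite.unop_mul]
  rfl

theorem antipodeLin_ιHom (h : H) : antipodeLin k H (ιHom h) = ιHom (HopfAlgebra.antipode k h) :=
  LinearMap.congr_fun (f := antipodeLin k H ∘ₗ ιHom.toLinearMap)
    (g := ιHom.toLinearMap ∘ₗ HopfAlgebra.antipode k) (linearMap_ext_groupLike fun g => by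
      change antipodeLin k H (ιHom (g : H)) = ιHom (HopfAlgebra.antipode k (g : H))
      rw [antipodeLin_apply, LiftData.lift_ιHom]
      exact congrArg MulOpposite.unop (liftGroupLike_apply opInv g)) h

theorem antipodeLin_ιDLin (i : Fin 2) (f : Module.Dual k H) :
    antipodeLin k H (ιDLin i f) = ιDLin i (compAntipode f) := by
  rw [antipodeLin_apply, LiftData.lift_ιDLin]
  rfl

variable (k H) in
/-- The coproduct of `D^el(H)`. -/
def comulHom : Del k H →ₐ[k] Del k H ⊗[k] Del k H := (comulData k H).lift

variable (k H) in
/-- The counit of `D^el(H)`. -/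
def counitHom : Del k H →ₐ[k] k := (counitData k H).lift

theorem comulHom_ιHom (g : GroupLike k H) :
    comulHom k H (ιHom (g : H)) = ιHom (g : H) ⊗ₜ ιHom (g : H) := by
  refine (LiftData.lift_ιHom _ _).trans ?_
  change Algebra.TensorProduct.map ιHom ιHom (Coalgebra.comul (R := k) (g : H)) = _
  rw [comul_groupLike, Algebra.TensorProduct.map_tmul]

theorem comulHom_ιDLin (i : Fin 2) (f : Module.Dual k H) :
    comulHom k H (ιDLin i f) = ιSq k H i (Coalgebra.comul (R := k) (cop k H f)) :=
  LiftData.lift_ιDLin _ _ _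

theorem comulHom_ιCop (i : Fin 2) (f : DualCop k H) :
    comulHom k H (ιCop k H i f) = ιSq k H i (Coalgebra.comul (R := k) f) :=
  LiftData.lift_ιDLin _ _ _

theorem counitHom_ιHom (h : H) : counitHom k H (ιHom h) = Coalgebra.counit h :=
  LiftData.lift_ιHom _ _

theorem counitHom_ιDLin (i : Fin 2) (f : Module.Dual k H) :
    counitHom k H (ιDLin i f) = f 1 := LiftData.lift_ιDLin _ _ _

theorem counitHom_ιCop (i : Fin 2) (f : DualCop k H) :
    counitHom k H (ιCop k H i f) = Coalgebra.counit (R := k) f := LiftData.lift_ιDLin _ _ _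

/-- Homomorphisms on `D^el(H)` that agree on group-like elements and the copies of `H^*` agree. -/
theorem algHom_ext_groupLike {B : Type*} [Ring B] [Algebra k B] {φ ψ : Del k H →ₐ[k] B}
    (hι : ∀ g : GroupLike k H, φ (ιHom (g : H)) = ψ (ιHom (g : H)))
    (hD : ∀ i (f : Module.Dual k H), φ (ιDLin i f) = ψ (ιDLin i f)) : φ = ψ :=
  algHom_ext (LinearMap.congr_fun (f := φ.toLinearMap ∘ₗ ιHom.toLinearMap)
    (g := ψ.toLinearMap ∘ₗ ιHom.toLinearMap) (linearMap_ext_groupLike hι)) hD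

/-- Both sides are algebra maps, so generators suffice. On group-likes it is immediate, and on the
copies of `H^*` it is the coassociativity of `H^{*,cop}` transported along the inclusions. -/
theorem comulHom_coassoc :
    (Algebra.TensorProduct.assoc k k k (Del k H) (Del k H) (Del k H)).toAlgHom.comp
      ((Algebra.TensorProduct.map (comulHom k H) (.id k (Del k H))).comp (comulHom k H)) =
    (Algebra.TensorProduct.map (.id k (Del k H)) (comulHom k H)).comp (comulHom k H) := by
  refine algHom_ext_groupLike (fun g => ?_) fun i f => ?_
  · change TensorProduct.assoc k _ _ _ (Algebra.TensorProduct.map (comulHom k H) (.id k (Del k H))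
      (comulHom k H (ιHom (g : H)))) = Algebra.TensorProduct.map (.id k (Del k H)) (comulHom k H)
        (comulHom k H (ιHom (g : H)))
    rw [comulHom_ιHom, Algebra.TensorProduct.map_tmul, Algebra.TensorProduct.map_tmul,
      comulHom_ιHom]
    rfl
  · change TensorProduct.assoc k _ _ _ (Algebra.TensorProduct.map (comulHom k H) (.id k (Del k H))
      (comulHom k H (ιDLin i f))) = Algebra.TensorProduct.map (.id k (Del k H)) (comulHom k H)
        (comulHom k H (ιDLin i f))
    rw [comulHom_ιDLin]
    let T : DualCop k H ⊗[k] (DualCop k H ⊗[k] DualCop k H) →ₗ[k]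
      Del k H ⊗[k] (Del k H ⊗[k] Del k H) := TensorProduct.map (ιCop k H i) (ιSq k H i)
    have hl : ∀ u, TensorProduct.assoc k _ _ _
        (Algebra.TensorProduct.map (comulHom k H) (.id k (Del k H)) (ιSq k H i u)) =
        T (TensorProduct.assoc k _ _ _ ((Coalgebra.comul (R := k)).rTensor _ u)) := by
      intro u
      induction u with
      | zero => simp
      | add x y hx hy => simp only [map_add, hx, hy]
      | tmul a b =>
        change TensorProduct.assoc k _ _ _ (comulHom k H (ιCop k H i a) ⊗ₜ ιCop k H i b) =
          T (TensorProduct.assoc k _ _ _ (Coalgebra.comul (R := k) a ⊗ₜ b))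
        rw [comulHom_ιCop]
        generalize (Coalgebra.comul (R := k) a) = v
        induction v with
        | zero => simp
        | add x y hx hy => simp only [map_add, TensorProduct.add_tmul, hx, hy]
        | tmul c d => rfl
    have hr : ∀ u, Algebra.TensorProduct.map (.id k (Del k H)) (comulHom k H) (ιSq k H i u) =
        T ((Coalgebra.comul (R := k)).lTensor _ u) := by
      intro u
      induction u with
      | zero => simp
      | add x y hx hy => simp only [map_add, hx, hy]
      | tmul a b =>
        change ιCop k H i a ⊗ₜ comulHom k H (ιCop k H i b) = _
        rw [comulHom_ιCop]
        rfl
    rw [hl, hr, Coalgebra.coassoc_apply]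

theorem counitHom_left :
    (Algebra.TensorProduct.map (counitHom k H) (.id k (Del k H))).comp (comulHom k H) =
      (Algebra.TensorProduct.lid k (Del k H)).symm := by
  refine algHom_ext_groupLike (fun g => ?_) fun i f => ?_
  · change Algebra.TensorProduct.map (counitHom k H) (.id k (Del k H))
      (comulHom k H (ιHom (g : H))) = 1 ⊗ₜ ιHom (g : H)
    rw [comulHom_ιHom, Algebra.TensorProduct.map_tmul, counitHom_ιHom, counit_groupLike]
    rfl
  · change Algebra.TensorProduct.map (counitHom k H) (.id k (Del k H))
      (comulHom k H (ιDLin i f)) = 1 ⊗ₜ ιDLin i f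
    have h : ∀ u, Algebra.TensorProduct.map (counitHom k H) (.id k (Del k H)) (ιSq k H i u) =
        (ιCop k H i).lTensor k ((Coalgebra.counit (R := k)).rTensor _ u) := by
      intro u
      induction u with
      | zero => simp
      | add x y hx hy => simp only [map_add, hx, hy]
      | tmul a b =>
        change counitHom k H (ιCop k H i a) ⊗ₜ ιCop k H i b = _
        rw [counitHom_ιCop]
        rfl
    rw [comulHom_ιDLin, h, Coalgebra.rTensor_counit_comul]
    rfl

theorem counitHom_right :
    (Algebra.TensorProduct.map (.id k (Del k H)) (counitHom k H)).comp (comulHom k H) =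
      (Algebra.TensorProduct.rid k k (Del k H)).symm := by
  refine algHom_ext_groupLike (fun g => ?_) fun i f => ?_
  · change Algebra.TensorProduct.map (.id k (Del k H)) (counitHom k H)
      (comulHom k H (ιHom (g : H))) = ιHom (g : H) ⊗ₜ 1
    rw [comulHom_ιHom, Algebra.TensorProduct.map_tmul, counitHom_ιHom, counit_groupLike]
    rfl
  · change Algebra.TensorProduct.map (.id k (Del k H)) (counitHom k H)
      (comulHom k H (ιDLin i f)) = ιDLin i f ⊗ₜ 1
    have h : ∀ u, Algebra.TensorProduct.map (.id k (Del k H)) (counitHom k H) (ιSq k H i u) =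
        (ιCop k H i).rTensor k ((Coalgebra.counit (R := k)).lTensor _ u) := by
      intro u
      induction u with
      | zero => simp
      | add x y hx hy => simp only [map_add, hx, hy]
      | tmul a b =>
        change ιCop k H i a ⊗ₜ counitHom k H (ιCop k H i b) = _
        rw [counitHom_ιCop]
        rfl
    rw [comulHom_ιDLin, h, Coalgebra.lTensor_counit_comul]
    rfl

variable (k H) in
/-- The map `x ⊗ y ↦ S(x) y`. -/
def antipodeMul : Del k H ⊗[k] Del k H →ₗ[k] Del k H :=
  LinearMap.mul' k (Del k H) ∘ₗ (antipodeLin k H).rTensor (Del k H)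

variable (k H) in
/-- The map `x ⊗ y ↦ x S(y)`. -/
def mulAntipode : Del k H ⊗[k] Del k H →ₗ[k] Del k H :=
  LinearMap.mul' k (Del k H) ∘ₗ (antipodeLin k H).lTensor (Del k H)

theorem antipodeMul_tmul (x y : Del k H) :
    antipodeMul k H (x ⊗ₜ y) = antipodeLin k H x * y := rfl

theorem mulAntipode_tmul (x y : Del k H) :
    mulAntipode k H (x ⊗ₜ y) = x * antipodeLin k H y := rfl

/-- In the product `S(y₁) S(x₁) x₂ y₂` the inner factors already collapse to the scalar `c`. This
propagates the antipode axiom from generators to products. -/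
theorem antipodeMul_mul {s : Del k H ⊗[k] Del k H} {c : k}
    (hs : antipodeMul k H s = algebraMap k _ c) (t : Del k H ⊗[k] Del k H) :
    antipodeMul k H (s * t) = c • antipodeMul k H t := by
  induction t with
  | zero => simp
  | add x y hx hy => rw [mul_add, map_add, hx, hy, map_add, smul_add]
  | tmul x y =>
    -- This identity needs only anti-multiplicativity and is additive in `s`, so the scalar
    -- hypothesis is dropped before `s` is decomposed.
    have h : antipodeMul k H (s * (x ⊗ₜ y)) = antipodeLin k H x * antipodeMul k H s * y := by
      clear hs
      induction s with
      | zero => simp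
      | add a b ha hb => rw [add_mul, map_add, ha, hb, map_add, mul_add, add_mul]
      | tmul a b =>
        rw [Algebra.TensorProduct.tmul_mul_tmul, antipodeMul_tmul, antipodeMul_tmul,
          antipodeLin_mul]
        simp only [mul_assoc]
    rw [h, hs, antipodeMul_tmul, Algebra.smul_def, ← Algebra.commutes, mul_assoc]

theorem mulAntipode_mul {t : Del k H ⊗[k] Del k H} {c : k}
    (ht : mulAntipode k H t = algebraMap k _ c) (s : Del k H ⊗[k] Del k H) :
    mulAntipode k H (s * t) = c • mulAntipode k H s := by
  induction s with
  | zero => simp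
  | add x y hx hy => rw [add_mul, map_add, hx, hy, map_add, smul_add]
  | tmul x y =>
    have h : mulAntipode k H ((x ⊗ₜ y) * t) = x * mulAntipode k H t * antipodeLin k H y := by
      clear ht
      induction t with
      | zero => simp
      | add a b ha hb => rw [mul_add, map_add, ha, hb, map_add, mul_add, add_mul]
      | tmul a b =>
        rw [Algebra.TensorProduct.tmul_mul_tmul, mulAntipode_tmul, mulAntipode_tmul,
          antipodeLin_mul]
        simp only [mul_assoc]
    rw [h, ht, mulAntipode_tmul, Algebra.smul_def, ← Algebra.commutes, mul_assoc]

/-- Applied to the coproduct of `f`, whose values are `f(ba)`, this restriction to the pairs `(a⁻¹,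
a)` is the constant function `f(1)`, as the antipode axiom requires. -/
theorem exists_antipodeMul_ιSq (i : Fin 2) (s : DualCop k H ⊗[k] DualCop k H) :
    ∃ f : Module.Dual k H, antipodeMul k H (ιSq k H i s) = ιDLin i f ∧
      ∀ a : GroupLike k H, f (a : H) = eval₂ ((a⁻¹ : GroupLike k H) : H) (a : H) s := by
  induction s using dualCop_tensor_induction with
  | h0 => exact ⟨0, by simp, by simp⟩
  | hadd s s' hs hs' =>
    obtain ⟨u, hu, hu'⟩ := hs
    obtain ⟨w, hw, hw'⟩ := hs'
    exact ⟨u + w, by rw [map_add, map_add, hu, hw, map_add],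
      fun a => by rw [map_add, LinearMap.add_apply, hu', hw']⟩
  | htmul f f' =>
    refine ⟨(toConv (compAntipode f) * toConv f').ofConv, ?_, fun a => ?_⟩
    · rw [ιSq_tmul, antipodeMul_tmul, antipodeLin_ιDLin, ιDLin_mul]
    · rw [conv_groupLike, compAntipode_apply, eval₂_tmul, cop_apply, cop_apply]

theorem exists_mulAntipode_ιSq (i : Fin 2) (s : DualCop k H ⊗[k] DualCop k H) :
    ∃ f : Module.Dual k H, mulAntipode k H (ιSq k H i s) = ιDLin i f ∧
      ∀ a : GroupLike k H, f (a : H) = eval₂ (a : H) ((a⁻¹ : GroupLike k H) : H) s := by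
  induction s using dualCop_tensor_induction with
  | h0 => exact ⟨0, by simp, by simp⟩
  | hadd s s' hs hs' =>
    obtain ⟨u, hu, hu'⟩ := hs
    obtain ⟨w, hw, hw'⟩ := hs'
    exact ⟨u + w, by rw [map_add, map_add, hu, hw, map_add],
      fun a => by rw [map_add, LinearMap.add_apply, hu', hw']⟩
  | htmul f f' =>
    refine ⟨(toConv f * toConv (compAntipode f')).ofConv, ?_, fun a => ?_⟩
    · rw [ιSq_tmul, mulAntipode_tmul, antipodeLin_ιDLin, ιDLin_mul]
    · rw [conv_groupLike, compAntipode_apply, eval₂_tmul, cop_apply, cop_apply]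

theorem ιDLin_eq_algebraMap (i : Fin 2) {f : Module.Dual k H} {c : k}
    (h : ∀ a : GroupLike k H, f (a : H) = c) : ιDLin i f = algebraMap k _ c := by
  have : f = c • Coalgebra.counit (R := k) (A := H) :=
    linearMap_ext_groupLike fun a => by
      rw [h, LinearMap.smul_apply, counit_groupLike, smul_eq_mul, mul_one]
  rw [this, map_smul, ιDLin_counit, Algebra.algebraMap_eq_smul_one]

theorem antipode_left : LinearMap.mul' k (Del k H) ∘ₗ (antipodeLin k H).rTensor (Del k H) ∘ₗ
    (comulHom k H).toLinearMap = Algebra.linearMap k _ ∘ₗ (counitHom k H).toLinearMap := by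
  refine LinearMap.ext fun x => ?_
  change antipodeMul k H (comulHom k H x) = algebraMap k _ (counitHom k H x)
  refine induction_generators (p := fun x => antipodeMul k H (comulHom k H x) =
    algebraMap k _ (counitHom k H x)) ?_ ?_ ?_ ?_ x
  · refine LinearMap.congr_fun
      (f := antipodeMul k H ∘ₗ (comulHom k H).toLinearMap ∘ₗ ιHom.toLinearMap)
      (g := Algebra.linearMap k _ ∘ₗ (counitHom k H).toLinearMap ∘ₗ ιHom.toLinearMap)
      (linearMap_ext_groupLike fun g => ?_)
    change antipodeMul k H (comulHom k H (ιHom (g : H))) =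
      algebraMap k _ (counitHom k H (ιHom (g : H)))
    rw [comulHom_ιHom, antipodeMul_tmul, antipodeLin_ιHom, ← map_mul, antipode_groupLike,
      groupLike_inv_mul, counitHom_ιHom, counit_groupLike, map_one, map_one]
  · intro i f
    obtain ⟨w, hw, hw'⟩ := exists_antipodeMul_ιSq i (Coalgebra.comul (R := k) (cop k H f))
    rw [comulHom_ιDLin, hw, counitHom_ιDLin]
    refine ιDLin_eq_algebraMap i fun a => ?_
    rw [hw', eval₂_comul_groupLike, mul_inv_cancel, GroupLike.val_one]
  · intro x y hx hy
    rw [map_add, map_add, hx, hy, map_add, map_add]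
  · intro x y hx hy
    rw [map_mul, antipodeMul_mul hx, hy, map_mul, map_mul, Algebra.smul_def]

theorem antipode_right : LinearMap.mul' k (Del k H) ∘ₗ (antipodeLin k H).lTensor (Del k H) ∘ₗ
    (comulHom k H).toLinearMap = Algebra.linearMap k _ ∘ₗ (counitHom k H).toLinearMap := by
  refine LinearMap.ext fun x => ?_
  change mulAntipode k H (comulHom k H x) = algebraMap k _ (counitHom k H x)
  refine induction_generators (p := fun x => mulAntipode k H (comulHom k H x) =
    algebraMap k _ (counitHom k H x)) ?_ ?_ ?_ ?_ x
  · refine LinearMap.congr_fun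
      (f := mulAntipode k H ∘ₗ (comulHom k H).toLinearMap ∘ₗ ιHom.toLinearMap)
      (g := Algebra.linearMap k _ ∘ₗ (counitHom k H).toLinearMap ∘ₗ ιHom.toLinearMap)
      (linearMap_ext_groupLike fun g => ?_)
    change mulAntipode k H (comulHom k H (ιHom (g : H))) =
      algebraMap k _ (counitHom k H (ιHom (g : H)))
    rw [comulHom_ιHom, mulAntipode_tmul, antipodeLin_ιHom, ← map_mul, antipode_groupLike,
      groupLike_mul_inv, counitHom_ιHom, counit_groupLike, map_one, map_one]
  · intro i f
    obtain ⟨w, hw, hw'⟩ := exists_mulAntipode_ιSq i (Coalgebra.comul (R := k) (cop k H f))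
    rw [comulHom_ιDLin, hw, counitHom_ιDLin]
    refine ιDLin_eq_algebraMap i fun a => ?_
    rw [hw', eval₂_comul_groupLike, inv_mul_cancel, GroupLike.val_one]
  · intro x y hx hy
    rw [map_add, map_add, hx, hy, map_add, map_add]
  · intro x y hx hy
    rw [map_mul, mulAntipode_mul hy, hx, map_mul, map_mul, Algebra.smul_def, Algebra.commutes]

variable (k H) in
/-- The Hopf algebra structure of `D^el(H)`. -/
def hopfStructure : HopfStructure k (Del k H) where
  comul := comulHom k H
  counit := counitHom k H
  coassoc := comulHom_coassoc
  counit_left := counitHom_left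
  counit_right := counitHom_right
  antipode := antipodeLin k H
  antipode_left := antipode_left
  antipode_right := antipode_right

@[reducible]
instance hopfAlgebra : HopfAlgebra k (Del k H) := (hopfStructure k H).toHopfAlgebra

theorem comul_eq (x : Del k H) : Coalgebra.comul (R := k) x = comulHom k H x := rfl

theorem counit_eq (x : Del k H) : Coalgebra.counit (R := k) x = counitHom k H x := rfl

theorem antipode_eq (x : Del k H) : HopfAlgebra.antipode k x = antipodeLin k H x := rfl

/-- The coproduct of the double is multiplicative, so on `g f¹ f²` it is the product of the three
separate coproducts; regrouping the tensor factors gives the componentwise coproduct. -/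
theorem map_comul_mulMap :
    TensorProduct.map (mulMap k H) (mulMap k H) ∘ₗ Coalgebra.comul =
      Coalgebra.comul ∘ₗ mulMap k H := by
  refine TensorProduct.ext (linearMap_ext_groupLike fun g => TensorProduct.ext' fun f₁ f₂ => ?_)
  have hE : ∀ (h : H) (a b : DualCop k H),
      mulMap k H (h ⊗ₜ (a ⊗ₜ b)) = ιHom h * (ιCop k H 0 a * ιCop k H 1 b) := fun _ _ _ => rfl
  have key : ∀ s t : DualCop k H ⊗[k] DualCop k H,
      TensorProduct.map (mulMap k H) (mulMap k H)
        (TensorProduct.AlgebraTensorModule.tensorTensorTensorComm k k k k H H _ _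
          (((g : H) ⊗ₜ (g : H)) ⊗ₜ
            TensorProduct.AlgebraTensorModule.tensorTensorTensorComm k k k k _ _ _ _ (s ⊗ₜ t))) =
      (ιHom (g : H) ⊗ₜ ιHom (g : H)) * (ιSq k H 0 s * ιSq k H 1 t) := by
    intro s t
    induction s with
    | zero => simp
    | add x y hx hy => simp only [map_add, TensorProduct.add_tmul, TensorProduct.tmul_add, add_mul,
        mul_add, hx, hy]
    | tmul a b =>
      induction t with
      | zero => simp
      | add x y hx hy => simp only [map_add, TensorProduct.tmul_add, mul_add, hx, hy]
      | tmul c d =>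
        simp only [TensorProduct.AlgebraTensorModule.tensorTensorTensorComm_tmul,
          TensorProduct.map_tmul, hE, ιSq, Algebra.TensorProduct.tmul_mul_tmul]
  change TensorProduct.map (mulMap k H) (mulMap k H)
    (Coalgebra.comul (R := k) ((g : H) ⊗ₜ[k] (f₁ ⊗ₜ[k] f₂))) =
      comulHom k H (mulMap k H ((g : H) ⊗ₜ (f₁ ⊗ₜ f₂)))
  rw [TensorProduct.comul_tmul, TensorProduct.comul_tmul, comul_groupLike, key, hE, map_mul,
    map_mul, comulHom_ιHom, comulHom_ιCop, comulHom_ιCop]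

theorem counit_comp_mulMap :
    Coalgebra.counit ∘ₗ mulMap k H = Coalgebra.counit (R := k) := by
  refine TensorProduct.ext (linearMap_ext_groupLike fun g => TensorProduct.ext' fun f₁ f₂ => ?_)
  change counitHom k H (ιHom (g : H) * (ιCop k H 0 f₁ * ιCop k H 1 f₂)) =
    Coalgebra.counit (R := k) ((g : H) ⊗ₜ[k] (f₁ ⊗ₜ[k] f₂))
  rw [map_mul, map_mul, counitHom_ιHom, counitHom_ιCop, counitHom_ιCop, TensorProduct.counit_tmul,
    TensorProduct.counit_tmul, counit_groupLike]
  simp [mul_comm]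

variable (k H) in
/-- The multiplication map `h ⊗ f¹ ⊗ f² ↦ h f¹ f²` as an isomorphism of coalgebras. -/
def mulCoalgEquiv : H ⊗[k] (DualCop k H ⊗[k] DualCop k H) ≃ₗc[k] Del k H :=
  CoalgEquiv.ofBijective (f := (⟨mulMap k H, counit_comp_mulMap, map_comul_mulMap⟩ :
    H ⊗[k] (DualCop k H ⊗[k] DualCop k H) →ₗc[k] Del k H))
    ⟨mulMap_injective k H, mulMap_surjective k H⟩

theorem compAntipode_compAntipode (f : Module.Dual k H) : compAntipode (compAntipode f) = f :=
  linearMap_ext_groupLike fun g => by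
    rw [compAntipode_apply, compAntipode_apply, inv_inv]

theorem antipodeLin_antipodeLin (x : Del k H) : antipodeLin k H (antipodeLin k H x) = x := by
  refine induction_generators (p := fun x => antipodeLin k H (antipodeLin k H x) = x) ?_ ?_ ?_ ?_ x
  · intro h
    rw [antipodeLin_ιHom, antipodeLin_ιHom, antipode_antipode]
  · intro i f
    rw [antipodeLin_ιDLin, antipodeLin_ιDLin, compAntipode_compAntipode]
  · intro x y hx hy
    rw [map_add, map_add, hx, hy]
  · intro x y hx hy
    rw [antipodeLin_mul, antipodeLin_mul, hx, hy]

/-- Since `S² = 1` in `H` and in the double, a pivotal element is the same as a central group-like.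
Centrality in `H` makes conjugation by `v` trivial on functionals, so `v` also commutes with both
copies of `H^*`. -/
theorem isPivotal_ιHom {v : H} (hv : IsPivotal k v) : IsPivotal k (ιHom v : Del k H) := by
  obtain ⟨g, rfl⟩ : ∃ g : GroupLike k H, (g : H) = v := ⟨⟨v, hv.groupLike⟩, rfl⟩
  have hc : ∀ x : H, x * g = g * x := fun x => by
    have := hv.antipode_sq x
    rwa [antipode_antipode] at this
  refine ⟨⟨?_, ?_⟩, fun x => ?_⟩
  · rw [counit_eq, counitHom_ιHom, counit_groupLike]
  · rw [comul_eq, comulHom_ιHom]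
  rw [antipode_eq, antipode_eq, antipodeLin_antipodeLin]
  refine induction_generators (p := fun x => x * ιHom (g : H) = ιHom (g : H) * x) ?_ ?_ ?_ ?_ x
  · intro h
    rw [← map_mul, hc, map_mul]
  · intro i f
    rw [ιDLin_mul_ιHom]
    refine congrArg (fun w => _ * ιDLin i w) (linearMap_ext_groupLike fun x => ?_)
    rw [conj_apply]
    congr 1
    rw [GroupLike.val_mul, GroupLike.val_mul, ← hc, mul_assoc, groupLike_mul_inv, mul_one]
  · intro x y hx hy
    rw [add_mul, mul_add, hx, hy]
  · intro x y hx hy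
    rw [mul_assoc, hy, ← mul_assoc, hx, mul_assoc]

/-- The restriction of a module over `D^el(H)` to `H`. -/
def restrict (X : FDMod k (Del k H)) : FDMod k H where
  V := X.V
  finite := X.finite
  ρ := X.ρ.comp ιHom

/-- The traces involve only the action of `H`, and an endomorphism over the double is also one over
`H`. -/
theorem isSpherical_ιHom {v : H} (hv : IsSpherical k v) : IsSpherical k (ιHom v : Del k H) := by
  refine ⟨isPivotal_ιHom hv.toIsPivotal, fun X θ => ?_⟩
  have h := hv.trace_eq (restrict X) ⟨θ.hom, fun a x => θ.equivariant (ιHom a) x⟩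
  rw [antipode_eq, antipodeLin_ιHom]
  exact h

end Hopf

end EllipticDouble
end Elliptic

namespace Elliptic

/-! ### The action of `H^*` attached to a half-braiding. -/

section HalfBraidingAction

set_option linter.unusedSectionVars false

open WithConv

theorem lam_naturality {C : Type*} [Category* C] [MonoidalCategory C] {X : C} (b : HalfBraiding X)
    {A B : C} (f : A ⟶ B) : f ▷ X ≫ (lam b B).hom = (lam b A).hom ≫ X ◁ f := by
  simp only [lam, Iso.symm_hom]
  rw [Iso.eq_inv_comp, ← Category.assoc, Iso.comp_inv_eq, b.naturality]

theorem lam_tensor {C : Type*} [Category* C] [MonoidalCategory C] {X : C} (b : HalfBraiding X)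
    (A B : C) : (lam b (A ⊗ B)).hom = (α_ A B X).hom ≫ A ◁ (lam b B).hom ≫ (α_ A X B).inv ≫
      (lam b A).hom ▷ B ≫ (α_ X A B).hom := by
  have h : b.β (A ⊗ B) = (α_ X A B).symm ≪≫ whiskerRightIso (b.β A) B ≪≫ α_ A X B ≪≫
      whiskerLeftIso A (b.β B) ≪≫ (α_ A B X).symm := by
    ext
    simp [b.monoidal]
  simp [lam, h]

variable {k H : Type u} [Field k] [Ring H] [HopfAlgebra k H] [FiniteDimensional k H]

/-- The linear map underlying `λ_A`. -/
def lamLin {X : FDMod k H} (b : HalfBraiding X) (A : FDMod k H) :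
    A.V ⊗[k] X.V →ₗ[k] X.V ⊗[k] A.V := (lam b A).hom.hom.hom

theorem lamLin_naturality {X : FDMod k H} (b : HalfBraiding X) {A B : FDMod k H} (f : A ⟶ B)
    (a : A.V) (x : X.V) :
    lamLin b B (f.hom a ⊗ₜ x) = f.hom.hom.lTensor X.V (lamLin b A (a ⊗ₜ x)) :=
  congrArg (fun m : A ⊗ X ⟶ X ⊗ B => m.hom (a ⊗ₜ[k] x : A.V ⊗[k] X.V)) (lam_naturality b f)

theorem lamLin_tensor {X : FDMod k H} (b : HalfBraiding X) (A B : FDMod k H)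
    (y : A.V) (z : B.V) (x : X.V) :
    lamLin b (A ⊗ B) ((y ⊗ₜ[k] z : A.V ⊗[k] B.V) ⊗ₜ x) =
      TensorProduct.assoc k X.V A.V B.V ((lamLin b A).rTensor B.V
        ((TensorProduct.assoc k A.V X.V B.V).symm (y ⊗ₜ lamLin b B (z ⊗ₜ x)))) :=
  congrArg (fun m : (A ⊗ B) ⊗ X ⟶ X ⊗ A ⊗ B =>
    m.hom ((y ⊗ₜ[k] z) ⊗ₜ[k] x : (A.V ⊗[k] B.V) ⊗[k] X.V)) (lam_tensor b A B)

theorem tensor_ρ_groupLike (X Y : FDMod k H) (g : GroupLike k H) (x : X.V) (y : Y.V) :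
    (X ⊗ Y).ρ (g : H) (x ⊗ₜ[k] y : X.V ⊗[k] Y.V) = X.ρ (g : H) x ⊗ₜ[k] Y.ρ (g : H) y := by
  let r : Coalgebra.Repr k (g : H) Unit :=
    { index := {()}, left := fun _ => g, right := fun _ => g
      eq := by rw [Finset.sum_singleton, comul_groupLike] }
  exact (FDMod.tensor_ρ X Y r x y).trans (Finset.sum_singleton _ _)

theorem lamLin_ρ {X : FDMod k H} (b : HalfBraiding X) (A : FDMod k H) (g : GroupLike k H)
    (t : A.V ⊗[k] X.V) : lamLin b A (TensorProduct.map (A.ρ (g : H)) (X.ρ (g : H)) t) =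
      TensorProduct.map (X.ρ (g : H)) (A.ρ (g : H)) (lamLin b A t) := by
  have h : ∀ (X Y : FDMod k H) (t : X.V ⊗[k] Y.V),
      TensorProduct.map (X.ρ (g : H)) (Y.ρ (g : H)) t = (X ⊗ Y).ρ (g : H) t := by
    intro X Y t
    induction t with
    | zero => exact (map_zero _).trans (map_zero ((X ⊗ Y).ρ (g : H))).symm
    | tmul x y => exact (tensor_ρ_groupLike X Y g x y).symm
    | add x y hx hy => exact (map_add _ _ _).trans ((congrArg₂ _ hx hy).trans (map_add _ _ _).symm)
  rw [h, h]
  exact (lam b A).hom.equivariant (g : H) t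

/-- The map `H → A`, `h ↦ h a`. -/
def evalHom (A : FDMod k H) (a : A.V) : FDMod.regular k H ⟶ A where
  hom := ModuleCat.ofHom ((LinearMap.applyₗ a) ∘ₗ A.ρ.toLinearMap : H →ₗ[k] A.V)
  equivariant h x := congrArg (fun m : Module.End k A.V => m a) (map_mul A.ρ h x)

/-- The linear map underlying `λ_H`. -/
def lamReg {X : FDMod k H} (b : HalfBraiding X) : H ⊗[k] X.V →ₗ[k] X.V ⊗[k] H :=
  lamLin b (FDMod.regular k H)

/-- The coaction `x ↦ λ_H (1 ⊗ x)`. -/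
def coact {X : FDMod k H} (b : HalfBraiding X) : X.V →ₗ[k] X.V ⊗[k] H :=
  lamReg b ∘ₗ TensorProduct.mk k H X.V 1

/-- The action of `H^*` given by a half-braiding. -/
def act {X : FDMod k H} (b : HalfBraiding X) : Module.Dual k H →ₗ[k] Module.End k X.V :=
  LinearMap.lcomp k X.V (coact b) ∘ₗ (LinearMap.llcomp k (X.V ⊗[k] H) (X.V ⊗[k] k) X.V
    (TensorProduct.rid k X.V).toLinearMap) ∘ₗ LinearMap.lTensorHom X.V

theorem act_apply {X : FDMod k H} (b : HalfBraiding X) (f : Module.Dual k H) (x : X.V) :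
    act b f x = TensorProduct.rid k X.V (f.lTensor X.V (coact b x)) := rfl

variable [IsAlgClosed k] [CharZero k] [Coalgebra.IsCocomm k H]

/-- Naturality along the module map `H → A`, `h ↦ h a`, determines `λ_A` from the coaction `x ↦
λ_H(1 ⊗ x)`, which is expanded in the basis of group-likes. -/
theorem lamLin_tmul {X : FDMod k H} (b : HalfBraiding X) (A : FDMod k H) (a : A.V) (x : X.V) :
    lamLin b A (a ⊗ₜ x) = ∑ g : GroupLike k H, act b (delta g) x ⊗ₜ A.ρ (g : H) a := by
  have h := lamLin_naturality b (evalHom A a) (1 : H) x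
  have h1 : (evalHom A a).hom (1 : H) = a :=
    congrArg (fun m : Module.End k A.V => m a) (map_one A.ρ)
  rw [h1] at h
  rw [h]
  change ((LinearMap.applyₗ a) ∘ₗ A.ρ.toLinearMap : H →ₗ[k] A.V).lTensor X.V (coact b x) = _
  rw [← tensor_eq_sum_right (coact b x), map_sum]
  rfl

theorem act_eq_sum {X : FDMod k H} (b : HalfBraiding X) (f : Module.Dual k H) :
    act b f = ∑ g : GroupLike k H, f (g : H) • act b (delta g) := by
  conv_lhs => rw [← dual_eq_sum_delta f]
  simp only [map_sum, map_smul]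

theorem coact_eq_sum {X : FDMod k H} (b : HalfBraiding X) (x : X.V) :
    coact b x = ∑ g : GroupLike k H, act b (delta g) x ⊗ₜ (g : H) :=
  (tensor_eq_sum_right (coact b x)).symm

theorem assoc_lamReg {X : FDMod k H} (b b' : HalfBraiding X) (x : X.V) :
    TensorProduct.assoc k X.V H H ((lamReg b).rTensor H
      ((TensorProduct.assoc k H X.V H).symm ((1 : H) ⊗ₜ coact b' x))) =
    ∑ h : GroupLike k H, ∑ g : GroupLike k H,
      act b (delta g) (act b' (delta h) x) ⊗ₜ[k] ((g : H) ⊗ₜ[k] (h : H)) := by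
  rw [coact_eq_sum, TensorProduct.tmul_sum, map_sum, map_sum, map_sum]
  refine Finset.sum_congr rfl fun h _ => ?_
  change TensorProduct.assoc k X.V H H (coact b (act b' (delta h) x) ⊗ₜ (h : H)) = _
  rw [coact_eq_sum, TensorProduct.sum_tmul, map_sum]
  rfl

/-- The tensor axiom for `A = B = H`, evaluated at `1 ⊗ 1 ⊗ x`, equates `∑ p_g x ⊗ g ⊗ g` with `∑
p_g p_h x ⊗ g ⊗ h`, where `p_g` is the action of `delta g`. Pairing with `f ⊗ f'` gives the claim.
-/
theorem act_conv {X : FDMod k H} (b : HalfBraiding X) (f f' : Module.Dual k H) :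
    act b (toConv f * toConv f').ofConv = act b f * act b f' := by
  refine LinearMap.ext fun x => ?_
  have h := lamLin_tensor b (FDMod.regular k H) (FDMod.regular k H) (1 : H) (1 : H) x
  have hl : lamLin b (FDMod.regular k H ⊗ FDMod.regular k H)
      (((1 : H) ⊗ₜ[k] (1 : H) : H ⊗[k] H) ⊗ₜ x) =
        (∑ g : GroupLike k H, act b (delta g) x ⊗ₜ ((g : H) ⊗ₜ (g : H)) :
          X.V ⊗[k] (H ⊗[k] H)) := by
    refine (lamLin_tmul b (FDMod.regular k H ⊗ FDMod.regular k H) _ x).trans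
      (Finset.sum_congr rfl fun g _ => congrArg (fun w : H ⊗[k] H =>
        (act b (delta g) x ⊗ₜ w : X.V ⊗[k] (H ⊗[k] H))) ?_)
    refine (tensor_ρ_groupLike (FDMod.regular k H) (FDMod.regular k H) g (1 : H) (1 : H)).trans ?_
    change ((g : H) * 1) ⊗ₜ[k] ((g : H) * 1) = _
    rw [mul_one]
  have h' := hl.symm.trans (h.trans (assoc_lamReg b b x))
  have h'' := congrArg (fun t => TensorProduct.rid k X.V
    ((LinearMap.mul' k k ∘ₗ TensorProduct.map f f').lTensor X.V t)) h'
  simp only [map_sum, LinearMap.lTensor_tmul, LinearMap.comp_apply, TensorProduct.map_tmul,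
    LinearMap.mul'_apply, TensorProduct.rid_tmul] at h''
  rw [act_eq_sum, Module.End.mul_apply, act_eq_sum b f, act_eq_sum b f']
  simp only [LinearMap.sum_apply, LinearMap.smul_apply, map_sum, map_smul]
  refine Eq.trans (Finset.sum_congr rfl fun g _ => by rw [conv_groupLike]) (h''.trans ?_)
  refine Finset.sum_congr rfl fun g _ => ?_
  rw [Finset.smul_sum]
  refine Finset.sum_congr rfl fun h _ => ?_
  rw [smul_smul, mul_comm]

/-- Up to unit isomorphisms the action of `ε` is `λ` at the unit object, hence injective. It is
idempotent because `ε * ε = ε`, and an injective idempotent is the identity. -/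
theorem act_counit {X : FDMod k H} (b : HalfBraiding X) :
    act b (Coalgebra.counit (R := k) (A := H)) = 1 := by
  have hP : ∀ x, lamLin b (𝟙_ (FDMod k H)) ((1 : k) ⊗ₜ x) =
      (act b (Coalgebra.counit (R := k) (A := H)) x ⊗ₜ (1 : k) : X.V ⊗[k] k) := by
    intro x
    rw [act_eq_sum]
    refine (lamLin_tmul b _ _ x).trans ?_
    rw [LinearMap.sum_apply, TensorProduct.sum_tmul]
    refine Finset.sum_congr rfl fun g _ => ?_
    rw [counit_groupLike, one_smul]
    refine congrArg (fun c : k => (act b (delta g) x ⊗ₜ c : X.V ⊗[k] k)) ?_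
    change Coalgebra.counit (R := k) (g : H) * 1 = 1
    rw [counit_groupLike, mul_one]
  have hinj : Function.Injective (lamLin b (𝟙_ (FDMod k H))) :=
    Function.LeftInverse.injective (g := (lam b (𝟙_ (FDMod k H))).inv.hom) fun t =>
      congrArg (fun m : 𝟙_ (FDMod k H) ⊗ X ⟶ 𝟙_ (FDMod k H) ⊗ X => m.hom t)
        (lam b (𝟙_ (FDMod k H))).hom_inv_id
  have hPinj : ∀ x y, act b (Coalgebra.counit (R := k) (A := H)) x =
      act b (Coalgebra.counit (R := k) (A := H)) y → x = y := by
    intro x y hxy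
    have h := (hP x).trans ((congrArg (fun w : X.V => (w ⊗ₜ (1 : k) : X.V ⊗[k] k)) hxy).trans
      (hP y).symm)
    exact (TensorProduct.lid k X.V).symm.injective (hinj h)
  refine LinearMap.ext fun x => hPinj _ _ ?_
  have hε : (toConv (Coalgebra.counit (R := k) (A := H)) *
      toConv (Coalgebra.counit (R := k) (A := H))).ofConv = Coalgebra.counit :=
    linearMap_ext_groupLike fun g => by rw [conv_groupLike, counit_groupLike, mul_one]
  have h := act_conv b (Coalgebra.counit (R := k) (A := H)) Coalgebra.counit
  rw [hε] at h
  rw [← Module.End.mul_apply, ← h]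
  rfl

/-- This expresses that `λ_H` commutes with the action of `g`, evaluated at `1 ⊗ x`. -/
theorem act_cross {X : FDMod k H} (b : HalfBraiding X) (f : Module.Dual k H) (g : GroupLike k H) :
    act b f * X.ρ (g : H) = X.ρ (g : H) * act b (EllipticDouble.conj g f) := by
  refine LinearMap.ext fun x => ?_
  have h := lamLin_ρ b (FDMod.regular k H) g ((1 : H) ⊗ₜ x)
  have hl : lamLin b (FDMod.regular k H) (TensorProduct.map ((FDMod.regular k H).ρ (g : H))
      (X.ρ (g : H)) ((1 : H) ⊗ₜ x)) =
        (∑ h : GroupLike k H, act b (delta h) (X.ρ (g : H) x) ⊗ₜ ((h : H) * ((g : H) * 1)) :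
          X.V ⊗[k] H) :=
    lamLin_tmul b (FDMod.regular k H) _ _
  have hr : (TensorProduct.map (X.ρ (g : H)) ((FDMod.regular k H).ρ (g : H)) (coact b x) :
        X.V ⊗[k] H) =
      (∑ h : GroupLike k H, X.ρ (g : H) (act b (delta h) x) ⊗ₜ ((g : H) * (h : H)) :
          X.V ⊗[k] H) := by
    rw [coact_eq_sum]
    exact map_sum _ _ _
  have h' := hl.symm.trans (h.trans hr)
  -- The translated functional `y ↦ f(y g⁻¹)` cancels the factor `g` that acting on `1 ∈ H` leaves
  -- on the right.
  have h'' := congrArg (fun t => TensorProduct.rid k X.V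
    ((EllipticDouble.translate f 1 ((g⁻¹ : GroupLike k H) : H)).lTensor X.V t)) h'
  simp only [map_sum, LinearMap.lTensor_tmul, EllipticDouble.translate_apply, mul_one, one_mul,
    TensorProduct.rid_tmul, mul_assoc, groupLike_mul_inv] at h''
  rw [act_eq_sum, act_eq_sum b (EllipticDouble.conj g f)]
  simp only [Module.End.mul_apply, LinearMap.sum_apply, LinearMap.smul_apply, map_sum, map_smul,
    EllipticDouble.conj_apply, GroupLike.val_mul, mul_assoc]
  exact h''

/-- COMM for `A = B = H` at `1 ⊗ 1 ⊗ x` compares `p¹_g p²_h x` with `p²_h p¹_g x`, both as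
coefficients of `h ⊗ g`. -/
theorem act_comm {X : FDMod k H} {b₁ b₂ : HalfBraiding X} (hb : Comm b₁ b₂)
    (f₁ f₂ : Module.Dual k H) : act b₂ f₂ * act b₁ f₁ = act b₁ f₁ * act b₂ f₂ := by
  refine LinearMap.ext fun x => ?_
  let R := FDMod.regular k H
  have h := congrArg (fun m : R ⊗ R ⊗ X ⟶ X ⊗ R ⊗ R =>
    m.hom ((1 : H) ⊗ₜ[k] ((1 : H) ⊗ₜ[k] x) : H ⊗[k] (H ⊗[k] X.V))) (hb R R)
  have h' : (TensorProduct.comm k H H).toLinearMap.lTensor X.V (TensorProduct.assoc k X.V H H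
      ((lamReg b₁).rTensor H ((TensorProduct.assoc k H X.V H).symm ((1 : H) ⊗ₜ coact b₂ x)))) =
    TensorProduct.assoc k X.V H H
      ((lamReg b₂).rTensor H ((TensorProduct.assoc k H X.V H).symm ((1 : H) ⊗ₜ coact b₁ x))) := h
  rw [assoc_lamReg, assoc_lamReg] at h'
  have h'' := congrArg (fun t => TensorProduct.rid k X.V
    ((LinearMap.mul' k k ∘ₗ TensorProduct.map f₂ f₁).lTensor X.V t)) h'
  simp only [map_sum, LinearMap.lTensor_tmul, LinearMap.comp_apply, TensorProduct.map_tmul,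
    LinearMap.mul'_apply, TensorProduct.rid_tmul, LinearEquiv.coe_coe,
    TensorProduct.comm_tmul] at h''
  rw [act_eq_sum b₁ f₁, act_eq_sum b₂ f₂]
  simp only [Module.End.mul_apply, LinearMap.sum_apply, LinearMap.smul_apply, map_sum, map_smul,
    Finset.smul_sum, smul_smul]
  refine Eq.trans ?_ (h''.symm.trans ?_)
  · refine Finset.sum_congr rfl fun g _ => Finset.sum_congr rfl fun h _ => ?_
    rw [mul_comm]
  · rw [Finset.sum_comm]

end HalfBraidingAction

end Elliptic

namespace Elliptic
namespace EllipticDouble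

/-! ### The equivalence between the elliptic center and modules over the double. -/

section Functor

set_option linter.unusedSectionVars false

open WithConv

variable {k H : Type u} [Field k] [Ring H] [HopfAlgebra k H] [FiniteDimensional k H]
  [IsAlgClosed k] [CharZero k] [Coalgebra.IsCocomm k H]

/-! ### From half-braidings to modules -/

/-- The half-braidings of an object of the elliptic center. -/
def halfBraiding (Z : EllipticCenter (FDMod k H)) (i : Fin 2) : HalfBraiding Z.X :=
  if i = 0 then Z.b₁ else Z.b₂

/-- The data of the action of `D^el(H)` on an object of the elliptic center. -/
def centerData (Z : EllipticCenter (FDMod k H)) : LiftData k H (Module.End k Z.X.V) where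
  φ := Z.X.ρ
  ψ i := act (halfBraiding Z i)
  one _ := act_counit _
  mul _ f f' := act_conv _ f f'
  cross _ f g := act_cross _ f g
  comm f₁ f₂ := act_comm Z.comm f₁ f₂

/-- The module over `D^el(H)` given by an object of the elliptic center. -/
def centerModule (Z : EllipticCenter (FDMod k H)) : FDMod k (Del k H) where
  V := Z.X.V
  finite := Z.X.finite
  ρ := (centerData Z).lift

theorem centerModule_ιHom (Z : EllipticCenter (FDMod k H)) (h : H) :
    (centerModule Z).ρ (ιHom h) = Z.X.ρ h := LiftData.lift_ιHom _ _

theorem centerModule_ιDLin (Z : EllipticCenter (FDMod k H)) (i : Fin 2) (f : Module.Dual k H) :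
    (centerModule Z).ρ (ιDLin i f) = act (halfBraiding Z i) f := LiftData.lift_ιDLin _ _ _

/-- A linear map between modules over `D^el(H)` that commutes with the action of the generators is
a homomorphism. -/
theorem equivariant_of_generators {X Y : FDMod k (Del k H)} (f : X.V →ₗ[k] Y.V)
    (hι : ∀ (g : GroupLike k H) x, f (X.ρ (ιHom (g : H)) x) = Y.ρ (ιHom (g : H)) (f x))
    (hD : ∀ i (φ : Module.Dual k H) x, f (X.ρ (ιDLin i φ) x) = Y.ρ (ιDLin i φ) (f x))
    (d : Del k H) (x : X.V) : f (X.ρ d x) = Y.ρ d (f x) := by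
  suffices h : f ∘ₗ X.ρ d = Y.ρ d ∘ₗ f from LinearMap.congr_fun h x
  refine induction_generators (p := fun d => f ∘ₗ X.ρ d = Y.ρ d ∘ₗ f) ?_ ?_ ?_ ?_ d
  · refine LinearMap.congr_fun
      (f := LinearMap.llcomp k X.V X.V Y.V f ∘ₗ X.ρ.toLinearMap ∘ₗ ιHom.toLinearMap)
      (g := LinearMap.lcomp k Y.V f ∘ₗ Y.ρ.toLinearMap ∘ₗ ιHom.toLinearMap)
      (linearMap_ext_groupLike fun g => ?_)
    exact LinearMap.ext fun x => hι g x
  · intro i φ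
    exact LinearMap.ext fun x => hD i φ x
  · intro d d' hd hd'
    rw [map_add, map_add, LinearMap.comp_add, LinearMap.add_comp, hd, hd']
  · intro d d' hd hd'
    rw [map_mul, map_mul, Module.End.mul_eq_comp, Module.End.mul_eq_comp, ← LinearMap.comp_assoc,
      hd, LinearMap.comp_assoc, hd', LinearMap.comp_assoc]

/-- Only the intertwining condition at `A = H` on vectors `1 ⊗ x` is used: there it says that `f`
commutes with the coactions. -/
theorem act_hom {X Y : FDMod k H} (b : HalfBraiding X) (b' : HalfBraiding Y) (f : X ⟶ Y)
    (h : ∀ A, (lam b A).hom ≫ f ▷ A = A ◁ f ≫ (lam b' A).hom) (φ : Module.Dual k H) (x : X.V) :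
    f.hom (act b φ x) = act b' φ (f.hom x) := by
  have h1 : f.hom.hom.rTensor H (coact b x) = coact b' (f.hom x) :=
    congrArg (fun m : FDMod.regular k H ⊗ X ⟶ Y ⊗ FDMod.regular k H =>
      m.hom ((1 : H) ⊗ₜ[k] x : H ⊗[k] X.V)) (h (FDMod.regular k H))
  rw [act_apply, act_apply, ← h1]
  generalize coact b x = t
  induction t with
  | zero => simp
  | tmul y a => simp
  | add s t hs ht => simp only [map_add, hs, ht]

theorem centerHom_comm {Z W : EllipticCenter (FDMod k H)} (f : Z ⟶ W) (i : Fin 2)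
    (A : FDMod k H) : (lam (halfBraiding Z i) A).hom ≫ f.f ▷ A =
      A ◁ f.f ≫ (lam (halfBraiding W i) A).hom := by
  fin_cases i
  · exact f.comm₁ A
  · exact f.comm₂ A

variable (k H) in
/-- The functor from the elliptic center to modules over `D^el(H)`. -/
def centerFunctor : EllipticCenter (FDMod k H) ⥤ FDMod k (Del k H) where
  obj := centerModule
  map {Z W} f := ⟨f.f.hom, equivariant_of_generators (X := centerModule Z) (Y := centerModule W)
    f.f.hom.hom
    (fun g x => by
      rw [centerModule_ιHom, centerModule_ιHom]
      exact f.f.equivariant (g : H) x)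
    (fun i φ x => by
      rw [centerModule_ιDLin, centerModule_ιDLin]
      exact act_hom _ _ f.f (centerHom_comm f i) φ x)⟩

instance : (centerFunctor k H).Faithful where
  map_injective {Z W} f g h := by
    have h' : f.f.hom = g.f.hom := congrArg (fun m => (FDMod.forget k (Del k H)).map m) h
    exact EllipticCenter.hom_ext _ _ (FDMod.hom_ext _ _ h')

/-- By `lamLin_tmul` a half-braiding is recovered from its action of `H^*`, so commuting with that
action suffices for every `A`. This gives fullness. -/
theorem hom_comm_of_act {X Y : FDMod k H} (b : HalfBraiding X) (b' : HalfBraiding Y) (f : X ⟶ Y)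
    (h : ∀ (φ : Module.Dual k H) (x : X.V), f.hom (act b φ x) = act b' φ (f.hom x))
    (A : FDMod k H) : (lam b A).hom ≫ f ▷ A = A ◁ f ≫ (lam b' A).hom := by
  refine FDMod.hom_ext _ _ (ModuleCat.hom_ext (TensorProduct.ext' fun a x => ?_))
  change f.hom.hom.rTensor A.V (lamLin b A (a ⊗ₜ x)) = lamLin b' A (a ⊗ₜ f.hom x)
  rw [lamLin_tmul, lamLin_tmul, map_sum]
  refine Finset.sum_congr rfl fun g _ => ?_
  rw [LinearMap.rTensor_tmul, ← h]

instance : (centerFunctor k H).Full where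
  map_surjective {Z W} φ := by
    let f : Z.X ⟶ W.X := ⟨φ.hom, fun h x => by
      have := φ.equivariant (ιHom h) x
      change φ.hom ((centerModule Z).ρ (ιHom h) x) = (centerModule W).ρ (ιHom h) (φ.hom x) at this
      rwa [centerModule_ιHom, centerModule_ιHom] at this⟩
    have hact : ∀ (i : Fin 2) (ψ : Module.Dual k H) (x : Z.X.V),
        f.hom (act (halfBraiding Z i) ψ x) = act (halfBraiding W i) ψ (f.hom x) := by
      intro i ψ x
      have := φ.equivariant (ιDLin i ψ) x
      change φ.hom ((centerModule Z).ρ (ιDLin i ψ) x) =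
        (centerModule W).ρ (ιDLin i ψ) (φ.hom x) at this
      rwa [centerModule_ιDLin, centerModule_ιDLin] at this
    exact ⟨⟨f, hom_comm_of_act Z.b₁ W.b₁ f (hact 0), hom_comm_of_act Z.b₂ W.b₂ f (hact 1)⟩, rfl⟩

/-! ### From modules to half-braidings -/

section Module

variable (M : FDMod k (Del k H)) (i : Fin 2)

/-- The projection of a module over `D^el(H)` given by the functional dual to a group-like
element. -/
def proj (g : GroupLike k H) : Module.End k M.V := M.ρ (ιDLin i (delta g))

theorem sum_smul_proj (f : Module.Dual k H) :
    ∑ g : GroupLike k H, f (g : H) • proj M i g = M.ρ (ιDLin i f) := by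
  conv_rhs => rw [← dual_eq_sum_delta f]
  simp only [map_sum, map_smul]
  rfl

theorem sum_proj_apply (x : M.V) : ∑ g : GroupLike k H, proj M i g x = x := by
  have h := sum_smul_proj M i (Coalgebra.counit (R := k) (A := H))
  simp only [counit_groupLike, one_smul, ιDLin_counit, map_one] at h
  have := congrArg (fun m : Module.End k M.V => m x) h
  simpa using this

-- Distinct delta functions have product zero and each is idempotent. With `sum_proj_apply` this
-- makes `M` a `G`-graded space for each `i`.
open Classical in
theorem proj_proj (g h : GroupLike k H) (x : M.V) :
    proj M i g (proj M i h x) = if g = h then proj M i h x else 0 := by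
  have hm : (toConv (delta g) * toConv (delta h)).ofConv =
      if g = h then delta h else (0 : Module.Dual k H) := by
    refine linearMap_ext_groupLike fun y => ?_
    rw [conv_groupLike, delta_apply, delta_apply]
    split_ifs with h1 h2 h3 <;> simp_all [delta_apply]
  have h1 : proj M i g * proj M i h = M.ρ (ιDLin i (if g = h then delta h else 0)) := by
    rw [proj, proj, ← map_mul, ← ιDLin_mul, hm]
  rw [← Module.End.mul_apply, h1]
  split_ifs
  · rfl
  · simp

/-- This is the Yetter–Drinfeld condition: acting by `g` carries degree `h` to degree `g h g⁻¹`. -/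
theorem proj_ιHom (g h : GroupLike k H) (x : M.V) :
    proj M i (g * h * g⁻¹) (M.ρ (ιHom (g : H)) x) = M.ρ (ιHom (g : H)) (proj M i h x) := by
  classical
  have hd : conj g (delta (g * h * g⁻¹)) = (delta h : Module.Dual k H) := by
    refine linearMap_ext_groupLike fun y => ?_
    rw [conj_apply, delta_apply, delta_apply]
    simp
  rw [proj, proj, ← Module.End.mul_apply, ← Module.End.mul_apply, ← map_mul, ← map_mul,
    ιDLin_mul_ιHom, hd]

theorem proj_comm (g h : GroupLike k H) (x : M.V) :
    proj M 1 g (proj M 0 h x) = proj M 0 h (proj M 1 g x) := by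
  rw [proj, proj, ← Module.End.mul_apply, ← Module.End.mul_apply, ← map_mul, ← map_mul,
    ιDLin_comm]

/-- The map `x ⊗ a ↦ ∑ g⁻¹ a ⊗ p_g x`. -/
def braidLin (A : FDMod k H) : M.V ⊗[k] A.V →ₗ[k] A.V ⊗[k] M.V :=
  (∑ g : GroupLike k H, TensorProduct.map (A.ρ ((g⁻¹ : GroupLike k H) : H)) (proj M i g)) ∘ₗ
    (TensorProduct.comm k M.V A.V).toLinearMap

/-- The map `a ⊗ x ↦ ∑ p_g x ⊗ g a`. -/
def braidInvLin (A : FDMod k H) : A.V ⊗[k] M.V →ₗ[k] M.V ⊗[k] A.V :=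
  (∑ g : GroupLike k H, TensorProduct.map (proj M i g) (A.ρ (g : H))) ∘ₗ
    (TensorProduct.comm k A.V M.V).toLinearMap

theorem braidLin_tmul (A : FDMod k H) (x : M.V) (a : A.V) :
    braidLin M i A (x ⊗ₜ a) =
      ∑ g : GroupLike k H, A.ρ ((g⁻¹ : GroupLike k H) : H) a ⊗ₜ proj M i g x := by
  simp [braidLin]

theorem braidInvLin_tmul (A : FDMod k H) (x : M.V) (a : A.V) :
    braidInvLin M i A (a ⊗ₜ x) = ∑ g : GroupLike k H, proj M i g x ⊗ₜ A.ρ (g : H) a := by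
  simp [braidInvLin]

theorem ρ_inv_ρ (A : FDMod k H) (g : GroupLike k H) (a : A.V) :
    A.ρ ((g⁻¹ : GroupLike k H) : H) (A.ρ (g : H) a) = a := by
  rw [← Module.End.mul_apply, ← map_mul, groupLike_inv_mul, map_one, Module.End.one_apply]

theorem ρ_ρ_inv (A : FDMod k H) (g : GroupLike k H) (a : A.V) :
    A.ρ (g : H) (A.ρ ((g⁻¹ : GroupLike k H) : H) a) = a := by
  rw [← Module.End.mul_apply, ← map_mul, groupLike_mul_inv, map_one, Module.End.one_apply]

/-- The map `x ⊗ a ↦ ∑ g⁻¹ a ⊗ p_g x` is invertible. -/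
def braidEquiv (A : FDMod k H) : M.V ⊗[k] A.V ≃ₗ[k] A.V ⊗[k] M.V :=
  LinearEquiv.ofLinearMap (braidLin M i A) (braidInvLin M i A)
    (TensorProduct.ext' fun a x => by
      classical
      rw [LinearMap.comp_apply, braidInvLin_tmul, map_sum, LinearMap.id_apply]
      simp only [braidLin_tmul, proj_proj, TensorProduct.tmul_ite,
        Finset.sum_ite_eq', Finset.mem_univ, if_true, ρ_inv_ρ, ← TensorProduct.tmul_sum,
        sum_proj_apply])
    (TensorProduct.ext' fun x a => by
      classical
      rw [LinearMap.comp_apply, braidLin_tmul, map_sum, LinearMap.id_apply]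
      simp only [braidInvLin_tmul, proj_proj, TensorProduct.ite_tmul,
        Finset.sum_ite_eq', Finset.mem_univ, if_true, ρ_ρ_inv, ← TensorProduct.sum_tmul,
        sum_proj_apply])

theorem equivariant_of_groupLike {X Y : FDMod k H} (f : X.V →ₗ[k] Y.V)
    (hf : ∀ (g : GroupLike k H) x, f (X.ρ (g : H) x) = Y.ρ (g : H) (f x))
    (h : H) (x : X.V) : f (X.ρ h x) = Y.ρ h (f x) := by
  have := linearMap_ext_groupLike
    (φ := LinearMap.llcomp k X.V X.V Y.V f ∘ₗ X.ρ.toLinearMap)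
    (ψ := LinearMap.lcomp k Y.V f ∘ₗ Y.ρ.toLinearMap) fun g => LinearMap.ext fun x => hf g x
  exact LinearMap.congr_fun (LinearMap.congr_fun this h) x

theorem braidLin_equivariant (A : FDMod k H) (h : H) (t : M.V ⊗[k] A.V) :
    braidLin M i A ((restrict M ⊗ A).ρ h t) = (A ⊗ restrict M).ρ h (braidLin M i A t) := by
  refine equivariant_of_groupLike (X := restrict M ⊗ A) (Y := A ⊗ restrict M) (braidLin M i A)
    (fun g => LinearMap.congr_fun (f := braidLin M i A ∘ₗ (restrict M ⊗ A).ρ (g : H))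
      (g := (A ⊗ restrict M).ρ (g : H) ∘ₗ braidLin M i A)
      (TensorProduct.ext' fun (x : M.V) a => ?_)) h t
  change braidLin M i A ((restrict M ⊗ A).ρ (g : H) (x ⊗ₜ[k] a : M.V ⊗[k] A.V)) =
    (A ⊗ restrict M).ρ (g : H) (braidLin M i A (x ⊗ₜ a))
  refine (congrArg (braidLin M i A) (tensor_ρ_groupLike (restrict M) A g x a)).trans ?_
  refine (braidLin_tmul M i A _ _).trans ?_
  rw [braidLin_tmul]
  refine Eq.trans ?_ (map_sum ((A ⊗ restrict M).ρ (g : H)) _ _).symm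
  -- The two sums are matched by reindexing the degree `h` as `g h g⁻¹`.
  refine (Fintype.sum_equiv (MulAut.conj g).toEquiv _ _ fun h => ?_).symm
  refine (tensor_ρ_groupLike A (restrict M) g _ _).trans ?_
  change A.ρ (g : H) (A.ρ ((h⁻¹ : GroupLike k H) : H) a) ⊗ₜ[k] M.ρ (ιHom (g : H)) (proj M i h x) =
    A.ρ (((g * h * g⁻¹)⁻¹ : GroupLike k H) : H) (A.ρ (g : H) a) ⊗ₜ[k]
      proj M i (g * h * g⁻¹) (M.ρ (ιHom (g : H)) x)
  rw [proj_ιHom]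
  refine congrArg (fun w : A.V => w ⊗ₜ[k] M.ρ (ιHom (g : H)) (proj M i h x)) ?_
  rw [← Module.End.mul_apply, ← Module.End.mul_apply, ← map_mul, ← map_mul,
    ← GroupLike.val_mul, ← GroupLike.val_mul]
  congr 3
  group

/-- The isomorphism `x ⊗ a ↦ ∑ g⁻¹ a ⊗ p_g x` of modules over `H`. -/
def braidIso (A : FDMod k H) : restrict M ⊗ A ≅ A ⊗ restrict M :=
  FDMod.isoMk (X := restrict M ⊗ A) (Y := A ⊗ restrict M) (braidEquiv M i A).toModuleIso
    (braidLin_equivariant M i A)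

/-- The half-braidings of a module over `D^el(H)`. -/
def moduleHalfBraiding : HalfBraiding (restrict M) where
  β := braidIso M i
  monoidal U V := by
    refine FDMod.hom_ext _ _ (ModuleCat.hom_ext (TensorProduct.ext (LinearMap.ext fun (x : M.V) =>
      TensorProduct.ext' fun a b => ?_)))
    change braidLin M i (U ⊗ V) (x ⊗ₜ (a ⊗ₜ[k] b : U.V ⊗[k] V.V)) =
      (TensorProduct.assoc k U.V V.V M.V).symm ((braidLin M i V).lTensor U.V
        (TensorProduct.assoc k U.V M.V V.V (braidLin M i U (x ⊗ₜ a) ⊗ₜ b)))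
    classical
    refine (braidLin_tmul M i (U ⊗ V) _ _).trans ?_
    rw [braidLin_tmul, TensorProduct.sum_tmul, map_sum, map_sum, map_sum]
    refine Finset.sum_congr rfl fun g _ => ?_
    rw [TensorProduct.assoc_tmul, LinearMap.lTensor_tmul, braidLin_tmul]
    -- Orthogonality of the projections leaves the diagonal of the double sum, which is how the
    -- group-like `g⁻¹` acts on `U ⊗ V`.
    simp only [proj_proj, TensorProduct.tmul_ite,
      Finset.sum_ite_eq', Finset.mem_univ, if_true]
    rw [TensorProduct.assoc_symm_tmul]
    exact congrArg (fun w : U.V ⊗[k] V.V => (w ⊗ₜ[k] proj M i g x : (U.V ⊗[k] V.V) ⊗[k] M.V))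
      (tensor_ρ_groupLike U V g⁻¹ a b)
  naturality {U V} f := by
    refine FDMod.hom_ext _ _ (ModuleCat.hom_ext (TensorProduct.ext' fun (x : M.V) a => ?_))
    change braidLin M i V (x ⊗ₜ f.hom a) = f.hom.hom.rTensor M.V (braidLin M i U (x ⊗ₜ a))
    rw [braidLin_tmul, braidLin_tmul, map_sum]
    refine Finset.sum_congr rfl fun g _ => ?_
    rw [← f.equivariant]
    rfl

theorem act_moduleHalfBraiding (f : Module.Dual k H) :
    act (moduleHalfBraiding M i) f = M.ρ (ιDLin i f) := by
  refine LinearMap.ext fun (x : M.V) => ?_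
  change TensorProduct.rid k M.V (f.lTensor M.V
    (braidInvLin M i (FDMod.regular k H) ((1 : H) ⊗ₜ x))) = (M.ρ (ιDLin i f) : Module.End k M.V) x
  have h : braidInvLin M i (FDMod.regular k H) ((1 : H) ⊗ₜ x) =
      (∑ g : GroupLike k H, proj M i g x ⊗ₜ (g : H) : M.V ⊗[k] H) := by
    refine (braidInvLin_tmul M i (FDMod.regular k H) x (1 : H)).trans ?_
    refine Finset.sum_congr rfl fun g _ => ?_
    exact congrArg (fun w : H => (proj M i g x ⊗ₜ[k] w : M.V ⊗[k] H)) (mul_one (g : H))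
  rw [h, ← sum_smul_proj, LinearMap.sum_apply]
  simp only [map_sum, LinearMap.lTensor_tmul, TensorProduct.rid_tmul, LinearMap.smul_apply]

/-- Expanded in projections, the two sides differ only in the order of a projection from each copy,
and these commute. -/
theorem comm_moduleHalfBraiding : Comm (moduleHalfBraiding M 0) (moduleHalfBraiding M 1) := by
  intro A B
  refine FDMod.hom_ext _ _ (ModuleCat.hom_ext (TensorProduct.ext (LinearMap.ext fun a =>
    TensorProduct.ext' fun b (x : M.V) => ?_)))
  change (TensorProduct.comm k A.V B.V).toLinearMap.lTensor M.V (TensorProduct.assoc k M.V A.V B.V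
      ((braidInvLin M 0 A).rTensor B.V ((TensorProduct.assoc k A.V M.V B.V).symm
        (a ⊗ₜ braidInvLin M 1 B (b ⊗ₜ x))))) =
    TensorProduct.assoc k M.V B.V A.V ((braidInvLin M 1 B).rTensor A.V
      ((TensorProduct.assoc k B.V M.V A.V).symm (b ⊗ₜ braidInvLin M 0 A (a ⊗ₜ x))))
  simp only [braidInvLin_tmul, TensorProduct.tmul_sum, map_sum, TensorProduct.assoc_symm_tmul,
    LinearMap.rTensor_tmul, TensorProduct.sum_tmul, TensorProduct.assoc_tmul,
    LinearMap.lTensor_tmul, LinearEquiv.coe_coe, TensorProduct.comm_tmul]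
  rw [Finset.sum_comm]
  simp only [proj_comm]

end Module

/-- The object of the elliptic center given by a module over `D^el(H)`. -/
def moduleCenter (M : FDMod k (Del k H)) : EllipticCenter (FDMod k H) where
  X := restrict M
  b₁ := moduleHalfBraiding M 0
  b₂ := moduleHalfBraiding M 1
  comm := comm_moduleHalfBraiding M

theorem act_moduleCenter (M : FDMod k (Del k H)) (i : Fin 2) (f : Module.Dual k H) :
    act (halfBraiding (moduleCenter M) i) f = M.ρ (ιDLin i f) := by
  fin_cases i
  · exact act_moduleHalfBraiding M 0 f
  · exact act_moduleHalfBraiding M 1 f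

/-- Every module over `D^el(H)` comes from an object of the elliptic center. -/
def moduleCenterIso (M : FDMod k (Del k H)) : (centerFunctor k H).obj (moduleCenter M) ≅ M :=
  FDMod.isoMk (X := centerModule (moduleCenter M)) (Y := M) (Iso.refl M.V)
    (equivariant_of_generators (X := centerModule (moduleCenter M)) (Y := M) LinearMap.id
      (fun g x => by
        rw [centerModule_ιHom]
        rfl)
      (fun i f x => by
        rw [centerModule_ιDLin, act_moduleCenter]
        rfl))

instance : (centerFunctor k H).EssSurj where
  mem_essImage M := ⟨moduleCenter M, ⟨moduleCenterIso M⟩⟩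

instance : (centerFunctor k H).IsEquivalence where

end Functor

end EllipticDouble
end Elliptic

namespace Elliptic
namespace EllipticDouble

/-! ### The naive tensor product matches the coproduct of the double. -/

section MonoidalFunctor

set_option linter.unusedSectionVars false

variable {k H : Type u} [Field k] [Ring H] [HopfAlgebra k H] [FiniteDimensional k H]
  [IsAlgClosed k] [CharZero k] [Coalgebra.IsCocomm k H]

/-! ### The tensor structure -/

theorem tensor_ρ_ιHom (X Y : FDMod k (Del k H)) (g : GroupLike k H) (x : X.V) (y : Y.V) :
    (X ⊗ Y).ρ (ιHom (g : H)) (x ⊗ₜ[k] y : X.V ⊗[k] Y.V) =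
      X.ρ (ιHom (g : H)) x ⊗ₜ[k] Y.ρ (ιHom (g : H)) y := by
  let r : Coalgebra.Repr k (ιHom (g : H) : Del k H) Unit :=
    { index := {()}, left := fun _ => ιHom (g : H), right := fun _ => ιHom (g : H)
      eq := by rw [Finset.sum_singleton, comul_eq, comulHom_ιHom] }
  exact (FDMod.tensor_ρ X Y r x y).trans (Finset.sum_singleton _ _)

/-- The coproduct of `f` is the function `(a, b) ↦ f(ba)`, so vectors of degrees `g` and `h` have
tensor product of degree `h g`. -/
theorem tensor_ρ_ιDLin (X Y : FDMod k (Del k H)) (i : Fin 2) (f : Module.Dual k H) (x : X.V)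
    (y : Y.V) :
    (X ⊗ Y).ρ (ιDLin i f) (x ⊗ₜ[k] y : X.V ⊗[k] Y.V) =
      (∑ g : GroupLike k H, ∑ h : GroupLike k H,
        f ((h * g : GroupLike k H) : H) • (proj X i g x ⊗ₜ proj Y i h y) : X.V ⊗[k] Y.V) := by
  have h : ∀ u : DualCop k H ⊗[k] DualCop k H,
      Module.endTensorEndAlgHom (R := k) (S := k) (A := k)
        (Algebra.TensorProduct.map X.ρ Y.ρ (ιSq k H i u)) (x ⊗ₜ[k] y) =
      ∑ g : GroupLike k H, ∑ h : GroupLike k H,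
        eval₂ (g : H) (h : H) u • (proj X i g x ⊗ₜ[k] proj Y i h y) := by
    intro u
    induction u using dualCop_tensor_induction with
    | h0 => simp
    | hadd s t hs ht =>
      simp only [map_add, LinearMap.add_apply, hs, ht, add_smul, Finset.sum_add_distrib]
    | htmul f f' =>
      change X.ρ (ιDLin i f) x ⊗ₜ[k] Y.ρ (ιDLin i f') y = _
      rw [← sum_smul_proj, ← sum_smul_proj]
      simp only [LinearMap.sum_apply, LinearMap.smul_apply, TensorProduct.sum_tmul,
        ← TensorProduct.smul_tmul']
      refine Finset.sum_congr rfl fun g _ => ?_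
      rw [TensorProduct.tmul_sum, Finset.smul_sum]
      refine Finset.sum_congr rfl fun h _ => ?_
      rw [TensorProduct.tmul_smul, smul_smul, eval₂_tmul, cop_apply, cop_apply]
  refine Eq.trans ?_ ((h (Coalgebra.comul (R := k) (cop k H f))).trans ?_)
  · change Module.endTensorEndAlgHom (R := k) (S := k) (A := k)
      (Algebra.TensorProduct.map X.ρ Y.ρ (comulHom k H (ιDLin i f))) (x ⊗ₜ[k] y) = _
    rw [comulHom_ιDLin]
  · simp only [eval₂_comul_groupLike]

/-- The unit of `H` first passes `X`, becoming `g`, and then `Y`, becoming `h g`. This order is what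
forces the co-opposite coproduct on `H^*`. -/
theorem coact_tensorHB {X Y : FDMod k H} (b : HalfBraiding X) (b' : HalfBraiding Y)
    (x : X.V) (y : Y.V) :
    (coact (X := X ⊗ Y) (EllipticCenter.tensorHB b b') (x ⊗ₜ[k] y : X.V ⊗[k] Y.V) :
        (X.V ⊗[k] Y.V) ⊗[k] H) =
      ∑ g : GroupLike k H, ∑ h : GroupLike k H,
        (act b (delta g) x ⊗ₜ act b' (delta h) y) ⊗ₜ ((h * g : GroupLike k H) : H) := by
  have h := congrArg (fun m : FDMod.regular k H ⊗ (X ⊗ Y) ⟶ (X ⊗ Y) ⊗ FDMod.regular k H =>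
    m.hom ((1 : H) ⊗ₜ[k] (x ⊗ₜ[k] y) : H ⊗[k] (X.V ⊗[k] Y.V)))
      (EllipticCenter.lam_tensorHB b b' (FDMod.regular k H))
  refine Eq.trans h ?_
  change (TensorProduct.assoc k X.V Y.V H).symm ((lamReg b').lTensor X.V
    (TensorProduct.assoc k X.V H Y.V (coact b x ⊗ₜ y))) = _
  rw [coact_eq_sum, TensorProduct.sum_tmul, map_sum, map_sum, map_sum]
  refine Finset.sum_congr rfl fun g _ => ?_
  have h2 : lamReg b' ((g : H) ⊗ₜ y) =
      ∑ h : GroupLike k H, act b' (delta h) y ⊗ₜ ((h * g : GroupLike k H) : H) :=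
    lamLin_tmul b' (FDMod.regular k H) (g : H) y
  rw [TensorProduct.assoc_tmul, LinearMap.lTensor_tmul, h2, TensorProduct.tmul_sum, map_sum]
  rfl

theorem act_tensorHB {X Y : FDMod k H} (b : HalfBraiding X) (b' : HalfBraiding Y)
    (f : Module.Dual k H) (x : X.V) (y : Y.V) :
    act (X := X ⊗ Y) (EllipticCenter.tensorHB b b') f (x ⊗ₜ[k] y : X.V ⊗[k] Y.V) =
      (∑ g : GroupLike k H, ∑ h : GroupLike k H,
        f ((h * g : GroupLike k H) : H) • (act b (delta g) x ⊗ₜ act b' (delta h) y) :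
          X.V ⊗[k] Y.V) := by
  let L : (X.V ⊗[k] Y.V) ⊗[k] H →ₗ[k] X.V ⊗[k] Y.V :=
    (TensorProduct.rid k (X.V ⊗[k] Y.V)).toLinearMap ∘ₗ f.lTensor (X.V ⊗[k] Y.V)
  refine (congrArg L (coact_tensorHB b b' x y)).trans ((map_sum L _ _).trans ?_)
  exact Finset.sum_congr rfl fun g _ => map_sum L _ _

theorem halfBraiding_tensor (Z W : EllipticCenter (FDMod k H)) (i : Fin 2) :
    halfBraiding (Z ⊗ W) i =
      EllipticCenter.tensorHB (halfBraiding Z i) (halfBraiding W i) := by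
  fin_cases i <;> rfl

theorem halfBraiding_unit (i : Fin 2) :
    halfBraiding (𝟙_ (EllipticCenter (FDMod k H))) i = EllipticCenter.unitHB (FDMod k H) := by
  fin_cases i <;> rfl

theorem proj_centerModule (Z : EllipticCenter (FDMod k H)) (i : Fin 2) (g : GroupLike k H) :
    proj (centerModule Z) i g = act (halfBraiding Z i) (delta g) := centerModule_ιDLin Z i _

/-- The identity as an isomorphism `F(Z) ⊗ F(W) ≅ F(Z ⊗ W)`. -/
def tensorIso (Z W : EllipticCenter (FDMod k H)) :
    centerModule Z ⊗ centerModule W ≅ centerModule (Z ⊗ W) :=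
  FDMod.isoMk (X := centerModule Z ⊗ centerModule W) (Y := centerModule (Z ⊗ W))
    (Iso.refl (ModuleCat.of k (Z.X.V ⊗[k] W.X.V)))
    (equivariant_of_generators (X := centerModule Z ⊗ centerModule W)
      (Y := centerModule (Z ⊗ W)) (LinearMap.id : Z.X.V ⊗[k] W.X.V →ₗ[k] Z.X.V ⊗[k] W.X.V)
      (fun g t => by
        refine LinearMap.congr_fun (f := (centerModule Z ⊗ centerModule W).ρ (ιHom (g : H)))
          (g := (centerModule (Z ⊗ W)).ρ (ιHom (g : H)))
          (TensorProduct.ext' fun (x : Z.X.V) (y : W.X.V) => ?_) t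
        refine (tensor_ρ_ιHom (centerModule Z) (centerModule W) g x y).trans ?_
        rw [centerModule_ιHom, centerModule_ιHom, centerModule_ιHom]
        exact (tensor_ρ_groupLike Z.X W.X g x y).symm)
      (fun i f t => by
        refine LinearMap.congr_fun (f := (centerModule Z ⊗ centerModule W).ρ (ιDLin i f))
          (g := (centerModule (Z ⊗ W)).ρ (ιDLin i f))
          (TensorProduct.ext' fun (x : Z.X.V) (y : W.X.V) => ?_) t
        refine (tensor_ρ_ιDLin (centerModule Z) (centerModule W) i f x y).trans ?_
        rw [centerModule_ιDLin, halfBraiding_tensor]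
        simp only [proj_centerModule]
        exact (act_tensorHB (halfBraiding Z i) (halfBraiding W i) f x y).symm))

/-- The trivial half-braiding sends `1 ⊗ c` to `1 ⊗ c • 1`, so the unit object is concentrated in
degree `1`, matching the counit `f ↦ f(1)`. -/
theorem act_unitHB (f : Module.Dual k H) (c : k) :
    act (EllipticCenter.unitHB (FDMod k H)) f c = f 1 * c := by
  have h : (lam (EllipticCenter.unitHB (FDMod k H)) (FDMod.regular k H)).hom =
      (ρ_ (FDMod.regular k H)).hom ≫ (λ_ (FDMod.regular k H)).inv := by
    simp [lam, EllipticCenter.unitHB, Center.tensorUnit]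
  have h' : coact (EllipticCenter.unitHB (FDMod k H)) c = ((1 : k) ⊗ₜ[k] (c • (1 : H)) :
      k ⊗[k] H) :=
    congrArg (fun m : FDMod.regular k H ⊗ 𝟙_ (FDMod k H) ⟶ 𝟙_ (FDMod k H) ⊗ FDMod.regular k H =>
      m.hom ((1 : H) ⊗ₜ[k] c : H ⊗[k] k)) h
  refine (congrArg (fun t => TensorProduct.rid k k (f.lTensor k t)) h').trans ?_
  change f (c • 1) • (1 : k) = _
  rw [map_smul, smul_eq_mul, smul_eq_mul, mul_one, mul_comm]

variable (k H) in
/-- The identity as an isomorphism of the unit with the image of the unit. -/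
def unitIso : 𝟙_ (FDMod k (Del k H)) ≅ centerModule (𝟙_ (EllipticCenter (FDMod k H))) :=
  FDMod.isoMk (X := 𝟙_ (FDMod k (Del k H))) (Y := centerModule (𝟙_ (EllipticCenter (FDMod k H))))
    (Iso.refl (ModuleCat.of k k))
    (equivariant_of_generators (X := 𝟙_ (FDMod k (Del k H)))
      (Y := centerModule (𝟙_ (EllipticCenter (FDMod k H)))) (LinearMap.id : k →ₗ[k] k)
      (fun g (c : k) => by
        rw [centerModule_ιHom]
        exact congrArg (fun w : k => w * c) (counitHom_ιHom (g : H)))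
      (fun i f (c : k) => by
        rw [centerModule_ιDLin, halfBraiding_unit]
        exact (congrArg (fun w : k => w * c) (counitHom_ιDLin i f)).trans
          (act_unitHB f c).symm))

variable (k H) in
/-- The tensor structure on the functor from the elliptic center to modules over `D^el(H)`. -/
def centerFunctorCoreMonoidal : (centerFunctor k H).CoreMonoidal where
  εIso := unitIso k H
  μIso := tensorIso
  -- All structure maps are identities on vector spaces, so naturality and the coherence axioms hold
  -- by definition once tested on pure tensors.
  μIso_hom_natural_left _ _ := FDMod.hom_ext _ _ rfl
  μIso_hom_natural_right _ _ := FDMod.hom_ext _ _ rfl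
  associativity X Y Z := FDMod.hom_ext _ _ (ModuleCat.hom_ext
    (TensorProduct.ext_threefold (R := k) (M := X.X.V) (N := Y.X.V) (P := Z.X.V)
      fun _ _ _ => rfl))
  left_unitality X := FDMod.hom_ext _ _ (ModuleCat.hom_ext
    (TensorProduct.ext' (R := k) (M := k) (N := X.X.V) fun _ _ => rfl))
  right_unitality X := FDMod.hom_ext _ _ (ModuleCat.hom_ext
    (TensorProduct.ext' (R := k) (M := X.X.V) (N := k) fun _ _ => rfl))

instance : (centerFunctor k H).Monoidal := (centerFunctorCoreMonoidal k H).toMonoidal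

variable (k H) in
/-- The functor from the elliptic center to modules over `D^el(H)` is the identity on underlying
vector spaces. -/
def centerFunctorForget : centerFunctor k H ⋙ FDMod.forget k (Del k H) ≅
    EllipticCenter.forget (FDMod k H) ⋙ FDMod.forget k H :=
  NatIso.ofComponents (fun Z => Iso.refl Z.X.V) fun _ => rfl

instance : NatTrans.IsMonoidal (centerFunctorForget k H).hom where
  unit := rfl
  tensor X Y := ModuleCat.hom_ext
    (TensorProduct.ext' (R := k) (M := X.X.V) (N := Y.X.V) fun _ _ => rfl)

end MonoidalFunctor

end EllipticDouble
end Elliptic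

end

/-! ### Assembly of the theorem. -/

open Elliptic
theorem mainTheorem9 {k H : Type u} [Field k] [IsAlgClosed k] [CharZero k] [Ring H]
    [HopfAlgebra k H] [FiniteDimensional k H] [Coalgebra.IsCocomm k H] :
    ∃ s : HopfStructure k (Del k H),
      letI := s.toHopfAlgebra
      (∃ e : H ⊗[k] (DualCop k H ⊗[k] DualCop k H) ≃ₗc[k] Del k H,
        ∀ (h : H) (f₁ f₂ : DualCop k H),
          e (h ⊗ₜ[k] (f₁ ⊗ₜ[k] f₂)) =
            EllipticDouble.ι _ h * EllipticDouble.ιD _ 0 f₁ * EllipticDouble.ιD _ 1 f₂) ∧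
      (∀ (h : H) (f₁ f₂ : Module.Dual k H),
        HopfAlgebra.antipode k (EllipticDouble.ι ((1 : H) ⊗ₜ[k] (1 : H)) h *
            EllipticDouble.ιD _ 0 f₁ * EllipticDouble.ιD _ 1 f₂) =
          EllipticDouble.ιD _ 1 (f₂ ∘ₗ antipodeInv k H) *
            EllipticDouble.ιD _ 0 (f₁ ∘ₗ antipodeInv k H) *
            EllipticDouble.ι _ (HopfAlgebra.antipode k h)) ∧
      (∀ v : H, IsPivotal k v → IsPivotal k (EllipticDouble.ι ((1 : H) ⊗ₜ[k] (1 : H)) v)) ∧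
      (∀ v : H, IsSpherical k v → IsSpherical k (EllipticDouble.ι ((1 : H) ⊗ₜ[k] (1 : H)) v)) ∧
      ∃ (F : EllipticCenter (FDMod k H) ⥤ FDMod k (Del k H))
        (_ : F.Monoidal)
        (α : F ⋙ FDMod.forget k (Del k H) ≅
          EllipticCenter.forget (FDMod k H) ⋙ FDMod.forget k H),
        F.IsEquivalence ∧ NatTrans.IsMonoidal α.hom ∧
        ∀ (Z : EllipticCenter (FDMod k H)) (x : (F.obj Z).V),
          (∀ h : H, α.hom.app Z ((F.obj Z).ρ (EllipticDouble.ι _ h) x) =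
            Z.X.ρ h (α.hom.app Z x)) ∧
          (∀ f : Module.Dual k H, α.hom.app Z ((F.obj Z).ρ (EllipticDouble.ιD _ 0 f) x) =
            dualAction (Z.lam₁ (FDMod.regular k H)).hom f (α.hom.app Z x)) ∧
          (∀ f : Module.Dual k H, α.hom.app Z ((F.obj Z).ρ (EllipticDouble.ιD _ 1 f) x) =
            dualAction (Z.lam₂ (FDMod.regular k H)).hom f (α.hom.app Z x)) := by
  refine ⟨EllipticDouble.hopfStructure k H, ⟨EllipticDouble.mulCoalgEquiv k H, fun h f₁ f₂ => ?_⟩,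
    fun h f₁ f₂ => ?_, fun v hv => EllipticDouble.isPivotal_ιHom hv,
    fun v hv => EllipticDouble.isSpherical_ιHom hv, EllipticDouble.centerFunctor k H, inferInstance,
    EllipticDouble.centerFunctorForget k H, inferInstance, inferInstance,
    fun Z x => ⟨fun h => ?_, fun f => ?_, fun f => ?_⟩⟩
  · exact (congrArg₂ (fun a b => EllipticDouble.ιHom h * (a * b)) (EllipticDouble.ιDLin_apply 0 f₁)
      (EllipticDouble.ιDLin_apply 1 f₂)).trans (mul_assoc _ _ _).symm
  · change EllipticDouble.antipodeLin k H _ = _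
    -- With `S⁻¹ = S` the claim is anti-multiplicativity together with the values of the antipode on
    -- the three kinds of generators.
    rw [antipodeInv_eq, EllipticDouble.antipodeLin_mul, EllipticDouble.antipodeLin_mul,
      ← EllipticDouble.ιDLin_apply, ← EllipticDouble.ιDLin_apply, ← EllipticDouble.ιHom_apply,
      EllipticDouble.antipodeLin_ιHom, EllipticDouble.antipodeLin_ιDLin,
      EllipticDouble.antipodeLin_ιDLin, ← EllipticDouble.ιDLin_apply, ← EllipticDouble.ιDLin_apply,
      ← EllipticDouble.ιHom_apply, mul_assoc]
    rfl
  · exact LinearMap.congr_fun (EllipticDouble.centerModule_ιHom Z h) x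
  · rw [← EllipticDouble.ιDLin_apply]
    exact LinearMap.congr_fun (EllipticDouble.centerModule_ιDLin Z 0 f) x
  · rw [← EllipticDouble.ιDLin_apply]
    exact LinearMap.congr_fun (EllipticDouble.centerModule_ιDLin Z 1 f) x
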